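/- Let $n \ge 2$, and let $B^d$ be the closed unit ball of $\mathbb{R}^d$. A *Hörmander-type operator* $T^\lambda$ is given by a scale $\lambda\ge 1$, a non-negative amplitude $a\in C_c^\infty(\mathbb{R}^n\times\mathbb{R}^{n-1})$ supported in $B^n\times B^{n-1}$ and a smooth phase $\phi\colon B^n\times B^{n-1}\to\mathbb{R}$ such that - H1) $\operatorname{rank}\partial^2_{\omega x}\phi(x;\omega)=n-1$ for all $(x;\omega)\in B^n\times B^{n-1}$; - H2) with $G_0(x;\omega):=\bigwedge_{j=1}^{n-1}\partial_{\omega_j}\partial_x\phi(x;\omega)$ (identified with a vector of $\mathbb{R}^n$) and $G:=G_0/|G_0|$, one has $\det\partial^2_{\omega\omega}\langle\partial_x\phi(x;\omega),G(x;\omega_0)\rangle|_{\omega=\omega_0}\ne0$ for all $(x;\omega_0)\in\operatorname{supp}a$; and $T^\lambda f(x):=\int_{B^{n-1}}e^{2\pi i\lambda\phi(x/\lambda;\omega)}a(x/\lambda;\omega)f(\omega)\,d\omega$. For $N\in\mathbb{N}$ let $\|a\|_{C^N}$ be the supremum of the derivatives of $a$ of order at most $N$. A tuple $(T_1^\lambda,\dots,T_k^\lambda)$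 of such operators (with a common $\lambda$) is *$\nu$-transverse*, $0<\nu\le1$, if $|\bigwedge_{j=1}^kG_j(x;\omega_j)|\ge\nu$ whenever $(x;\omega_j)\in\operatorname{supp}a_j$ for all $1\le j\le k$. **$k$-broad norms.** Let $K\ge1$, $M\in\mathbb{N}$. Let $B^{n-1}$ be covered by finitely many balls $\tau$ of radius $K^{-1}$ ("caps"), at most $M$ of which share a point, and let $f_\tau:=\psi_\tau f$, where the $\psi_\tau\ge0$ are measurable, $\psi_\tau$ is supported in $\tau$ and $\sum_\tau\psi_\tau=1$ on $B^{n-1}$. Let $\mathcal{B}_{K^2}$ be a finite collection of balls of radius $K^2$ which are centred in and cover $B(0,\lambda)$, at most $M$ of which share a point. For a cap $\tau$, a point $\bar x$ and a subspace $V\subseteq\mathbb{R}^n$ let $\angle(G^\lambda(\bar x;\tau),V)$ be the smallest angle between a non-zero vector of $V$ and a vector $G(\bar x/\lambda;\omega)$ with $\omega\in\tau$, $(\bar x/\lambda;\omega)\in\operatorname{supp}a$ (and $\infty$ if there is no such pair). For $B\in\mathcal{B}_{K^2}$ with centre $\bar x$ let $$\mu_{T^\lambda f}(B):=\min_{V\in\mathrm{Gr}(k-1,n)}\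 \max_{\tau:\ \angle(G^\lambda(\bar x;\tau),V)>K^{-1}}\|T^\lambda f_\tau\|^p_{L^p(B)},\qquad \|T^\lambda f\|_{\mathrm{BL}^p_{k,1}(U)}:=\Big(\sum_{B\in\mathcal{B}_{K^2},\,B\cap U\ne\emptyset}\mu_{T^\lambda f}(B)\Big)^{1/p}.$$ **Proposition.** Let $2\le k\le n$ and $\varepsilon>0$, and let $C_\varepsilon,R_\varepsilon\in\mathbb{R}$ and $N_\varepsilon\in\mathbb{N}$. There are $C'_\varepsilon\in\mathbb{R}$ and $N'_\varepsilon\in\mathbb{N}$, depending only on $n,k,\varepsilon,C_\varepsilon,R_\varepsilon,N_\varepsilon$, such that the following holds for all $2\le p<\infty$. Let $\mathcal{T}$ be a class of Hörmander-type operators such that - $\mathcal{T}$ is closed under translation: if $T^\lambda\in\mathcal{T}$ and $b\in\mathbb{R}^n$, and the translate $f\mapsto T^\lambda f(\cdot+b)$, with phase $\phi(x+b/\lambda;\omega)$ and amplitude $a(x+b/\lambda;\omega)$, is a Hörmander-type operator, then it belongs to $\mathcal{T}$; - $\mathcal{T}$ is closed under localisation of the amplitude: if $T^\lambda\in\mathcal{T}$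 has phase $\phi$ and amplitude $a$, then each Hörmander-type operator with the same $\lambda$ and $\phi$ and with an amplitude supported in $\operatorname{supp}a$ belongs to $\mathcal{T}$. Suppose that for all phases $\phi_1,\dots,\phi_k$ there is a constant $C$ such that $$\Big\|\prod_{j=1}^k|T_j^\lambda f_j|^{1/k}\Big\|_{L^p(B_R)}\le C\,\nu^{-C_\varepsilon}R^\varepsilon\prod_{j=1}^k\big(\|a_j\|_{C^{N_\varepsilon}}\|f_j\|_{L^2(B^{n-1})}\big)^{1/k}$$ holds for all $\nu\in(0,1]$, all $\nu$-transverse $(T_1^\lambda,\dots,T_k^\lambda)\in\mathcal{T}^k$ with phases $\phi_1,\dots,\phi_k$ and amplitudes $a_1,\dots,a_k$, all $\max(1,R_\varepsilon)\le R\le\lambda$, all balls $B_R\subset\mathbb{R}^n$ of radius $R$ and all $f_1,\dots,f_k\in L^2(B^{n-1})$. Then for all $M$ and each phase $\phi$ there is a constant $C$ such that $$\|T^\lambda f\|_{\mathrm{BL}^p_{k,1}(B_R)}\le C\,K^{C'_\varepsilon}R^\varepsilon\,\|a\|_{C^{N'_\varepsilon}}\|f\|_{L^2(B^{n-1})}$$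 holds for all $T^\lambda\in\mathcal{T}$ with phase $\phi$ and amplitude $a$, all $1\le R\le\lambda$, all balls $B_R\subset\mathbb{R}^n$ of radius $R$, all $K\ge1$, all families of caps, $\psi_\tau$ and $\mathcal{B}_{K^2}$ as above (with overlap at most $M$) and all $f\in L^2(B^{n-1})$. -/

import Mathlib

open MeasureTheory Set
open scoped ENNReal

noncomputable section

namespace HormanderOp

/-- The spatial space `ℝⁿ`, with `n = d + 1`. -/
abbrev Space (d : ℕ) : Type := EuclideanSpace ℝ (Fin (d + 1))

/-- The frequency space `ℝⁿ⁻¹`, with `n = d + 1`. -/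
abbrev Freq (d : ℕ) : Type := EuclideanSpace ℝ (Fin d)

/-- The product `Bⁿ × Bⁿ⁻¹` of the (closed) unit balls. -/
def unitBalls (d : ℕ) : Set (Space d × Freq d) :=
  Metric.closedBall 0 1 ×ˢ Metric.closedBall 0 1

/-- The spatial gradient `∂ₓφ(x; ω)`. -/
def spatialGrad {d : ℕ} (φ : Space d × Freq d → ℝ) (x : Space d) (ω : Freq d) : Space d :=
  gradient (fun y => φ (y, ω)) x

/-- The mixed Hessian `∂²_{ωx}φ(x; ω)`, as the derivative in `ω` of `∂ₓφ(x; ω)`. -/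
def mixedHessian {d : ℕ} (φ : Space d × Freq d → ℝ) (x : Space d) (ω : Freq d) :
    Freq d →L[ℝ] Space d :=
  fderiv ℝ (fun w => spatialGrad φ x w) ω

/-- The wedge product of `n - 1` vectors of `ℝⁿ`, identified with a vector of `ℝⁿ`: the `i`-th
coordinate is `det (v₁, …, vₙ₋₁, eᵢ)`. -/
def wedgeVector {d : ℕ} (v : Fin d → Space d) : Space d :=
  WithLp.toLp 2 fun i => Matrix.det (Matrix.of
    (Fin.snoc (fun j => (v j).ofLp) (Pi.single i 1) : Fin (d + 1) → Fin (d + 1) → ℝ))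

/-- `G₀(x; ω)`, the wedge product of the vectors `∂_{ω_j} ∂ₓφ(x; ω)`. -/
def gauss₀ {d : ℕ} (φ : Space d × Freq d → ℝ) (x : Space d) (ω : Freq d) : Space d :=
  wedgeVector fun j => mixedHessian φ x ω (EuclideanSpace.single j 1)

/-- The generalised Gauss map `G(x; ω) = G₀(x; ω) / |G₀(x; ω)|`. -/
def gauss {d : ℕ} (φ : Space d × Freq d → ℝ) (x : Space d) (ω : Freq d) : Space d :=
  ‖gauss₀ φ x ω‖⁻¹ • gauss₀ φ x ω

/-- The curvature matrix `∂²_{ωω} ⟨∂ₓφ(x; ω), G(x; ω₀)⟩` at `ω = ω₀` (the vector `G(x; ω₀)` is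
kept fixed while one differentiates in `ω`). -/
def curvatureMatrix {d : ℕ} (φ : Space d × Freq d → ℝ) (x : Space d) (ω₀ : Freq d) :
    Matrix (Fin d) (Fin d) ℝ :=
  Matrix.of fun i j =>
    fderiv ℝ
      (fun w => fderiv ℝ (fun w' => inner ℝ (spatialGrad φ x w') (gauss φ x ω₀)) w
        (EuclideanSpace.single i 1))
      ω₀ (EuclideanSpace.single j 1)

/-- The `Cᴺ` norm of an amplitude: the supremum of its derivatives of order at most `N`. -/
def ampNorm {d : ℕ} (N : ℕ) (a : Space d × Freq d → ℝ) : ℝ≥0∞ :=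
  ⨆ m ∈ Finset.range (N + 1), ⨆ z, ‖iteratedFDeriv ℝ m a z‖ₑ

end HormanderOp

open HormanderOp

/-- The data of a Hörmander-type operator `T^λ` on `ℝⁿ`, `n = d + 1`: a phase `φ`, an amplitude `a`
and a scale `λ ≥ 1`. The phase is smooth on the closed set `Bⁿ × Bⁿ⁻¹`, that is, in a neighbourhood
of each of its points; its values away from there play no role. -/
structure HormanderOperator (d : ℕ) where
  /-- the phase `φ` -/
  phase : Space d × Freq d → ℝ
  /-- the amplitude `a` -/
  amp : Space d × Freq d → ℝ
  /-- the parameter `λ` -/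
  scale : ℝ
  one_le_scale : 1 ≤ scale
  amp_smooth : ContDiff ℝ (⊤ : ℕ∞) amp
  amp_nonneg : ∀ z, 0 ≤ amp z
  amp_support : tsupport amp ⊆ unitBalls d
  phase_smooth : ∀ z ∈ unitBalls d, ContDiffAt ℝ (⊤ : ℕ∞) phase z
  /-- condition H1 -/
  rank_mixedHessian : ∀ x ω, (x, ω) ∈ unitBalls d →
    Module.finrank ℝ (LinearMap.range (mixedHessian phase x ω).toLinearMap) = d
  /-- condition H2 -/
  det_curvature_ne_zero : ∀ x ω, (x, ω) ∈ tsupport amp → (curvatureMatrix phase x ω).det ≠ 0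

namespace HormanderOperator

variable {d : ℕ}

/-- `T^λ f(x) = ∫_{Bⁿ⁻¹} e^{2πi λφ(x/λ; ω)} a(x/λ; ω) f(ω) dω`. -/
def op (T : HormanderOperator d) (f : Freq d → ℂ) (x : Space d) : ℂ :=
  ∫ ω in Metric.closedBall (0 : Freq d) 1,
    Complex.exp (2 * Real.pi * Complex.I * ((T.scale * T.phase (T.scale⁻¹ • x, ω) : ℝ) : ℂ)) *
      ((T.amp (T.scale⁻¹ • x, ω) : ℝ) : ℂ) * f ω

/-- `S` is the translate of `T` by `b`, that is, `S f(x) = T f(x + b)`: the same scale, and both the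
phase `φ(x/λ; ω)` and the amplitude `a(x/λ; ω)` are translated. -/
def IsTranslate (S T : HormanderOperator d) (b : Space d) : Prop :=
  S.scale = T.scale ∧
    (∀ x ω, S.phase (x, ω) = T.phase (x + T.scale⁻¹ • b, ω)) ∧
    ∀ x ω, S.amp (x, ω) = T.amp (x + T.scale⁻¹ • b, ω)

/-- `S` is a localisation of `T`: the same phase and scale, and an amplitude which is supported in
the support of the amplitude of `T`. -/
def IsLocalisation (S T : HormanderOperator d) : Prop :=
  S.scale = T.scale ∧ S.phase = T.phase ∧ tsupport S.amp ⊆ tsupport T.amp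

/-- A class of Hörmander-type operators is closed under translation: it contains each translate (of
one of its members) which is a Hörmander-type operator. -/
def ClosedUnderTranslation (𝒯 : Set (HormanderOperator d)) : Prop :=
  ∀ T ∈ 𝒯, ∀ (b : Space d) (S : HormanderOperator d), S.IsTranslate T b → S ∈ 𝒯

/-- A class of Hörmander-type operators is closed under localisation of the amplitude. -/
def ClosedUnderLocalisation (𝒯 : Set (HormanderOperator d)) : Prop :=
  ∀ T ∈ 𝒯, ∀ S : HormanderOperator d, S.IsLocalisation T → S ∈ 𝒯

/-- The norm `|v₁ ∧ ⋯ ∧ v_k|` of a wedge product of vectors, i.e. the square root of the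
Gram determinant. -/
def wedgeNorm {k : ℕ} (v : Fin k → Space d) : ℝ :=
  Real.sqrt (Matrix.gram ℝ v).det

/-- The tuple is `ν`-transverse: `|G₁(x; ω₁) ∧ ⋯ ∧ G_k(x; ω_k)| ≥ ν` whenever `(x; ω_j)` lies in the
support of `a_j` for each `j`. -/
def Transverse {k : ℕ} (T : Fin k → HormanderOperator d) (ν : ℝ) : Prop :=
  ∀ (x : Space d) (ω : Fin k → Freq d), (∀ j, (x, ω j) ∈ tsupport (T j).amp) →
    ν ≤ wedgeNorm fun j => gauss (T j).phase x (ω j)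

end HormanderOperator

/-- A decomposition of `Bⁿ⁻¹` into finitely-overlapping balls `τ` of radius `K⁻¹` (at most `M` of
them share a point) and a subordinate measurable partition of unity `(ψ_τ)`, which yields the
decomposition `f = ∑_τ f_τ` with `f_τ = ψ_τ f`. The caps are indexed by their centres. That they
cover `Bⁿ⁻¹` follows from `support_weight` and `sum_weight`. -/
structure CapDecomposition (d : ℕ) (K : ℝ) (M : ℕ) where
  centres : Finset (Freq d)
  overlap : ∀ ω : Freq d, {c | c ∈ centres ∧ ω ∈ Metric.closedBall c K⁻¹}.ncard ≤ M
  /-- `weight c` is the function `ψ_τ` of the cap `τ` with centre `c` -/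
  weight : Freq d → Freq d → ℝ
  measurable_weight : ∀ c, Measurable (weight c)
  weight_nonneg : ∀ c ω, 0 ≤ weight c ω
  support_weight : ∀ c ∈ centres, Function.support (weight c) ⊆ Metric.closedBall c K⁻¹
  sum_weight : ∀ ω ∈ Metric.closedBall (0 : Freq d) 1, ∑ c ∈ centres, weight c ω = 1

/-- The piece `f_τ = ψ_τ f`, where `τ` is the cap with centre `c`. -/
def CapDecomposition.piece {d : ℕ} {K : ℝ} {M : ℕ} (P : CapDecomposition d K M) (c : Freq d)
    (f : Freq d → ℂ) : Freq d → ℂ :=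
  fun ω => ((P.weight c ω : ℝ) : ℂ) * f ω

/-- A collection of finitely-overlapping balls of radius `K²` (at most `M` of them share a point)
which are centred in, and cover, the ball `B(0, λ)`. -/
structure SpatialCover (d : ℕ) (lam K : ℝ) (M : ℕ) where
  centres : Finset (Space d)
  centred : ∀ c ∈ centres, c ∈ Metric.closedBall (0 : Space d) lam
  cover : Metric.closedBall (0 : Space d) lam ⊆ ⋃ c ∈ centres, Metric.closedBall c (K ^ 2)
  overlap : ∀ x : Space d, {c | c ∈ centres ∧ x ∈ Metric.closedBall c (K ^ 2)}.ncard ≤ M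

namespace HormanderOperator

variable {d : ℕ}

/-- `∠(G^λ(x; τ), V)`: the smallest angle between a non-zero vector of `V` and a vector
`G^λ(x; ω) = G(x/λ; ω)` with `ω ∈ τ` and `(x/λ; ω)` in the support of the amplitude
(and `∞` if there is no such pair). -/
def capAngle (T : HormanderOperator d) (x : Space d) (τ : Set (Freq d))
    (V : Submodule ℝ (Space d)) : ℝ≥0∞ :=
  ⨅ (ω : Freq d) (_ : ω ∈ τ ∧ (T.scale⁻¹ • x, ω) ∈ tsupport T.amp)
    (v : Space d) (_ : v ∈ V ∧ v ≠ 0),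
      ENNReal.ofReal (InnerProductGeometry.angle v (gauss T.phase (T.scale⁻¹ • x) ω))

/-- `μ_{T^λ f}(B)` for the ball `B` of radius `K²` with centre `xbar`: the minimum over
`V₁, …, V_A ∈ Gr(k - 1, n)` of the maximum of `‖T^λ f_τ‖^p_{L^p(B)}` over the caps `τ` with
`∠(G^λ(xbar; τ), V_a) > K⁻¹` for all `a`. (The quantity takes finitely many values, hence the
infimum is a minimum; the maximum over no caps is `0`.) -/
def broadMu (T : HormanderOperator d) {K : ℝ} {M : ℕ} (P : CapDecomposition d K M)
    (p : ℝ) (k A : ℕ) (f : Freq d → ℂ) (xbar : Space d) : ℝ≥0∞ :=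
  ⨅ V : Fin A → {V : Submodule ℝ (Space d) // Module.finrank ℝ V = k - 1},
    ⨆ (c : Freq d) (_ : c ∈ P.centres)
      (_ : ∀ a, ENNReal.ofReal K⁻¹ < T.capAngle xbar (Metric.closedBall c K⁻¹) (V a)),
        eLpNorm (T.op (P.piece c f)) (ENNReal.ofReal p)
          (volume.restrict (Metric.closedBall xbar (K ^ 2))) ^ p

open Classical in
/-- The `k`-broad norm `‖T^λ f‖_{BL^p_{k,A}(U)}`. -/
def broadNorm (T : HormanderOperator d) {K : ℝ} {M : ℕ} (P : CapDecomposition d K M)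
    (Q : SpatialCover d T.scale K M) (p : ℝ) (k A : ℕ) (f : Freq d → ℂ) (U : Set (Space d)) :
    ℝ≥0∞ :=
  (∑ c ∈ Q.centres with (Metric.closedBall c (K ^ 2) ∩ U).Nonempty,
    T.broadMu P p k A f c) ^ (1 / p)

/-- The norm of `L²(Bⁿ⁻¹)`. -/
def l2Norm (f : Freq d → ℂ) : ℝ≥0∞ :=
  eLpNorm f 2 (volume.restrict (Metric.closedBall 0 1))

/-- The `k`-linear inequality, with loss `ν^{-C₀} R^ε`, for the `ν`-transverse `k`-tuples from the
class `𝒯` (with a common scale `λ`) and the balls of radius `R₀ ≤ R ≤ λ`. The implied constant `C`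
depends only on the class and the phases; the amplitudes enter through their `C^{N₀}` norms. -/
def MultilinearEstimate (𝒯 : Set (HormanderOperator d)) (k : ℕ) (p ε C₀ R₀ : ℝ) (N₀ : ℕ) : Prop :=
  ∀ φ : Fin k → Space d × Freq d → ℝ, ∃ C : ℝ,
    ∀ (T : Fin k → HormanderOperator d) (lam ν R : ℝ) (y : Space d) (f : Fin k → Freq d → ℂ),
      (∀ j, T j ∈ 𝒯 ∧ (T j).phase = φ j ∧ (T j).scale = lam) →
      0 < ν → ν ≤ 1 → Transverse T ν →
      1 ≤ R → R₀ ≤ R → R ≤ lam →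
      (∀ j, MemLp (f j) 2 (volume.restrict (Metric.closedBall 0 1))) →
      eLpNorm (fun x => ∏ j, ‖(T j).op (f j) x‖ ^ (1 / (k : ℝ))) (ENNReal.ofReal p)
          (volume.restrict (Metric.closedBall y R)) ≤
        ENNReal.ofReal (C * ν ^ (-C₀) * R ^ ε) *
          ∏ j, (ampNorm N₀ (T j).amp * l2Norm (f j)) ^ (1 / (k : ℝ))

/-- The `k`-broad inequality (with `A = 1`), with loss `K^{C₁} R^ε`, for all operators in the class
`𝒯` and all balls of radius `1 ≤ R ≤ λ`. The implied constant `C` depends only on the class, the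
phase and the overlap number `M` of the decompositions in the definition of the `k`-broad norm; the
amplitude enters through its `C^{N₁}` norm. -/
def BroadEstimate (𝒯 : Set (HormanderOperator d)) (k : ℕ) (p ε C₁ : ℝ) (N₁ : ℕ) : Prop :=
  ∀ (M : ℕ) (φ : Space d × Freq d → ℝ), ∃ C : ℝ,
    ∀ T ∈ 𝒯, T.phase = φ → ∀ (K R : ℝ) (y : Space d) (P : CapDecomposition d K M)
      (Q : SpatialCover d T.scale K M) (f : Freq d → ℂ),
      1 ≤ K → 1 ≤ R → R ≤ T.scale →
      MemLp f 2 (volume.restrict (Metric.closedBall 0 1)) →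
      T.broadNorm P Q p k 1 f (Metric.closedBall y R) ≤
        ENNReal.ofReal (C * K ^ C₁ * R ^ ε) * (ampNorm N₁ T.amp * l2Norm f)

end HormanderOperator

end

/-! Fix a ball `B` of radius `K²` with centre `x̄`, and let `q` satisfy `2|B|q^p = μ(B)`. For each
`(k-1)`-plane `V` there is a cap `τ` at angle more than `1/K` from `V` with `|T f_τ| ≥ q` at some
point of `B`. Cutting `f_τ` into frequency cells of size `ρ ~ K^{-2k}` costs a power of `K`. Unless
`q` is negligible, some cell with a large contribution contains a frequency `ω` in the cap with
`(x̄/λ, ω)` in the support of the amplitude, so that `G(x̄/λ; ω)` has distance at least `1/(2K)`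
from `V`. Choosing `V` around the Gauss vectors already found, `k` times in a row, yields `k`
vectors with Gram determinant at least `(2K)^{-2k}` (`exists_transverse_caps`). The Gauss map is
Lipschitz, so the amplitudes localised to the corresponding cells are transverse
(`cellsTransverse_of_le_det_gram`).

The obstacle is that the `k` pieces are large at `k` different points of `B`, whereas the
multilinear inequality concerns a product at one point. It is overcome by separation of variables
(`exists_separation`). Write the point as `x + v` with `|v| ≤ 2K²`. After removal of the linear part
of the phase at the centre of a cell, which contributes a unimodular factor depending on `v` only,
the change of the phase has size about `K²(ρ + K²/λ)`. This is small, so the exponential and the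
amplitude can be expanded into Taylor series: up to an error, `T g(x + v)` is a combination of
values `S_i g(x)`, with coefficients of modulus at most `1` that depend on `v` and amplitudes that
do not. The `S_i` have the phase of `T` and amplitudes inside its support; to make the amplitudes
non-negative, each is written as a difference using a smooth majorant with the same support
constraint (`exists_nonneg_majorant`). Hence they belong to the class, by closure under
localisation.

Thus on all of `B` the number `q` is at most a power of `K` times the geometric mean of the sums
`∑_i |S_i g_j|`, or else it is negligible (`broadMu_le_lintegral`). Instead of following the choice
of cells from ball to ball, one adds over all transverse tuples; their number is polynomial in `K`,
and finite overlap turns the sum over the balls into one integral (`exists_broadNorm_le`). The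
multilinear hypothesis bounds each term (`eLpNorm_meanOp_le`). The expansion is carried to order `n
= d + 1`, so its error `λ^{-n}` absorbs the volume `λ^n` of the region of integration.

All of this needs `λ` to exceed a multiple of `K^{2k+4}` (`exists_broadNorm_le_of_large`). Otherwise
every volume in sight is polynomial in `K` and the trivial bound suffices
(`exists_broadNorm_le_of_small`). -/

noncomputable section

namespace HormanderOp

/-! ### Taylor's formula and directional derivatives -/

section Taylor

variable {E F : Type*} [NormedAddCommGroup E] [NormedSpace ℝ E] [NormedAddCommGroup F]
  [NormedSpace ℝ F]

/-- Taylor's formula of order `N`, with the remainder bounded by the derivatives of order `N`. -/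
theorem norm_add_sub_taylor_le [CompleteSpace F] {f : E → F} {N : ℕ} (hf : ContDiff ℝ N f) {A : ℝ}
    (hA : ∀ z, ‖iteratedFDeriv ℝ N f z‖ ≤ A) (x y : E) :
    ‖f (x + y) - ∑ i ∈ Finset.range N,
      ((i.factorial : ℝ))⁻¹ • iteratedFDeriv ℝ i f x (fun _ => y)‖ ≤ A * ‖y‖ ^ N := by
  cases N with
  | zero =>
    have := hA (x + y)
    simpa [norm_iteratedFDeriv_zero] using this
  | succ n =>
    rw [map_add_eq_sum_add_integral_iteratedFDeriv (n := n) (f := f) (x := x) (y := y)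
      (fun t _ => hf.contDiffAt.of_le (by norm_cast)), add_sub_cancel_left, norm_smul]
    have hA0 : 0 ≤ A := (norm_nonneg _).trans (hA x)
    have h1 : ‖∫ t in (0:ℝ)..1, (1 - t) ^ n • iteratedFDeriv ℝ (n + 1) f (x + t • y)
        (fun _ => y)‖ ≤ A * ‖y‖ ^ (n + 1) * |1 - 0| := by
      refine intervalIntegral.norm_integral_le_of_norm_le_const fun t ht => ?_
      rw [uIoc_of_le zero_le_one] at ht
      rw [norm_smul]
      have h2 : ‖(1 - t) ^ n‖ ≤ 1 := by
        rw [norm_pow, Real.norm_eq_abs, abs_of_nonneg (by linarith [ht.2])]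
        exact pow_le_one₀ (by linarith [ht.2]) (by linarith [ht.1])
      have h3 : ‖iteratedFDeriv ℝ (n + 1) f (x + t • y) (fun _ => y)‖ ≤ A * ‖y‖ ^ (n + 1) := by
        refine (ContinuousMultilinearMap.le_opNorm _ _).trans ?_
        rw [Finset.prod_const, Finset.card_univ, Fintype.card_fin]
        exact mul_le_mul_of_nonneg_right (hA _) (by positivity)
      calc _ ≤ 1 * (A * ‖y‖ ^ (n + 1)) := mul_le_mul h2 h3 (norm_nonneg _) zero_le_one
        _ = _ := one_mul _
    have h4 : ‖((n.factorial : ℝ))⁻¹‖ ≤ 1 := by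
      rw [norm_inv, Real.norm_natCast]
      exact inv_le_one_of_one_le₀ (by exact_mod_cast Nat.one_le_iff_ne_zero.2 n.factorial_ne_zero)
    calc _ ≤ 1 * (A * ‖y‖ ^ (n + 1) * |1 - 0|) :=
          mul_le_mul h4 h1 (norm_nonneg _) zero_le_one
      _ = _ := by simp

/-- A function which vanishes near `x` is small, to any order, near `x`. -/
theorem norm_le_of_notMem_tsupport [CompleteSpace F] {f : E → F} {N : ℕ} (hf : ContDiff ℝ N f)
    {A : ℝ} (hA : ∀ z, ‖iteratedFDeriv ℝ N f z‖ ≤ A) {x : E} (hx : x ∉ tsupport f) (z : E) :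
    ‖f z‖ ≤ A * ‖z - x‖ ^ N := by
  have h := norm_add_sub_taylor_le hf hA x (z - x)
  have h0 : ∀ i, iteratedFDeriv ℝ i f x = 0 := fun i =>
    image_eq_zero_of_notMem_tsupport fun h => hx (tsupport_iteratedFDeriv_subset i h)
  simpa [h0] using h

/-- The derivative `∂_{e_{α 0}} ⋯ ∂_{e_{α (i - 1)}} f`. -/
def dirDeriv {n : ℕ} (e : Fin n → E) (f : E → F) {i : ℕ} (α : Fin i → Fin n) (z : E) : F :=
  iteratedFDeriv ℝ i f z fun j => e (α j)

theorem iteratedFDeriv_apply_sum_smul {n : ℕ} (e : Fin n → E) (u : Fin n → ℝ) (f : E → F) (i : ℕ)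
    (z : E) :
    iteratedFDeriv ℝ i f z (fun _ => ∑ j, u j • e j) =
      ∑ α : Fin i → Fin n, (∏ j, u (α j)) • dirDeriv e f α z := by
  classical
  rw [ContinuousMultilinearMap.map_sum]
  refine Finset.sum_congr rfl fun α _ => ?_
  rw [ContinuousMultilinearMap.map_smul_univ]
  rfl

/-- Currying one variable is an isometry, so derivatives can be moved from the inner to the outer
order one at a time. -/
theorem norm_iteratedFDeriv_iteratedFDeriv (f : E → F) (m i : ℕ) (z : E) :
    ‖iteratedFDeriv ℝ m (iteratedFDeriv ℝ i f) z‖ = ‖iteratedFDeriv ℝ (m + i) f z‖ := by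
  induction i generalizing m with
  | zero =>
    rw [iteratedFDeriv_zero_eq_comp, LinearIsometryEquiv.norm_iteratedFDeriv_comp_left]
    rfl
  | succ i ih =>
    have h := LinearIsometryEquiv.norm_iteratedFDeriv_comp_left (𝕜 := ℝ)
      (G := ContinuousMultilinearMap ℝ (fun _ : Fin (i + 1) => E) F)
      (continuousMultilinearCurryLeftEquiv ℝ (fun _ : Fin (i + 1) => E) F).symm
      (fderiv ℝ (iteratedFDeriv ℝ i f)) z m
    rw [iteratedFDeriv_succ_eq_comp_left]
    refine h.trans ?_
    rw [norm_iteratedFDeriv_fderiv, ih, Nat.add_right_comm, Nat.add_assoc]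

theorem contDiff_dirDeriv {n : ℕ} (e : Fin n → E) {f : E → F} {i m : ℕ} (α : Fin i → Fin n)
    (hf : ContDiff ℝ (m + i : ℕ) f) : ContDiff ℝ m (dirDeriv e f α) :=
  (ContinuousMultilinearMap.apply ℝ (fun _ : Fin i => E) F fun j => e (α j)).contDiff.comp
    (hf.iteratedFDeriv_right (by norm_cast))

theorem norm_iteratedFDeriv_dirDeriv_le {n : ℕ} {e : Fin n → E} (he : ∀ j, ‖e j‖ ≤ 1) {f : E → F}
    {i m : ℕ} (α : Fin i → Fin n) (hf : ContDiff ℝ (m + i : ℕ) f) (z : E) :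
    ‖iteratedFDeriv ℝ m (dirDeriv e f α) z‖ ≤ ‖iteratedFDeriv ℝ (m + i) f z‖ := by
  have h1 : ContDiff ℝ m (iteratedFDeriv ℝ i f) := hf.iteratedFDeriv_right (by norm_cast)
  have h2 : dirDeriv e f α =
      (ContinuousMultilinearMap.apply ℝ (fun _ : Fin i => E) F fun j => e (α j)) ∘
        iteratedFDeriv ℝ i f := rfl
  rw [h2]
  refine (ContinuousLinearMap.norm_iteratedFDeriv_comp_left _ h1.contDiffAt le_rfl).trans ?_
  rw [norm_iteratedFDeriv_iteratedFDeriv]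
  refine mul_le_of_le_one_left (norm_nonneg _) ?_
  refine ContinuousLinearMap.opNorm_le_bound _ zero_le_one fun T => ?_
  rw [ContinuousMultilinearMap.apply_apply, one_mul]
  refine (T.le_opNorm _).trans (mul_le_of_le_one_right (norm_nonneg _) ?_)
  exact Finset.prod_le_one (fun _ _ => norm_nonneg _) fun _ _ => he _

end Taylor

/-! ### Cutoff functions at a given scale, by mollification -/

section Cutoff

variable {E : Type} [NormedAddCommGroup E] [NormedSpace ℝ E] [FiniteDimensional ℝ E]
  [MeasurableSpace E] [BorelSpace E] (μ : Measure E) [μ.IsAddHaarMeasure]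

/-- The convolution of the indicator function of a set `A` and a function `k`. -/
def setConv {F : Type} [NormedAddCommGroup F] [NormedSpace ℝ F] (A : Set E) (k : E → F) : E → F :=
  convolution (A.indicator fun _ => (1 : ℝ)) k (ContinuousLinearMap.lsmul ℝ ℝ) μ

omit [BorelSpace E] in
theorem locallyIntegrable_indicator_one {A : Set E} (hA : MeasurableSet A) :
    LocallyIntegrable (A.indicator fun _ => (1 : ℝ)) μ :=
  (locallyIntegrable_const 1).indicator hA

variable {F : Type} [NormedAddCommGroup F] [NormedSpace ℝ F]

omit [NormedSpace ℝ E] [FiniteDimensional ℝ E] [BorelSpace E] [μ.IsAddHaarMeasure] in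
theorem setConv_apply (A : Set E) (k : E → F) (z : E) :
    setConv μ A k z = ∫ y, A.indicator (fun _ => (1 : ℝ)) y • k (z - y) ∂μ := rfl

theorem fderiv_setConv {A : Set E} (hA : MeasurableSet A) {k : E → F} (hk : ContDiff ℝ 1 k)
    (hc : HasCompactSupport k) : fderiv ℝ (setConv μ A k) = setConv μ A (fderiv ℝ k) := by
  ext1 z
  rw [setConv, (hc.hasFDerivAt_convolution_right _ (locallyIntegrable_indicator_one μ hA) hk
    z).fderiv]
  rfl

theorem norm_setConv_le {A : Set E} {k : E → F} {r C : ℝ}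
    (hr : Function.support k ⊆ Metric.closedBall 0 r) (hC : ∀ z, ‖k z‖ ≤ C) (z : E) :
    ‖setConv μ A k z‖ ≤ C * μ.real (Metric.closedBall 0 r) := by
  rw [setConv_apply, ← setIntegral_eq_integral_of_forall_compl_eq_zero
    (s := Metric.closedBall z r)]
  · have h1 : μ.real (Metric.closedBall 0 r) = μ.real (Metric.closedBall z r) := by
      simp only [Measure.real, Measure.addHaar_closedBall_center]
    rw [h1]
    refine norm_setIntegral_le_of_norm_le_const measure_closedBall_lt_top fun y _ => ?_
    rw [norm_smul]
    have : ‖A.indicator (fun _ => (1 : ℝ)) y‖ ≤ 1 := by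
      by_cases hy : y ∈ A <;> simp [hy]
    exact (mul_le_of_le_one_left (norm_nonneg _) this).trans (hC _)
  · intro y hy
    have : k (z - y) = 0 := by
      by_contra h
      have := hr h
      rw [mem_closedBall_zero_iff] at this
      exact hy (by rwa [Metric.mem_closedBall, dist_comm, dist_eq_norm])
    rw [this, smul_zero]

/-- All derivatives fall on the kernel, so the bound is uniform in the set `A`. The target space is
quantified inside the induction because differentiating the kernel changes it. -/
theorem norm_iteratedFDeriv_setConv_le {A : Set E} (hA : MeasurableSet A) (i : ℕ) :
    ∀ {F : Type} [NormedAddCommGroup F] [NormedSpace ℝ F] {k : E → F} {r C : ℝ}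
      (_ : ContDiff ℝ i k) (_ : tsupport k ⊆ Metric.closedBall 0 r)
      (_ : ∀ z, ‖iteratedFDeriv ℝ i k z‖ ≤ C) (z : E),
      ‖iteratedFDeriv ℝ i (setConv μ A k) z‖ ≤ C * μ.real (Metric.closedBall 0 r) := by
  induction i with
  | zero =>
    intro F _ _ k r C hk hr hC z
    rw [norm_iteratedFDeriv_zero]
    exact norm_setConv_le μ ((subset_tsupport k).trans hr)
      (fun z => by simpa only [norm_iteratedFDeriv_zero] using hC z) z
  | succ i ih =>
    intro F _ _ k r C hk hr hC z
    have hc : HasCompactSupport k :=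
      (isCompact_closedBall 0 r).of_isClosed_subset (isClosed_tsupport k) hr
    rw [← norm_iteratedFDeriv_fderiv, fderiv_setConv μ hA
      (hk.of_le (by exact_mod_cast Nat.le_add_left 1 i)) hc]
    refine ih (hk.fderiv_right (by norm_cast)) ((tsupport_fderiv_subset ℝ).trans hr)
      (fun z => ?_) z
    rw [norm_iteratedFDeriv_fderiv]
    exact hC z

/-- Smooth cutoff functions adapted to a set at scale `r`, with the natural derivative bounds. -/
theorem exists_cutoff (E : Type) [NormedAddCommGroup E] [NormedSpace ℝ E]
    [FiniteDimensional ℝ E] : ∃ C : ℕ → ℝ, (∀ i, 0 ≤ C i) ∧ ∀ (A : Set E) (r : ℝ), 0 < r →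
    ∃ χ : E → ℝ, ContDiff ℝ (⊤ : ℕ∞) χ ∧ (∀ z, 0 ≤ χ z) ∧ (∀ z ∈ A, χ z = 1) ∧
      Function.support χ ⊆ Metric.thickening (2 * r) A ∧
      ∀ i z, ‖iteratedFDeriv ℝ i χ z‖ ≤ C i * r⁻¹ ^ i := by
  borelize E
  let μ : Measure E := Measure.addHaar
  let β : ContDiffBump (0 : E) := ⟨2⁻¹, 1, by norm_num, by norm_num⟩
  have hβ : ContDiff ℝ (⊤ : ℕ∞) (β : E → ℝ) := β.contDiff
  have hint : 0 < ∫ y, β y ∂μ := β.integral_pos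
  have hsupp : tsupport (β : E → ℝ) ⊆ Metric.closedBall 0 1 := β.tsupport_eq.subset
  have hb : ∀ i : ℕ, ∃ C : ℝ, ∀ z, ‖iteratedFDeriv ℝ i (β : E → ℝ) z‖ ≤ C := fun i =>
    (β.hasCompactSupport.iteratedFDeriv i).exists_bound_of_continuous
      (hβ.continuous_iteratedFDeriv (by exact_mod_cast le_top))
  choose B hB using hb
  have hB0 : ∀ i, 0 ≤ B i := fun i => (norm_nonneg _).trans (hB i 0)
  refine ⟨fun i => (∫ y, β y ∂μ)⁻¹ * (B i * μ.real (Metric.closedBall 0 1)),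
    fun i => mul_nonneg (inv_nonneg.2 hint.le) (mul_nonneg (hB0 i) measureReal_nonneg),
    fun A r hr => ?_⟩
  -- The `r`-neighbourhood of `A` is rescaled to unit scale and mollified with one fixed bump of
  -- radius `1`. The constants then come from this bump alone, and undoing the scaling produces the
  -- factors `r⁻¹ ^ i`.
  set A' : Set E := {y | r • y ∈ Metric.thickening r A} with hA'
  have hA'm : MeasurableSet A' :=
    (Metric.isOpen_thickening.preimage (continuous_const_smul r)).measurableSet
  have hcont : ContDiff ℝ (⊤ : ℕ∞) (setConv μ A' (β : E → ℝ)) :=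
    β.hasCompactSupport.contDiff_convolution_right _ (locallyIntegrable_indicator_one μ hA'm) hβ
  refine ⟨fun z => (∫ y, β y ∂μ)⁻¹ • setConv μ A' β (r⁻¹ • z), ?_, ?_, ?_, ?_, ?_⟩
  · exact (hcont.comp (contDiff_const_smul _)).const_smul _
  · intro z
    refine smul_nonneg (inv_nonneg.2 hint.le) (integral_nonneg fun y => ?_)
    refine mul_nonneg (indicator_nonneg (fun _ _ => zero_le_one) _) β.nonneg
  · intro z hz
    have : setConv μ A' β (r⁻¹ • z) = ∫ y, β y ∂μ := by
      rw [setConv_apply, ← integral_sub_left_eq_self (fun y => β y) μ (r⁻¹ • z)]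
      refine integral_congr_ae (.of_forall fun y => ?_)
      by_cases hy : y ∈ A'
      · simp [hy]
      · have : β (r⁻¹ • z - y) = 0 := by
          by_contra h
          have h1 : r⁻¹ • z - y ∈ Function.support β := h
          rw [β.support_eq, mem_ball_zero_iff] at h1
          change ‖r⁻¹ • z - y‖ < 1 at h1
          refine hy (Metric.mem_thickening_iff.2 ⟨z, hz, ?_⟩)
          rw [dist_comm, dist_eq_norm]
          have h2 : z - r • y = r • (r⁻¹ • z - y) := by
            rw [smul_sub, smul_inv_smul₀ hr.ne']
          rw [h2, norm_smul, Real.norm_of_nonneg hr.le]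
          nlinarith
        simp [this]
    change _ • setConv μ A' β (r⁻¹ • z) = 1
    rw [this, smul_eq_mul, inv_mul_cancel₀ hint.ne']
  · intro z hz
    have h1 : setConv μ A' β (r⁻¹ • z) ≠ 0 := fun h => hz (by simp [h])
    obtain ⟨y, hy⟩ : ∃ y, A'.indicator (fun _ => (1 : ℝ)) y • β (r⁻¹ • z - y) ≠ 0 := by
      by_contra! h
      exact h1 (by rw [setConv_apply]; simp only [h, integral_zero])
    have hyA : y ∈ A' := by
      by_contra h
      simp [h] at hy
    have h2 : r⁻¹ • z - y ∈ Function.support β := fun h => hy (by rw [h, smul_zero])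
    rw [β.support_eq, mem_ball_zero_iff] at h2
    change ‖r⁻¹ • z - y‖ < 1 at h2
    obtain ⟨x, hx, hxy⟩ := Metric.mem_thickening_iff.1 hyA
    refine Metric.mem_thickening_iff.2 ⟨x, hx, ?_⟩
    have h3 : dist z (r • y) < r := by
      rw [dist_eq_norm, show z - r • y = r • (r⁻¹ • z - y) by
        rw [smul_sub, smul_inv_smul₀ hr.ne'], norm_smul, Real.norm_of_nonneg hr.le]
      nlinarith
    linarith [dist_triangle z (r • y) x]
  · intro i z
    have h1 : ContDiff ℝ i (setConv μ A' (β : E → ℝ)) := hcont.of_le (by exact_mod_cast le_top)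
    have h3 : ContDiff ℝ i fun z => setConv μ A' (β : E → ℝ) (r⁻¹ • z) :=
      h1.comp (contDiff_const_smul _)
    rw [iteratedFDeriv_const_smul_apply' h3.contDiffAt, norm_smul, Real.norm_of_nonneg (inv_nonneg.2 hint.le), mul_assoc]
    refine mul_le_mul_of_nonneg_left ?_ (inv_nonneg.2 hint.le)
    have h2 := iteratedFDeriv_comp_const_smul (i := i) r⁻¹ h1
    rw [h2]
    beta_reduce
    rw [norm_smul, norm_pow, norm_inv, Real.norm_of_nonneg hr.le, mul_comm]
    exact mul_le_mul_of_nonneg_right (norm_iteratedFDeriv_setConv_le μ hA'm i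
      (hβ.of_le (by exact_mod_cast le_top)) hsupp (hB i) _) (by positivity)

end Cutoff

end HormanderOp

namespace HormanderOp

/-! ### Smooth majorants inside the support -/

section Majorant

/-- A smooth function `g` has a smooth majorant of `|g|` which is supported in the support of `g`
and whose `Cᴺ` norm is controlled by the `Cᴺ⁺¹` norm of `g`. -/
theorem exists_nonneg_majorant (E : Type) [NormedAddCommGroup E] [NormedSpace ℝ E]
    [FiniteDimensional ℝ E] [Nontrivial E] (N : ℕ) : ∃ C : ℝ, 0 ≤ C ∧ ∀ (g : E → ℝ) (A : ℝ),
    ContDiff ℝ (⊤ : ℕ∞) g → tsupport g ⊆ Metric.closedBall 0 1 →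
    (∀ i ≤ N + 1, ∀ z, ‖iteratedFDeriv ℝ i g z‖ ≤ A) →
    ∃ h : E → ℝ, ContDiff ℝ (⊤ : ℕ∞) h ∧ (∀ z, |g z| ≤ h z) ∧ tsupport h ⊆ tsupport g ∧
      ∀ i ≤ N, ∀ z, ‖iteratedFDeriv ℝ i h z‖ ≤ C * A := by
  obtain ⟨C, hC0, hC⟩ := exists_cutoff E
  refine ⟨∑ i ∈ Finset.range (N + 1), 2 * 8 ^ (i + 1) * C i,
    Finset.sum_nonneg fun i _ => mul_nonneg (by positivity) (hC0 i), fun g A hg hs hA => ?_⟩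
  have hgc : HasCompactSupport g :=
    (isCompact_closedBall 0 1).of_isClosed_subset (isClosed_tsupport g) hs
  -- Up to order `N + 1` the given bound `A` is used. At higher orders compactness gives some bound,
  -- which serves the smoothness of the series below and enters no constant of the conclusion.
  have hb : ∀ i : ℕ, ∃ B : ℝ, (i ≤ N + 1 → B = A) ∧ ∀ z, ‖iteratedFDeriv ℝ i g z‖ ≤ B := by
    intro i
    by_cases hi : i ≤ N + 1
    · exact ⟨A, fun _ => rfl, hA i hi⟩
    · obtain ⟨B, hB⟩ := (hgc.iteratedFDeriv i).exists_bound_of_continuous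
        (hg.continuous_iteratedFDeriv (by exact_mod_cast le_top))
      exact ⟨B, fun h => absurd h hi, hB⟩
  choose B hBA hB using hb
  have hB0 : ∀ i, 0 ≤ B i := fun i => (norm_nonneg _).trans (hB i 0)
  set r : ℕ → ℝ := fun j => (2⁻¹ : ℝ) ^ j with hr
  have hr0 : ∀ j, 0 < r j := fun j => by positivity
  -- A dyadic decomposition by the distance to the complement of the support: `Z j` is at depth at
  -- least `4 r j`, and `D j` below is within `8 r j` of the complement. On `D j` the function is
  -- flat, since all its derivatives vanish at points off the support.
  set Z : ℕ → Set E := fun j => {z | Metric.closedBall z (4 * r j) ⊆ tsupport g} with hZ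
  choose χ hχs hχ0 hχ1 hχsupp hχd using fun j => hC (Z j) (r j) (hr0 j)
  set D : ℕ → Set E := fun j => {z | ∃ y ∉ tsupport g, dist z y ≤ 8 * r j} with hD
  have hflat : ∀ i j, ∀ z ∈ D j, |g z| ≤ B i * (8 * r j) ^ i := by
    rintro i j z ⟨y, hy, hzy⟩
    have := norm_le_of_notMem_tsupport (hg.of_le (by exact_mod_cast le_top) : ContDiff ℝ i g)
      (hB i) hy z
    rw [Real.norm_eq_abs, ← dist_eq_norm] at this
    exact this.trans (mul_le_mul_of_nonneg_left (pow_le_pow_left₀ dist_nonneg hzy i) (hB0 i))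
  set w : ℕ → ℝ := fun j => sSup ((fun z => |g z|) '' D j) with hw
  have hbdd : ∀ j, BddAbove ((fun z => |g z|) '' D j) := fun j =>
    ⟨B 0 * (8 * r j) ^ 0, by rintro _ ⟨z, hz, rfl⟩; exact hflat 0 j z hz⟩
  have hw0 : ∀ j, 0 ≤ w j := fun j =>
    Real.sSup_nonneg (by rintro _ ⟨z, _, rfl⟩; exact abs_nonneg _)
  have hwB : ∀ i j, w j ≤ B i * (8 * r j) ^ i := fun i j =>
    Real.sSup_le (by rintro _ ⟨z, hz, rfl⟩; exact hflat i j z hz)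
      (mul_nonneg (hB0 i) (by have := hr0 j; positivity))
  have hwD : ∀ j, ∀ z ∈ D j, |g z| ≤ w j := fun j z hz => le_csSup (hbdd j) ⟨z, hz, rfl⟩
  -- The majorant is the sum of these functions. A derivative of order `i` of `χ j` costs `r j ^
  -- (-i)`, while flatness to order `i + 1` gives `w j` a factor `r j ^ (i + 1)`. The remaining
  -- factor `r j` makes the series converge and accounts for the loss of one derivative.
  set f : ℕ → E → ℝ := fun j z => w j • χ j z with hf
  have hfs : ∀ j, ContDiff ℝ (⊤ : ℕ∞) (f j) := fun j => (hχs j).const_smul _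
  set v : ℕ → ℕ → ℝ := fun i j => B (i + 1) * 8 ^ (i + 1) * C i * (2⁻¹) ^ j with hv
  have hvs : ∀ i : ℕ, (i : ℕ∞) ≤ ((⊤ : ℕ∞)) → Summable (v i) := fun i _ =>
    (summable_geometric_of_lt_one (by norm_num) (by norm_num)).mul_left _
  have hfd : ∀ (i j : ℕ) (z : E), (i : ℕ∞) ≤ ((⊤ : ℕ∞)) →
      ‖iteratedFDeriv ℝ i (f j) z‖ ≤ v i j := by
    intro i j z _
    rw [hf, iteratedFDeriv_const_smul_apply' ((hχs j).of_le (by exact_mod_cast le_top)).contDiffAt,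
      norm_smul, Real.norm_of_nonneg (hw0 j)]
    refine (mul_le_mul (hwB (i + 1) j) (hχd j i z) (norm_nonneg _)
      (mul_nonneg (hB0 _) (by have := hr0 j; positivity))).trans (le_of_eq ?_)
    have h1 : r j ^ (i + 1) * (r j)⁻¹ ^ i = r j := by
      rw [pow_succ, mul_right_comm, ← mul_pow, mul_inv_cancel₀ (hr0 j).ne', one_pow, one_mul]
    calc B (i + 1) * (8 * r j) ^ (i + 1) * (C i * (r j)⁻¹ ^ i)
        = B (i + 1) * 8 ^ (i + 1) * C i * (r j ^ (i + 1) * (r j)⁻¹ ^ i) := by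
          rw [mul_pow]; ring
      _ = _ := by rw [h1]
  have hsum : ∀ z, Summable fun j => f j z := fun z =>
    (hvs 0 le_top).of_norm_bounded fun j => by
      simpa only [norm_iteratedFDeriv_zero] using hfd 0 j z le_top
  have hf0 : ∀ j z, 0 ≤ f j z := fun j z => mul_nonneg (hw0 j) (hχ0 j z)
  refine ⟨fun z => ∑' j, f j z, contDiff_tsum hfs hvs hfd, fun z => ?_, ?_, fun i hi z => ?_⟩
  · by_cases hz : g z = 0
    · rw [hz, abs_zero]
      exact tsum_nonneg fun j => hf0 j z
    have hex : ∃ j, z ∈ Z j := by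
      have h1 : Function.support g ∈ nhds z :=
        (hg.continuous.isOpen_support).mem_nhds hz
      obtain ⟨ε, hε, hε'⟩ := Metric.mem_nhds_iff.1 h1
      obtain ⟨j, hj⟩ := exists_pow_lt_of_lt_one (show 0 < ε / 4 by positivity)
        (show (2⁻¹ : ℝ) < 1 by norm_num)
      refine ⟨j, fun y hy => subset_tsupport g (hε' ?_)⟩
      rw [Metric.mem_closedBall] at hy
      rw [Metric.mem_ball]
      have : r j < ε / 4 := hj
      linarith
    classical
    -- At the first `j` with `z ∈ Z j`, the point `z` is not in `Z (j - 1)`, hence within `4 r (j -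
    -- 1) = 8 r j` of the complement: it lies in `D j`, and the single term `f j` already dominates
    -- `|g z|`. For `j = 0` a point of norm `2`, which is outside the support, plays the same role.
    have hzj := Nat.find_spec hex
    set j := Nat.find hex with hj
    have hzD : z ∈ D j := by
      by_cases h0 : j = 0
      · obtain ⟨y, hy⟩ := exists_norm_eq E (show (0 : ℝ) ≤ 2 by norm_num)
        refine ⟨y, fun h => ?_, ?_⟩
        · have := hs h
          rw [mem_closedBall_zero_iff, hy] at this
          norm_num at this
        · have h1 : ‖z‖ ≤ 1 := by
            simpa using hs (subset_tsupport g hz)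
          rw [h0]
          calc dist z y ≤ ‖z‖ + ‖y‖ := dist_le_norm_add_norm z y
            _ ≤ _ := by rw [hy, hr]; norm_num; linarith
      · obtain ⟨i, hi⟩ := Nat.exists_eq_succ_of_ne_zero h0
        have h1 : z ∉ Z i := Nat.find_min hex (by omega)
        obtain ⟨y, hy, hyS⟩ := not_subset.1 h1
        refine ⟨y, hyS, ?_⟩
        rw [dist_comm]
        refine (Metric.mem_closedBall.1 hy).trans (le_of_eq ?_)
        rw [hi, hr]
        simp only [Nat.succ_eq_add_one, pow_succ]
        ring
    calc |g z| ≤ w j := hwD j z hzD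
      _ = f j z := by rw [hf]; simp only [hχ1 j z hzj, smul_eq_mul, mul_one]
      _ ≤ _ := (hsum z).le_tsum j fun i _ => hf0 i z
  · refine closure_minimal (fun z hz => ?_) (isClosed_tsupport g)
    obtain ⟨j, hj⟩ : ∃ j, f j z ≠ 0 := by
      by_contra! h
      exact hz (by simp [h])
    have h1 : χ j z ≠ 0 := fun h => hj (by rw [hf]; simp [h])
    obtain ⟨y, hy, hzy⟩ := Metric.mem_thickening_iff.1 (hχsupp j h1)
    refine hy (Metric.mem_closedBall.2 (hzy.le.trans ?_))
    linarith [hr0 j]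
  · rw [iteratedFDeriv_tsum_apply hfs hvs hfd le_top]
    refine (tsum_of_norm_bounded (hvs i le_top).hasSum fun j => hfd i j z le_top).trans ?_
    rw [hv, tsum_mul_left, tsum_geometric_inv_two, hBA (i + 1) (by omega), Finset.sum_mul]
    have hA0 : 0 ≤ A := (norm_nonneg _).trans (hA 0 (by omega) 0)
    refine le_trans (le_of_eq ?_) (Finset.single_le_sum
      (f := fun i => 2 * 8 ^ (i + 1) * C i * A) (fun m _ => ?_) (Finset.mem_range_succ_iff.2 hi))
    · ring
    · exact mul_nonneg (mul_nonneg (by positivity) (hC0 m)) hA0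

end Majorant

/-! ### Submultiplicative jet norms -/

section Jet

variable {E : Type*} [NormedAddCommGroup E] [NormedSpace ℝ E]

/-- The norm, with weight `θ`, of the jet of order `Q` of a function at a point. -/
def jet (Q : ℕ) (θ : ℝ) (f : E → ℝ) (z : E) : ℝ :=
  ∑ m ∈ Finset.range (Q + 1), θ ^ m / m.factorial * ‖iteratedFDeriv ℝ m f z‖

variable {Q : ℕ} {θ : ℝ}

theorem jet_nonneg (hθ : 0 ≤ θ) (f : E → ℝ) (z : E) : 0 ≤ jet Q θ f z :=
  Finset.sum_nonneg fun _ _ => by positivity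

/-- The weights `1 / m!` turn the binomial sum of the Leibniz rule into a Cauchy product, and its
part of total degree at most `Q` is contained in the product of the two jets. The constant `1` is
essential: products of `l` factors occur with `l` as large as a multiple of `log λ`, and no constant
to the power `l` may be lost beyond the available smallness. -/
theorem jet_mul_le (hθ : 0 ≤ θ) {f g : E → ℝ} (hf : ContDiff ℝ Q f) (hg : ContDiff ℝ Q g) (z : E) :
    jet Q θ (fun z => f z * g z) z ≤ jet Q θ f z * jet Q θ g z := by
  set F : ℕ → ℝ := fun m => θ ^ m / m.factorial * ‖iteratedFDeriv ℝ m f z‖ with hF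
  set G : ℕ → ℝ := fun m => θ ^ m / m.factorial * ‖iteratedFDeriv ℝ m g z‖ with hG
  have hF0 : ∀ m, 0 ≤ F m := fun m => by positivity
  have hG0 : ∀ m, 0 ≤ G m := fun m => by positivity
  have h1 : ∀ m ∈ Finset.range (Q + 1),
      θ ^ m / m.factorial * ‖iteratedFDeriv ℝ m (fun z => f z * g z) z‖ ≤
        ∑ x ∈ Finset.HasAntidiagonal.antidiagonal m, F x.1 * G x.2 := by
    intro m hm
    have hmQ : (m : WithTop ℕ∞) ≤ (Q : WithTop ℕ∞) := by
      exact_mod_cast Finset.mem_range_succ_iff.1 hm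
    refine (mul_le_mul_of_nonneg_left (norm_iteratedFDeriv_mul_le hf hg z hmQ)
      (by positivity)).trans (le_of_eq ?_)
    rw [Finset.mul_sum, Finset.Nat.sum_antidiagonal_eq_sum_range_succ_mk]
    refine Finset.sum_congr rfl fun i hi => ?_
    have hi' : i ≤ m := Finset.mem_range_succ_iff.1 hi
    have h2 : (m.factorial : ℝ) = m.choose i * i.factorial * (m - i).factorial := by
      exact_mod_cast (Nat.choose_mul_factorial_mul_factorial hi').symm
    have h3 : θ ^ m = θ ^ i * θ ^ (m - i) := by rw [← pow_add, Nat.add_sub_cancel' hi']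
    have h4 : (m.choose i : ℝ) ≠ 0 := by exact_mod_cast (Nat.choose_pos hi').ne'
    have h5 : (i.factorial : ℝ) ≠ 0 := by exact_mod_cast i.factorial_ne_zero
    have h6 : ((m - i).factorial : ℝ) ≠ 0 := by exact_mod_cast (m - i).factorial_ne_zero
    simp only [hF, hG]
    rw [h2, h3]
    field_simp
  refine (Finset.sum_le_sum h1).trans ?_
  rw [jet, jet, Finset.sum_mul_sum, ← Finset.sum_product', Finset.sum_sigma']
  refine (le_of_eq (Finset.sum_bij_ne_zero (fun x _ _ => x.2) ?_ ?_ ?_ ?_)).trans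
    (Finset.sum_le_sum_of_subset_of_nonneg
      (Finset.filter_subset (fun x : ℕ × ℕ => x.1 + x.2 ≤ Q) _)
      fun x _ _ => mul_nonneg (hF0 _) (hG0 _))
  · rintro ⟨m, x⟩ h _
    simp only [Finset.mem_sigma, Finset.mem_range, Finset.HasAntidiagonal.mem_antidiagonal] at h
    simp only [Finset.mem_filter, Finset.mem_product, Finset.mem_range]
    omega
  · rintro ⟨m, x⟩ h _ ⟨m', x'⟩ h' _ hxx
    simp only [Finset.mem_sigma, Finset.mem_range, Finset.HasAntidiagonal.mem_antidiagonal] at h h' hxx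
    subst hxx
    obtain rfl : m = m' := by omega
    rfl
  · rintro x hx hne
    simp only [Finset.mem_filter, Finset.mem_product, Finset.mem_range] at hx
    refine ⟨⟨x.1 + x.2, x⟩, ?_, hne, rfl⟩
    simp only [Finset.mem_sigma, Finset.mem_range, Finset.HasAntidiagonal.mem_antidiagonal, and_true]
    omega
  · rintro ⟨m, x⟩ _ _
    rfl

theorem jet_one_le (z : E) : jet Q θ (fun _ : E => (1 : ℝ)) z ≤ 1 := by
  rw [jet, Finset.sum_eq_single 0]
  · simp
  · intro m _ hm
    simp [iteratedFDeriv_const_of_ne hm]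
  · simp

theorem jet_prod_le (hθ : 0 ≤ θ) {ι : Type*} (s : Finset ι) {f : ι → E → ℝ}
    (hf : ∀ i, ContDiff ℝ Q (f i)) (z : E) {δ : ℝ} (hδ : ∀ i, jet Q θ (f i) z ≤ δ) :
    jet Q θ (fun z => ∏ i ∈ s, f i z) z ≤ δ ^ s.card := by
  classical
  induction s using Finset.induction_on with
  | empty => simpa using jet_one_le z
  | insert i s hi ih =>
    have h0 : 0 ≤ δ := (jet_nonneg hθ _ _).trans (hδ i)
    simp only [Finset.prod_insert hi, Finset.card_insert_of_notMem hi]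
    refine (jet_mul_le hθ (hf i) (contDiff_prod fun i _ => hf i) z).trans ?_
    rw [pow_succ']
    exact mul_le_mul (hδ i) ih (jet_nonneg hθ _ _) h0

theorem norm_iteratedFDeriv_le_jet (hθ : 0 < θ) (hθ1 : θ ≤ 1) {m : ℕ} (hm : m ≤ Q) (f : E → ℝ)
    (z : E) : ‖iteratedFDeriv ℝ m f z‖ ≤ Q.factorial * θ⁻¹ ^ Q * jet Q θ f z := by
  have h1 : θ ^ m / m.factorial * ‖iteratedFDeriv ℝ m f z‖ ≤ jet Q θ f z :=
    Finset.single_le_sum (f := fun m => θ ^ m / m.factorial * ‖iteratedFDeriv ℝ m f z‖)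
      (fun _ _ => by positivity) (Finset.mem_range_succ_iff.2 hm)
  have hf : (0 : ℝ) < m.factorial := by exact_mod_cast m.factorial_pos
  have h2 : ‖iteratedFDeriv ℝ m f z‖ = m.factorial * θ⁻¹ ^ m *
      (θ ^ m / m.factorial * ‖iteratedFDeriv ℝ m f z‖) := by
    rw [inv_pow]
    field_simp
  rw [h2]
  refine mul_le_mul ?_ h1 (by positivity) (by positivity)
  refine mul_le_mul (by exact_mod_cast Nat.factorial_le hm) ?_ (by positivity) (by positivity)
  exact pow_le_pow_right₀ ((one_le_inv₀ hθ).2 hθ1) hm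

theorem jet_le (hθ : 0 ≤ θ) {f : E → ℝ} {z : E} {B : ℝ}
    (hB : ∀ m ≤ Q, θ ^ m * ‖iteratedFDeriv ℝ m f z‖ ≤ B) : jet Q θ f z ≤ (Q + 1) * B := by
  have : ∀ m ∈ Finset.range (Q + 1), θ ^ m / m.factorial * ‖iteratedFDeriv ℝ m f z‖ ≤ B := by
    intro m hm
    refine le_trans ?_ (hB m (Finset.mem_range_succ_iff.1 hm))
    refine mul_le_mul_of_nonneg_right (div_le_self (by positivity) ?_) (norm_nonneg _)
    exact_mod_cast Nat.one_le_iff_ne_zero.2 m.factorial_ne_zero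
  refine (Finset.sum_le_sum this).trans (le_of_eq ?_)
  simp

end Jet

end HormanderOp

namespace HormanderOp

/-! ### Gram determinants and greedy selection of transverse vectors -/

section Gram

variable {E : Type*} [NormedAddCommGroup E] [InnerProductSpace ℝ E]

/-- The broad quantity tests subspaces of dimension exactly `k - 1`, while the vectors selected so
far may span less; their span is enlarged one line at a time. -/
theorem exists_submodule_finrank_eq [FiniteDimensional ℝ E] {m : ℕ} (hm : m ≤ Module.finrank ℝ E)
    (W : Submodule ℝ E) (hW : Module.finrank ℝ W ≤ m) :
    ∃ V : Submodule ℝ E, W ≤ V ∧ Module.finrank ℝ V = m := by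
  obtain ⟨i, hi⟩ := Nat.exists_eq_add_of_le hW
  induction i generalizing W with
  | zero => exact ⟨W, le_rfl, hi.symm⟩
  | succ i ih =>
    obtain ⟨x, hx⟩ := Submodule.exists_of_finrank_lt W (by omega)
    have hxW : x ∉ W := fun h => hx 1 one_ne_zero (by simpa using h)
    have h1 : W < W ⊔ ℝ ∙ x := by
      refine lt_of_le_of_ne le_sup_left fun h => hxW ?_
      rw [h]
      exact Submodule.mem_sup_right (Submodule.mem_span_singleton_self x)
    have h2 := Submodule.finrank_lt_finrank_of_lt h1
    have h3 := Submodule.finrank_add_le_finrank_add_finrank W (ℝ ∙ x)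
    have h4 := finrank_span_singleton (K := ℝ) (show x ≠ 0 by rintro rfl; exact hxW W.zero_mem)
    obtain ⟨V, hV, hV'⟩ := ih (W ⊔ ℝ ∙ x) (by omega) (by omega)
    exact ⟨V, le_sup_left.trans hV, hV'⟩

-- The Schur complement of the old Gram matrix in the new one is the squared distance from `u` to
-- the span of `v`. If the old determinant vanishes, positive semidefiniteness is enough.
open Matrix in
theorem le_det_gram_snoc {j : ℕ} (v : Fin j → E) (u : E) {δ : ℝ} (hδ : 0 ≤ δ)
    (hu : ∀ w ∈ Submodule.span ℝ (range v), δ ≤ ‖u - w‖) :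
    δ ^ 2 * (gram ℝ v).det ≤ (gram ℝ (Fin.snoc v u : Fin (j + 1) → E)).det := by
  by_cases h0 : (gram ℝ v).det = 0
  · rw [h0, mul_zero]
    exact (posSemidef_gram ℝ _).det_nonneg
  have hpos : 0 < (gram ℝ v).det := lt_of_le_of_ne (posSemidef_gram ℝ v).det_nonneg (Ne.symm h0)
  have hsnoc : (Fin.snoc v u : Fin (j + 1) → E) ∘ finSumFinEquiv =
      Sum.elim v (fun _ : Fin 1 => u) := by
    funext i
    rcases i with i | i
    · simp only [Function.comp_apply, finSumFinEquiv_apply_left, Sum.elim_inl]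
      exact Fin.snoc_castSucc (α := fun _ => E) u v i
    · simp only [Function.comp_apply, finSumFinEquiv_apply_right, Sum.elim_inr]
      have : Fin.natAdd j i = Fin.last j := by
        ext
        simp
      rw [this]
      exact Fin.snoc_last (α := fun _ => E) u v
  have hblock : (gram ℝ (Fin.snoc v u : Fin (j + 1) → E)).submatrix finSumFinEquiv finSumFinEquiv =
      fromBlocks (gram ℝ v) (of fun i (_ : Fin 1) => inner ℝ (v i) u)
        (of fun (_ : Fin 1) i => inner ℝ u (v i)) (of fun (_ _ : Fin 1) => inner ℝ u u) := by
    have h1 : ∀ a b, (gram ℝ (Fin.snoc v u : Fin (j + 1) → E)).submatrix finSumFinEquiv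
        finSumFinEquiv a b = inner ℝ (((Fin.snoc v u : Fin (j + 1) → E) ∘ finSumFinEquiv) a)
          (((Fin.snoc v u : Fin (j + 1) → E) ∘ finSumFinEquiv) b) := fun _ _ => rfl
    ext a b
    rw [h1, hsnoc]
    rcases a with a | a <;> rcases b with b | b <;> simp [gram_apply]
  rw [← det_submatrix_equiv_self finSumFinEquiv, hblock]
  let _ : Invertible (gram ℝ v) := invertibleOfIsUnitDet _ (Ne.isUnit h0)
  rw [det_fromBlocks₁₁, mul_comm]
  refine mul_le_mul_of_nonneg_left ?_ hpos.le
  rw [det_unique]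
  set b : Fin j → ℝ := fun i => inner ℝ (v i) u with hb
  -- These are the coefficients of the orthogonal projection of `u` onto the span of `v`: `hgc`
  -- below is the system of normal equations.
  set c : Fin j → ℝ := ⅟(gram ℝ v) *ᵥ b with hc
  have hgc : ∀ i, ∑ i', inner ℝ (v i) (v i') * c i' = b i := by
    intro i
    have h1 : gram ℝ v *ᵥ c = b := by
      rw [hc, mulVec_mulVec, mul_invOf_self, one_mulVec]
    exact congrFun h1 i
  have hw : ∑ i, c i • v i ∈ Submodule.span ℝ (range v) :=
    Submodule.sum_mem _ fun i _ => Submodule.smul_mem _ _ (Submodule.subset_span ⟨i, rfl⟩)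
  have h2 : δ ^ 2 ≤ ‖u - ∑ i, c i • v i‖ ^ 2 := pow_le_pow_left₀ hδ (hu _ hw) 2
  refine h2.trans (le_of_eq ?_)
  have h3 : inner ℝ u (∑ i, c i • v i) = ∑ i, c i * b i := by
    rw [inner_sum]
    refine Finset.sum_congr rfl fun i _ => ?_
    rw [inner_smul_right, hb, real_inner_comm]
  have h4 : inner ℝ (∑ i, c i • v i) (∑ i, c i • v i) = ∑ i, c i * b i := by
    rw [sum_inner]
    refine Finset.sum_congr rfl fun i _ => ?_
    rw [inner_smul_left, inner_sum, ← hgc i]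
    simp only [conj_trivial]
    congr 1
    refine Finset.sum_congr rfl fun i' _ => ?_
    rw [inner_smul_right, mul_comm]
  rw [norm_sub_sq_real, h3, ← real_inner_self_eq_norm_sq (∑ i, c i • v i), h4]
  have h5 : ((of fun (_ : Fin 1) i => inner ℝ u (v i)) * ⅟(gram ℝ v) *
      (of fun i (_ : Fin 1) => inner ℝ (v i) u)) default default = ∑ i, c i * b i := by
    rw [Matrix.mul_assoc, Matrix.mul_apply]
    refine Finset.sum_congr rfl fun i _ => ?_
    rw [mul_comm]
    congr 1
    rw [of_apply, hb, real_inner_comm]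
  rw [Matrix.sub_apply, h5, of_apply, real_inner_self_eq_norm_sq]
  ring

/-- Greedy selection of a quantitatively transverse tuple. -/
theorem exists_tuple_le_det_gram [FiniteDimensional ℝ E] {α : Type*} {P : α → Prop} {vec : α → E}
    {k : ℕ} (hk : k - 1 ≤ Module.finrank ℝ E) {δ : ℝ} (hδ : 0 ≤ δ)
    (h : ∀ V : Submodule ℝ E, Module.finrank ℝ V = k - 1 → ∃ a, P a ∧ ∀ w ∈ V, δ ≤ ‖vec a - w‖) :
    ∀ j ≤ k, ∃ a : Fin j → α, (∀ i, P (a i)) ∧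
      (δ ^ 2) ^ j ≤ (Matrix.gram ℝ fun i => vec (a i)).det := by
  intro j
  induction j with
  | zero => exact fun _ => ⟨Fin.elim0, fun i => i.elim0, by simp⟩
  | succ j ih =>
    intro hj
    obtain ⟨a, haP, ha⟩ := ih (by omega)
    have h1 : Module.finrank ℝ (Submodule.span ℝ (range fun i => vec (a i))) ≤ k - 1 :=
      (finrank_range_le_card fun i => vec (a i)).trans (by rw [Fintype.card_fin]; omega)
    obtain ⟨V, hV, hVk⟩ := exists_submodule_finrank_eq hk _ h1
    obtain ⟨x, hxP, hx⟩ := h V hVk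
    refine ⟨Fin.snoc a x, fun i => ?_, ?_⟩
    · refine Fin.lastCases ?_ (fun i => ?_) i
      · simpa using hxP
      · simpa using haP i
    · have h2 : (fun i => vec ((Fin.snoc a x : Fin (j + 1) → α) i)) =
          (Fin.snoc (fun i => vec (a i)) (vec x) : Fin (j + 1) → E) := by
        funext i
        refine Fin.lastCases ?_ (fun i => ?_) i <;> simp
      rw [h2]
      refine le_trans ?_ (le_det_gram_snoc _ _ hδ fun w hw => hx w (hV hw))
      rw [pow_succ']
      exact mul_le_mul_of_nonneg_left ha (by positivity)

/-- The distance from the unit vector `g` to the line through `w` is the sine of the angle between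
them, and `sin θ ≥ 2θ/π ≥ θ/2`. -/
theorem sin_le_norm_sub_of_lt_angle {V : Submodule ℝ E} {g : E} (hg : ‖g‖ = 1) {θ : ℝ}
    (hθ : 0 ≤ θ) (hθ' : θ ≤ 1)
    (h : ∀ v ∈ V, v ≠ 0 → θ < InnerProductGeometry.angle v g) {w : E} (hw : w ∈ V) :
    θ / 2 ≤ ‖g - w‖ := by
  have hpi := Real.pi_gt_three
  by_cases hw0 : w = 0
  · rw [hw0, sub_zero, hg]
    linarith
  set ψ := InnerProductGeometry.angle w g with hψ
  have h1 : θ < ψ := h w hw hw0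
  -- The angle lies in `[0, π]`, so it must also be kept away from `π`; the hypothesis for `-w` does
  -- this.
  have h2 : θ < Real.pi - ψ := by
    have := h (-w) (V.neg_mem hw) (neg_ne_zero.2 hw0)
    rwa [InnerProductGeometry.angle_neg_left] at this
  have h3 : Real.sin θ ≤ Real.sin ψ := by
    rcases le_total ψ (Real.pi / 2) with h4 | h4
    · exact Real.sin_le_sin_of_le_of_le_pi_div_two (by linarith) h4 h1.le
    · rw [← Real.sin_pi_sub ψ]
      exact Real.sin_le_sin_of_le_of_le_pi_div_two (by linarith) (by linarith) h2.le
  have h4 : θ / 2 ≤ Real.sin θ := by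
    have h5 := Real.mul_le_sin hθ (by linarith)
    refine le_trans ?_ h5
    have h6 : 1 / 2 ≤ 2 / Real.pi := by
      rw [div_le_div_iff₀ (by norm_num) (by linarith)]
      linarith [Real.pi_le_four]
    nlinarith
  have h5 : inner ℝ w g = ‖w‖ * Real.cos ψ := by
    rw [hψ, mul_comm, ← InnerProductGeometry.cos_angle_mul_norm_mul_norm, hg, mul_one]
  have h6 : Real.sin ψ ^ 2 ≤ ‖g - w‖ ^ 2 := by
    rw [norm_sub_sq_real, real_inner_comm, h5, hg, Real.sin_sq]
    nlinarith [sq_nonneg (‖w‖ - Real.cos ψ)]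
  have h7 : 0 ≤ Real.sin ψ := Real.sin_nonneg_of_nonneg_of_le_pi (by linarith) (by linarith)
  exact (h4.trans h3).trans (pow_le_pow_iff_left₀ h7 (norm_nonneg _) two_ne_zero |>.1 h6)

/-- The determinant is a polynomial in the inner products, hence `C¹`, and so Lipschitz on a compact
convex set. -/
theorem exists_det_gram_lipschitz (E : Type*) [NormedAddCommGroup E] [InnerProductSpace ℝ E]
    [FiniteDimensional ℝ E] (k : ℕ) : ∃ L : ℝ, 0 < L ∧ ∀ (u v : Fin k → E) (r : ℝ), 0 ≤ r →
    (∀ i, ‖u i‖ ≤ 1) → (∀ i, ‖v i‖ ≤ 1) → (∀ i, ‖u i - v i‖ ≤ r) →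
    |(Matrix.gram ℝ u).det - (Matrix.gram ℝ v).det| ≤ L * r := by
  have h1 : ContDiff ℝ 1 fun u : Fin k → E => (Matrix.gram ℝ u).det := by
    simp only [Matrix.det_apply, Matrix.gram_apply]
    refine ContDiff.sum fun σ _ => ContDiff.const_smul _ (contDiff_prod fun i _ => ?_)
    exact ContDiff.inner ℝ (contDiff_apply ℝ E _) (contDiff_apply ℝ E _)
  obtain ⟨L, hL⟩ := h1.contDiffOn.exists_lipschitzOnWith one_ne_zero
    (convex_closedBall (0 : Fin k → E) 1) (isCompact_closedBall 0 1)
  refine ⟨L + 1, by positivity, fun u v r hr hu hv huv => ?_⟩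
  have hu' : u ∈ Metric.closedBall (0 : Fin k → E) 1 := by
    rw [mem_closedBall_zero_iff]
    exact (pi_norm_le_iff_of_nonneg zero_le_one).2 hu
  have hv' : v ∈ Metric.closedBall (0 : Fin k → E) 1 := by
    rw [mem_closedBall_zero_iff]
    exact (pi_norm_le_iff_of_nonneg zero_le_one).2 hv
  have h2 := hL.dist_le_mul u hu' v hv'
  rw [Real.dist_eq] at h2
  refine h2.trans (mul_le_mul (by linarith) ?_ dist_nonneg (by positivity))
  exact (dist_pi_le_iff hr).2 fun i => by rw [dist_eq_norm]; exact huv i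

end Gram

/-! ### Regularity of the Gauss map -/

section Gauss

variable {d : ℕ}

theorem contDiff_wedgeVector {m : WithTop ℕ∞} :
    ContDiff ℝ m (wedgeVector : (Fin d → Space d) → Space d) := by
  rw [contDiff_euclidean]
  intro i
  simp only [wedgeVector, Matrix.det_apply]
  refine ContDiff.sum fun σ _ => ContDiff.const_smul _ (contDiff_prod fun s _ => ?_)
  simp only [Matrix.of_apply]
  refine Fin.lastCases ?_ (fun j => ?_) (σ s)
  · simp only [Fin.snoc_last]
    exact contDiff_const
  · simp only [Fin.snoc_castSucc]
    exact (contDiff_euclidean.1 (contDiff_apply ℝ (Space d) j)) s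

/-- Complete `v` to a basis by a vector `x`. The determinant of the basis is linear in `x`, with the
coordinates of `wedgeVector v` as coefficients; if these all vanished, so would the determinant. -/
theorem wedgeVector_ne_zero {v : Fin d → Space d} (hv : LinearIndependent ℝ v) :
    wedgeVector v ≠ 0 := by
  intro h0
  set w : Fin d → Fin (d + 1) → ℝ := fun j => (v j).ofLp with hw
  have hwli : LinearIndependent ℝ w :=
    hv.map' (WithLp.linearEquiv 2 ℝ (Fin (d + 1) → ℝ)).toLinearMap (LinearEquiv.ker _)
  obtain ⟨x, hx⟩ := exists_linearIndependent_snoc_of_lt_finrank (n := d) hwli (by simp)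
  have hdet : IsUnit (Matrix.det (Matrix.of (Fin.snoc w x : Fin (d + 1) → Fin (d + 1) → ℝ))) :=
    (Matrix.isUnit_iff_isUnit_det _).1 (Matrix.linearIndependent_rows_iff_isUnit.1 hx)
  refine hdet.ne_zero ?_
  set L : (Fin (d + 1) → ℝ) →ₗ[ℝ] ℝ :=
    (Matrix.detRowAlternating (R := ℝ) (n := Fin (d + 1))).toMultilinearMap.toLinearMap
      (Fin.snoc w 0 : Fin (d + 1) → Fin (d + 1) → ℝ) (Fin.last d) with hL
  have hLx : ∀ y, L y = Matrix.det (Matrix.of (Fin.snoc w y : Fin (d + 1) → Fin (d + 1) → ℝ)) := by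
    intro y
    have : Function.update (Fin.snoc w 0 : Fin (d + 1) → Fin (d + 1) → ℝ) (Fin.last d) y =
        Fin.snoc w y := by
      rw [Fin.update_snoc_last]
    change Matrix.det (Function.update (Fin.snoc w 0 : Fin (d + 1) → Fin (d + 1) → ℝ)
      (Fin.last d) y) = _
    rw [this]
    rfl
  rw [← hLx, LinearMap.pi_apply_eq_sum_univ L x]
  refine Finset.sum_eq_zero fun i _ => ?_
  have h1 : L (fun j => if i = j then 1 else 0) = 0 := by
    rw [hLx]
    have h2 : (fun j => if i = j then (1 : ℝ) else 0) = Pi.single i 1 := by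
      funext j
      simp [Pi.single_apply, eq_comm]
    rw [h2]
    exact congrArg (fun u : Space d => u i) h0
  rw [h1, smul_zero]

variable {φ : Space d × Freq d → ℝ}

theorem spatialGrad_eq {z : Space d × Freq d} (hφ : DifferentiableAt ℝ φ z) :
    spatialGrad φ z.1 z.2 = (InnerProductSpace.toDual ℝ (Space d)).symm
      ((fderiv ℝ φ z).comp (ContinuousLinearMap.inl ℝ (Space d) (Freq d))) := by
  have h1 : HasFDerivAt (fun y : Space d => φ (y, z.2))
      ((fderiv ℝ φ z).comp (ContinuousLinearMap.inl ℝ (Space d) (Freq d))) z.1 :=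
    HasFDerivAt.comp (f := fun y : Space d => (y, z.2)) z.1 hφ.hasFDerivAt
      (hasFDerivAt_prodMk_left z.1 z.2)
  rw [spatialGrad, gradient, h1.fderiv]

theorem contDiffAt_spatialGrad {z : Space d × Freq d} {m : ℕ}
    (hφ : ContDiffAt ℝ (m + 1 : ℕ) φ z) :
    ContDiffAt ℝ m (fun z : Space d × Freq d => spatialGrad φ z.1 z.2) z := by
  have h1 : ContDiffAt ℝ m (fun z => (InnerProductSpace.toDual ℝ (Space d)).symm
      ((fderiv ℝ φ z).comp (ContinuousLinearMap.inl ℝ (Space d) (Freq d)))) z := by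
    refine (LinearIsometryEquiv.contDiff _).contDiffAt.comp z ?_
    exact (hφ.fderiv_right (by norm_cast)).clm_comp contDiffAt_const
  refine h1.congr_of_eventuallyEq ?_
  filter_upwards [hφ.eventually (by simp)] with y hy
  exact spatialGrad_eq (hy.differentiableAt (by simp))

theorem contDiffAt_mixedHessian {z : Space d × Freq d} {m : ℕ}
    (hφ : ContDiffAt ℝ (m + 2 : ℕ) φ z) :
    ContDiffAt ℝ m (fun z : Space d × Freq d => mixedHessian φ z.1 z.2) z := by
  have h0 := contDiffAt_spatialGrad (m := m + 1) hφ
  have h1 : ContDiffAt ℝ m (fun z => (fderiv ℝ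
      (fun z : Space d × Freq d => spatialGrad φ z.1 z.2) z).comp
        (ContinuousLinearMap.inr ℝ (Space d) (Freq d))) z :=
    (h0.fderiv_right (by norm_cast)).clm_comp contDiffAt_const
  refine h1.congr_of_eventuallyEq ?_
  filter_upwards [h0.eventually (by simp)] with y hy
  have h2 : HasFDerivAt (fun w : Freq d => spatialGrad φ y.1 w)
      ((fderiv ℝ (fun z : Space d × Freq d => spatialGrad φ z.1 z.2) y).comp
        (ContinuousLinearMap.inr ℝ (Space d) (Freq d))) y.2 :=
    HasFDerivAt.comp (f := fun w : Freq d => (y.1, w)) y.2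
      (hy.differentiableAt (by simp)).hasFDerivAt
      (hasFDerivAt_prodMk_right y.1 y.2)
  rw [mixedHessian, h2.fderiv]

theorem contDiffAt_gauss₀ {z : Space d × Freq d} {m : ℕ} (hφ : ContDiffAt ℝ (m + 2 : ℕ) φ z) :
    ContDiffAt ℝ m (fun z : Space d × Freq d => gauss₀ φ z.1 z.2) z :=
  contDiff_wedgeVector.contDiffAt.comp z (contDiffAt_pi.2 fun _ =>
    (contDiffAt_mixedHessian hφ).clm_apply contDiffAt_const)

theorem gauss₀_ne_zero {x : Space d} {ω : Freq d}
    (h : Module.finrank ℝ (LinearMap.range (mixedHessian φ x ω).toLinearMap) = d) :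
    gauss₀ φ x ω ≠ 0 := by
  refine wedgeVector_ne_zero ?_
  have h1 := LinearMap.finrank_range_add_finrank_ker (mixedHessian φ x ω).toLinearMap
  rw [h, finrank_euclideanSpace_fin] at h1
  have h2 : LinearMap.ker (mixedHessian φ x ω).toLinearMap = ⊥ :=
    Submodule.finrank_eq_zero.1 (by omega)
  have h3 : LinearIndependent ℝ fun j : Fin d => (EuclideanSpace.single j (1 : ℝ) : Freq d) := by
    have := (EuclideanSpace.basisFun (Fin d) ℝ).toBasis.linearIndependent
    convert! this using 2 with j
    simp
  exact h3.map' _ h2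

theorem norm_gauss {x : Space d} {ω : Freq d} (h : gauss₀ φ x ω ≠ 0) : ‖gauss φ x ω‖ = 1 := by
  rw [gauss, norm_smul, norm_inv, norm_norm, inv_mul_cancel₀ (norm_ne_zero_iff.2 h)]

/-- By H1 the vector `gauss₀` does not vanish on the unit balls, so its normalisation is `C¹` there,
and the product of the balls is compact and convex. -/
theorem exists_gauss_lipschitz (hφ : ∀ z ∈ unitBalls d, ContDiffAt ℝ (⊤ : ℕ∞) φ z)
    (hr : ∀ x ω, (x, ω) ∈ unitBalls d →
      Module.finrank ℝ (LinearMap.range (mixedHessian φ x ω).toLinearMap) = d) :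
    ∃ L : ℝ, 0 < L ∧ ∀ z ∈ unitBalls d, ∀ z' ∈ unitBalls d,
      ‖gauss φ z.1 z.2 - gauss φ z'.1 z'.2‖ ≤ L * ‖z - z'‖ := by
  have hball : unitBalls d = Metric.closedBall (0 : Space d × Freq d) 1 :=
    (closedBall_prod_same 0 0 1)
  have h1 : ContDiffOn ℝ 1 (fun z : Space d × Freq d => gauss φ z.1 z.2) (unitBalls d) := by
    intro z hz
    refine ContDiffAt.contDiffWithinAt ?_
    have h2 : ContDiffAt ℝ 1 (fun z : Space d × Freq d => gauss₀ φ z.1 z.2) z :=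
      contDiffAt_gauss₀ (m := 1) ((hφ z hz).of_le (WithTop.coe_le_coe.2 le_top))
    have h3 : gauss₀ φ z.1 z.2 ≠ 0 := gauss₀_ne_zero (hr z.1 z.2 hz)
    exact ((h2.norm ℝ h3).inv (norm_ne_zero_iff.2 h3)).smul h2
  rw [hball] at h1 ⊢
  obtain ⟨L, hL⟩ := h1.exists_lipschitzOnWith one_ne_zero (convex_closedBall _ 1)
    (isCompact_closedBall _ 1)
  refine ⟨L + 1, by positivity, fun z hz z' hz' => ?_⟩
  have := hL.dist_le_mul z hz z' hz'
  rw [dist_eq_norm, dist_eq_norm] at this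
  nlinarith [norm_nonneg (z - z')]

end Gauss

end HormanderOp

namespace HormanderOp

/-! ### Global extension of the phase -/

theorem unitBalls_eq_closedBall (d : ℕ) :
    unitBalls d = Metric.closedBall (0 : Space d × Freq d) 1 :=
  closedBall_prod_same 0 0 1

/-- A function which is smooth at the points of the unit balls has, to finite order, a global
extension with bounded derivatives. -/
theorem exists_global_extension {d : ℕ} {φ : Space d × Freq d → ℝ}
    (hφ : ∀ z ∈ unitBalls d, ContDiffAt ℝ (⊤ : ℕ∞) φ z) (P : ℕ) :
    ∃ (ψ : Space d × Freq d → ℝ) (B : ℝ), 1 ≤ B ∧ ContDiff ℝ P ψ ∧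
      (∀ z ∈ unitBalls d, ψ =ᶠ[nhds z] φ) ∧ ∀ m ≤ P, ∀ z, ‖iteratedFDeriv ℝ m ψ z‖ ≤ B := by
  have hP : ∀ z ∈ unitBalls d, ContDiffAt ℝ P φ z := fun z hz =>
    (hφ z hz).of_le (WithTop.coe_le_coe.2 le_top)
  -- Here the finiteness of `P` matters: being `C^P` at a point is an open condition, whereas
  -- smoothness at a point allows the neighbourhood to shrink with the order.
  have hU : IsOpen {z | ContDiffAt ℝ P φ z} := by
    rw [isOpen_iff_mem_nhds]
    exact fun z hz => ContDiffAt.eventually hz (by simp)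
  have hK : IsCompact (unitBalls d) := by
    rw [unitBalls_eq_closedBall]
    exact isCompact_closedBall _ _
  obtain ⟨ε, hε, hεU⟩ := hK.exists_cthickening_subset_open hU hP
  obtain ⟨C, -, hC⟩ := exists_cutoff (Space d × Freq d)
  -- The cutoff is `1` near the unit balls and is supported within `ε / 3 + 2 * (ε / 6) < ε` of
  -- them, where `φ` is still `C^P`.
  obtain ⟨χ, hχ, -, hχ1, hχs, -⟩ := hC (Metric.thickening (ε / 3) (unitBalls d)) (ε / 6)
    (by positivity)
  have hts : tsupport χ ⊆ Metric.cthickening ε (unitBalls d) := by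
    refine closure_minimal (hχs.trans ?_) Metric.isClosed_cthickening
    refine (Metric.thickening_thickening_subset _ _ _).trans ?_
    exact (Metric.thickening_subset_cthickening_of_le (by linarith) _)
  have hcs : HasCompactSupport χ :=
    (hK.cthickening).of_isClosed_subset (isClosed_tsupport χ) hts
  have hψ : ContDiff ℝ P fun z => χ z * φ z := by
    rw [contDiff_iff_contDiffAt]
    intro z
    by_cases hz : z ∈ tsupport χ
    · exact (hχ.of_le (WithTop.coe_le_coe.2 le_top)).contDiffAt.mul (hεU (hts hz))
    · refine contDiffAt_const (c := (0 : ℝ)) |>.congr_of_eventuallyEq ?_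
      filter_upwards [(isClosed_tsupport χ).isOpen_compl.mem_nhds hz] with y hy
      rw [image_eq_zero_of_notMem_tsupport hy, zero_mul]
  have hψc : HasCompactSupport fun z => χ z * φ z := hcs.mul_right
  have hb : ∀ m : ℕ, ∃ B : ℝ, m ≤ P → ∀ z, ‖iteratedFDeriv ℝ m (fun z => χ z * φ z) z‖ ≤ B := by
    intro m
    by_cases hm : m ≤ P
    · obtain ⟨B, hB⟩ := (hψc.iteratedFDeriv m).exists_bound_of_continuous
        (hψ.continuous_iteratedFDeriv (by exact_mod_cast hm))
      exact ⟨B, fun _ => hB⟩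
    · exact ⟨0, fun h => absurd h hm⟩
  choose B hB using hb
  refine ⟨fun z => χ z * φ z, 1 + ∑ m ∈ Finset.range (P + 1), |B m|, ?_, hψ, ?_, ?_⟩
  · have : 0 ≤ ∑ m ∈ Finset.range (P + 1), |B m| := Finset.sum_nonneg fun _ _ => abs_nonneg _
    linarith
  · intro z hz
    filter_upwards [Metric.isOpen_thickening.mem_nhds
      (Metric.self_subset_thickening (show 0 < ε / 3 by positivity) _ hz)] with y hy
    rw [hχ1 y hy, one_mul]
  · intro m hm z
    refine (hB m hm z).trans ((le_abs_self _).trans ?_)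
    have := Finset.single_le_sum (f := fun m => |B m|) (fun _ _ => abs_nonneg _)
      (Finset.mem_range_succ_iff.2 hm)
    linarith

/-! ### Taylor expansion of a translated oscillating amplitude -/

section Expansion

variable {d : ℕ}

/-- The coordinate directions of the spatial factor. -/
def spaceDir (d : ℕ) (j : Fin (d + 1)) : Space d × Freq d := (EuclideanSpace.single j 1, 0)

theorem norm_spaceDir_le (j : Fin (d + 1)) : ‖spaceDir d j‖ ≤ 1 := by
  simp [spaceDir, Prod.norm_def]

theorem sum_smul_spaceDir (u : Space d) : ∑ j, u j • spaceDir d j = (u, 0) := by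
  refine Prod.ext ?_ ?_
  · rw [Prod.fst_sum]
    simp only [spaceDir, Prod.smul_fst]
    have := (EuclideanSpace.basisFun (Fin (d + 1)) ℝ).sum_repr u
    simpa using this
  · rw [Prod.snd_sum]
    simp [spaceDir]

/-- The normalised Taylor coefficient, at spatial scale `t`, in the directions `α`. -/
def taylorCoeff (t : ℝ) (f : Space d × Freq d → ℝ) {i : ℕ} (α : Fin i → Fin (d + 1))
    (z : Space d × Freq d) : ℝ :=
  t ^ i / i.factorial * dirDeriv (spaceDir d) f α z

/-- The monomial, at spatial scale `t`, which goes with `taylorCoeff`. -/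
def taylorMonomial (t : ℝ) (u : Space d) {i : ℕ} (α : Fin i → Fin (d + 1)) : ℝ :=
  ∏ j, u (α j) / t

theorem abs_taylorMonomial_le {t : ℝ} (ht : 0 < t) {u : Space d} (hu : ‖u‖ ≤ t) {i : ℕ}
    (α : Fin i → Fin (d + 1)) : |taylorMonomial t u α| ≤ 1 := by
  rw [taylorMonomial, Finset.abs_prod]
  refine Finset.prod_le_one (fun _ _ => abs_nonneg _) fun j _ => ?_
  rw [abs_div, abs_of_pos ht, div_le_one ht]
  exact (PiLp.norm_apply_le u (α j)).trans hu

theorem sum_taylorMonomial_mul_taylorCoeff {t : ℝ} (ht : 0 < t) (u : Space d)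
    (f : Space d × Freq d → ℝ) (i : ℕ) (z : Space d × Freq d) :
    ((i.factorial : ℝ))⁻¹ • iteratedFDeriv ℝ i f z (fun _ => ((u, 0) : Space d × Freq d)) =
      ∑ α : Fin i → Fin (d + 1), taylorMonomial t u α * taylorCoeff t f α z := by
  rw [← sum_smul_spaceDir, iteratedFDeriv_apply_sum_smul, Finset.smul_sum]
  refine Finset.sum_congr rfl fun α _ => ?_
  have h1 : ∏ j, u (α j) = t ^ i * taylorMonomial t u α := by
    rw [taylorMonomial, Finset.prod_div_distrib, Finset.prod_const, Finset.card_univ,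
      Fintype.card_fin]
    field_simp
  rw [h1, taylorCoeff, smul_eq_mul, smul_eq_mul]
  ring

theorem contDiff_taylorCoeff (t : ℝ) {f : Space d × Freq d → ℝ} {i m : ℕ}
    (α : Fin i → Fin (d + 1)) (hf : ContDiff ℝ (m + i : ℕ) f) :
    ContDiff ℝ m (taylorCoeff t f α) :=
  contDiff_const.mul (contDiff_dirDeriv _ α hf)

theorem norm_iteratedFDeriv_taylorCoeff_le {t : ℝ} (ht : 0 ≤ t) {f : Space d × Freq d → ℝ}
    {i m : ℕ} (α : Fin i → Fin (d + 1)) (hf : ContDiff ℝ (m + i : ℕ) f) (z : Space d × Freq d) :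
    ‖iteratedFDeriv ℝ m (taylorCoeff t f α) z‖ ≤ t ^ i * ‖iteratedFDeriv ℝ (m + i) f z‖ := by
  have h1 : taylorCoeff t f α = fun z => (t ^ i / i.factorial) • dirDeriv (spaceDir d) f α z := rfl
  rw [h1, iteratedFDeriv_const_smul_apply' (contDiff_dirDeriv _ α hf).contDiffAt, norm_smul]
  refine mul_le_mul ?_ (norm_iteratedFDeriv_dirDeriv_le norm_spaceDir_le α hf z) (norm_nonneg _)
    (by positivity)
  rw [Real.norm_of_nonneg (by positivity)]
  refine div_le_self (by positivity) ?_
  exact_mod_cast Nat.one_le_iff_ne_zero.2 i.factorial_ne_zero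

theorem tsupport_taylorCoeff_subset (t : ℝ) (f : Space d × Freq d → ℝ) {i : ℕ}
    (α : Fin i → Fin (d + 1)) : tsupport (taylorCoeff t f α) ⊆ tsupport f := by
  refine closure_minimal (fun z hz => ?_) (isClosed_tsupport f)
  refine tsupport_iteratedFDeriv_subset (𝕜 := ℝ) i (subset_tsupport _ fun h => hz ?_)
  rw [taylorCoeff, dirDeriv, h]
  simp

theorem contDiffAt_taylorCoeff_top (t : ℝ) {f : Space d × Freq d → ℝ} {i : ℕ}
    (α : Fin i → Fin (d + 1)) {z : Space d × Freq d} (hf : ContDiffAt ℝ (⊤ : ℕ∞) f z) :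
    ContDiffAt ℝ (⊤ : ℕ∞) (taylorCoeff t f α) z := by
  have h1 : ContDiffAt ℝ (⊤ : ℕ∞) (iteratedFDeriv ℝ i f) z :=
    hf.iteratedFDeriv_right (i := i) (by norm_cast)
  exact contDiffAt_const.mul ((ContinuousMultilinearMap.apply ℝ
    (fun _ : Fin i => Space d × Freq d) ℝ fun j => spaceDir d (α j)).contDiff.contDiffAt.comp z h1)

/-- The indices of the Taylor coefficients of orders `0, …, N - 1`. -/
abbrev TaylorIndex (d N : ℕ) : Type := (i : Fin N) × (Fin (i : ℕ) → Fin (d + 1))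

/-- The indices of the Taylor coefficients of orders `1, …, N`. -/
abbrev PosTaylorIndex (d N : ℕ) : Type := (i : Fin N) × (Fin ((i : ℕ) + 1) → Fin (d + 1))

theorem abs_sub_sum_taylor_le {N : ℕ} {f : Space d × Freq d → ℝ} (hf : ContDiff ℝ N f) {A : ℝ}
    (hA : ∀ z, ‖iteratedFDeriv ℝ N f z‖ ≤ A) {t : ℝ} (ht : 0 < t) {u : Space d} (hu : ‖u‖ ≤ t)
    (z : Space d × Freq d) :
    |f (z + (u, 0)) - ∑ β : TaylorIndex d N, taylorMonomial t u β.2 * taylorCoeff t f β.2 z| ≤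
      A * t ^ N := by
  have hA0 : 0 ≤ A := (norm_nonneg _).trans (hA z)
  have h := norm_add_sub_taylor_le hf hA z (u, 0)
  rw [Fintype.sum_sigma, Real.norm_eq_abs, Finset.sum_range] at *
  simp only [sum_taylorMonomial_mul_taylorCoeff ht] at h
  refine h.trans (mul_le_mul_of_nonneg_left (pow_le_pow_left₀ (norm_nonneg _) ?_ N) hA0)
  simpa [Prod.norm_def] using hu

theorem abs_sub_sum_posTaylor_le {N : ℕ} {f : Space d × Freq d → ℝ} (hf : ContDiff ℝ (N + 1 : ℕ) f)
    {A : ℝ} (hA : ∀ z, ‖iteratedFDeriv ℝ (N + 1) f z‖ ≤ A) {t : ℝ} (ht : 0 < t) {u : Space d}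
    (hu : ‖u‖ ≤ t) (z : Space d × Freq d) :
    |f (z + (u, 0)) - f z -
      ∑ γ : PosTaylorIndex d N, taylorMonomial t u γ.2 * taylorCoeff t f γ.2 z| ≤
      A * t ^ (N + 1) := by
  have hA0 : 0 ≤ A := (norm_nonneg _).trans (hA z)
  have h := norm_add_sub_taylor_le hf hA z (u, 0)
  rw [Fintype.sum_sigma]
  rw [Real.norm_eq_abs, Finset.sum_range_succ', Finset.sum_range] at h
  simp only [sum_taylorMonomial_mul_taylorCoeff ht (u := u)] at h
  have h0 : ∑ α : Fin 0 → Fin (d + 1), taylorMonomial t u α * taylorCoeff t f α z = f z := by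
    simp [taylorMonomial, taylorCoeff, dirDeriv]
  rw [h0, add_comm _ (f z), ← sub_sub] at h
  refine h.trans (mul_le_mul_of_nonneg_left (pow_le_pow_left₀ (norm_nonneg _) ?_ _) hA0)
  simpa [Prod.norm_def] using hu

/-- Replacing `x` by `y` costs `η` because `t ↦ exp (I t)` is `1`-Lipschitz on the real line; the
tail of the exponential series at `|y| ≤ 1/2` costs `exp (1/2) * 2^{-m}`. -/
theorem norm_exp_I_mul_sub_sum_le {x y η : ℝ} (hxy : |x - y| ≤ η) (hy : |y| ≤ 1 / 2) (m : ℕ) :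
    ‖Complex.exp (Complex.I * x) - ∑ l : Fin m, (Complex.I * y) ^ (l : ℕ) / (l : ℕ).factorial‖ ≤
      η + 2 * (1 / 2) ^ m := by
  have h1 : ‖Complex.exp (Complex.I * x) - Complex.exp (Complex.I * y)‖ ≤ η := by
    have h2 : Complex.exp (Complex.I * x) - Complex.exp (Complex.I * y) =
        Complex.exp (Complex.I * y) * (Complex.exp (Complex.I * ((x - y : ℝ) : ℂ)) - 1) := by
      rw [mul_sub, ← Complex.exp_add]
      push_cast
      ring_nf
    rw [h2, norm_mul, Complex.norm_exp_I_mul_ofReal, one_mul]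
    exact (Real.norm_exp_I_mul_ofReal_sub_one_le).trans (by simpa using hxy)
  have h3 : ‖Complex.exp (Complex.I * y) -
      ∑ l : Fin m, (Complex.I * y) ^ (l : ℕ) / (l : ℕ).factorial‖ ≤ 2 * (1 / 2) ^ m := by
    have h4 := Complex.norm_exp_sub_sum_le_norm_mul_exp (Complex.I * y) m
    rw [Finset.sum_range] at h4
    have h5 : ‖Complex.I * (y : ℂ)‖ ≤ 1 / 2 := by simpa using hy
    refine h4.trans ?_
    rw [mul_comm]
    refine mul_le_mul ?_ (pow_le_pow_left₀ (norm_nonneg _) h5 m) (by positivity) (by norm_num)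
    have h6 : Real.exp (1 / 2) ^ 2 < 4 := by
      rw [← Real.exp_nat_mul]
      norm_num
      linarith [Real.exp_one_lt_d9]
    have h7 : Real.exp (1 / 2) ≤ 2 := by nlinarith [Real.exp_pos (1 / 2)]
    exact (Real.exp_le_exp.2 h5).trans h7
  calc _ = ‖(Complex.exp (Complex.I * x) - Complex.exp (Complex.I * y)) +
      (Complex.exp (Complex.I * y) -
        ∑ l : Fin m, (Complex.I * y) ^ (l : ℕ) / (l : ℕ).factorial)‖ := by rw [sub_add_sub_cancel]
    _ ≤ _ := (norm_add_le _ _).trans (add_le_add h1 h3)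

/-- The indices of the terms of the expansion of a translated oscillating amplitude. -/
abbrev ExpansionIndex (d N m : ℕ) : Type :=
  ((l : Fin m) × (Fin (l : ℕ) → PosTaylorIndex d N)) × TaylorIndex d N

/-- The terms of the expansion of a translated oscillating amplitude. -/
def expansionTerm (t : ℝ) (Φ a : Space d × Freq d → ℝ) {N m : ℕ} (ι : ExpansionIndex d N m)
    (z : Space d × Freq d) : ℝ :=
  (((ι.1.1 : ℕ).factorial : ℝ))⁻¹ *
    ((∏ j, taylorCoeff t Φ (ι.1.2 j).2 z) * taylorCoeff t a ι.2.2 z)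

/-- The coefficients of the expansion of a translated oscillating amplitude. -/
def expansionCoeff (t : ℝ) (u : Space d) {N m : ℕ} (ι : ExpansionIndex d N m) : ℂ :=
  Complex.I ^ (ι.1.1 : ℕ) *
    (((∏ j, taylorMonomial t u (ι.1.2 j).2) * taylorMonomial t u ι.2.2 : ℝ) : ℂ)

theorem norm_expansionCoeff_le {t : ℝ} (ht : 0 < t) {u : Space d} (hu : ‖u‖ ≤ t) {N m : ℕ}
    (ι : ExpansionIndex d N m) : ‖expansionCoeff t u ι‖ ≤ 1 := by
  rw [expansionCoeff, norm_mul, norm_pow, Complex.norm_I, one_pow, one_mul, Complex.norm_real,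
    Real.norm_eq_abs, abs_mul, Finset.abs_prod]
  exact mul_le_one₀ (Finset.prod_le_one (fun _ _ => abs_nonneg _)
    fun _ _ => abs_taylorMonomial_le ht hu _) (abs_nonneg _) (abs_taylorMonomial_le ht hu _)

/-- Every monomial in the Taylor polynomials is a function of `u` times a function of `z`. Expanding
the `l`-th power over maps from `Fin l` into the indices preserves this splitting. -/
theorem sum_expansion (t : ℝ) (Φ a : Space d × Freq d → ℝ) (N m : ℕ) (u : Space d)
    (z : Space d × Freq d) :
    ∑ ι : ExpansionIndex d N m, expansionCoeff t u ι * (expansionTerm t Φ a ι z : ℂ) =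
      (∑ l : Fin m, (Complex.I * ((∑ γ : PosTaylorIndex d N,
        taylorMonomial t u γ.2 * taylorCoeff t Φ γ.2 z : ℝ) : ℂ)) ^ (l : ℕ) / (l : ℕ).factorial) *
      ((∑ β : TaylorIndex d N, taylorMonomial t u β.2 * taylorCoeff t a β.2 z : ℝ) : ℂ) := by
  rw [Fintype.sum_prod_type, Fintype.sum_sigma, Finset.sum_mul]
  refine Finset.sum_congr rfl fun l _ => ?_
  rw [mul_pow, ← Complex.ofReal_pow, Fintype.sum_pow]
  push_cast
  rw [mul_div_right_comm, mul_assoc, Finset.sum_mul_sum, Finset.mul_sum]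
  refine Finset.sum_congr rfl fun g _ => ?_
  rw [Finset.mul_sum]
  refine Finset.sum_congr rfl fun β _ => ?_
  simp only [expansionCoeff, expansionTerm]
  push_cast
  rw [Finset.prod_mul_distrib]
  ring

/-- Two replacements are made one after the other: the exponential by its truncated series in the
Taylor polynomial of the phase difference, then the amplitude by its Taylor polynomial. The
truncated series is at most `2` because its argument is at most `1/2`, which is where `hδ` and `hδ'`
enter. -/
theorem norm_sub_expansion_le {N m : ℕ} {Φ a : Space d × Freq d → ℝ}
    (hΦ : ContDiff ℝ (N + 1 : ℕ) Φ) (ha : ContDiff ℝ N a) {A B : ℝ}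
    (hB : ∀ z, ‖iteratedFDeriv ℝ (N + 1) Φ z‖ ≤ B) (hA : ∀ z, ‖iteratedFDeriv ℝ N a z‖ ≤ A)
    (hA' : ∀ z, |a z| ≤ A) {t : ℝ} (ht : 0 < t) {u : Space d} (hu : ‖u‖ ≤ t)
    {z : Space d × Freq d} {δ : ℝ} (hδ : ∀ γ : PosTaylorIndex d N, |taylorCoeff t Φ γ.2 z| ≤ δ)
    (hδ' : Fintype.card (PosTaylorIndex d N) * δ ≤ 1 / 2) :
    ‖Complex.exp (Complex.I * ((Φ (z + (u, 0)) - Φ z : ℝ) : ℂ)) * (a (z + (u, 0)) : ℂ) -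
      ∑ ι : ExpansionIndex d N m, expansionCoeff t u ι * (expansionTerm t Φ a ι z : ℂ)‖ ≤
      A * (B * t ^ (N + 1) + 2 * (1 / 2) ^ m + 2 * t ^ N) := by
  have hA0 : 0 ≤ A := (abs_nonneg _).trans (hA' z)
  rw [sum_expansion]
  set y : ℝ := ∑ γ : PosTaylorIndex d N, taylorMonomial t u γ.2 * taylorCoeff t Φ γ.2 z with hy
  set b : ℝ := ∑ β : TaylorIndex d N, taylorMonomial t u β.2 * taylorCoeff t a β.2 z with hb
  set S : ℂ := ∑ l : Fin m, (Complex.I * (y : ℂ)) ^ (l : ℕ) / (l : ℕ).factorial with hS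
  have hy' : |y| ≤ 1 / 2 := by
    refine (Finset.abs_sum_le_sum_abs _ _).trans (le_trans ?_ hδ')
    refine (Finset.sum_le_card_nsmul _ _ δ fun γ _ => ?_).trans (le_of_eq ?_)
    · rw [abs_mul]
      exact (mul_le_of_le_one_left (abs_nonneg _) (abs_taylorMonomial_le ht hu _)).trans (hδ γ)
    · rw [nsmul_eq_mul, Finset.card_univ]
  have h1 := norm_exp_I_mul_sub_sum_le (abs_sub_sum_posTaylor_le hΦ hB ht hu z) hy' m
  have h2 := abs_sub_sum_taylor_le ha hA ht hu z
  rw [← hb] at h2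
  have h3 : ‖S‖ ≤ 2 := by
    refine (norm_sum_le _ _).trans ?_
    have h4 : ∀ l : Fin m, ‖(Complex.I * (y : ℂ)) ^ (l : ℕ) / ((l : ℕ).factorial : ℂ)‖ ≤
        (1 / 2) ^ (l : ℕ) := by
      intro l
      rw [norm_div, norm_pow, norm_mul, Complex.norm_I, one_mul, Complex.norm_real,
        Complex.norm_natCast]
      refine (div_le_self (by positivity) ?_).trans (pow_le_pow_left₀ (norm_nonneg _) hy' _)
      exact_mod_cast Nat.one_le_iff_ne_zero.2 (l : ℕ).factorial_ne_zero
    refine (Finset.sum_le_sum fun l _ => h4 l).trans ?_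
    rw [← Finset.sum_range fun l => ((1 : ℝ) / 2) ^ l]
    exact sum_geometric_two_le m
  have h5 : Complex.exp (Complex.I * ((Φ (z + (u, 0)) - Φ z : ℝ) : ℂ)) * (a (z + (u, 0)) : ℂ) -
      S * (b : ℂ) = (Complex.exp (Complex.I * ((Φ (z + (u, 0)) - Φ z : ℝ) : ℂ)) - S) *
        (a (z + (u, 0)) : ℂ) + S * ((a (z + (u, 0)) - b : ℝ) : ℂ) := by
    push_cast
    ring
  rw [h5]
  refine (norm_add_le _ _).trans ?_
  rw [norm_mul, norm_mul, Complex.norm_real, Complex.norm_real, Real.norm_eq_abs, Real.norm_eq_abs]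
  have h6 : 0 ≤ B * t ^ (N + 1) + 2 * (1 / 2) ^ m := (norm_nonneg _).trans h1
  calc _ ≤ (B * t ^ (N + 1) + 2 * (1 / 2) ^ m) * A + 2 * (A * t ^ N) :=
        add_le_add (mul_le_mul h1 (hA' _) (abs_nonneg _) h6)
          (mul_le_mul h3 h2 (abs_nonneg _) (by norm_num))
    _ = _ := by ring

end Expansion

end HormanderOp

namespace HormanderOp

/-! ### Smallness of the expansion after removal of the linear part of the phase -/

theorem jet_const_le {E : Type*} [NormedAddCommGroup E] [NormedSpace ℝ E] {Q : ℕ} {θ : ℝ} (c : ℝ)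
    (z : E) : jet Q θ (fun _ : E => c) z ≤ |c| := by
  rw [jet, Finset.sum_eq_single 0]
  · simp
  · intro m _ hm
    simp [iteratedFDeriv_const_of_ne hm]
  · simp

theorem abs_le_jet {E : Type*} [NormedAddCommGroup E] [NormedSpace ℝ E] {Q : ℕ} {θ : ℝ}
    (hθ : 0 ≤ θ) (f : E → ℝ) (z : E) : |f z| ≤ jet Q θ f z := by
  have h := Finset.single_le_sum (f := fun m => θ ^ m / m.factorial * ‖iteratedFDeriv ℝ m f z‖)
    (fun _ _ => by positivity) (Finset.mem_range.2 (Nat.succ_pos Q))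
  simpa [jet, norm_iteratedFDeriv_zero] using h

variable {d : ℕ}

/-- The oscillating factor `e^{2πi λ ψ(z)}`. -/
def osc (lam : ℝ) (ψ : Space d × Freq d → ℝ) (z : Space d × Freq d) : ℂ :=
  Complex.exp (2 * Real.pi * Complex.I * ((lam * ψ z : ℝ) : ℂ))

theorem osc_eq (lam : ℝ) (ψ : Space d × Freq d → ℝ) (z : Space d × Freq d) :
    osc lam ψ z = Complex.exp (((2 * Real.pi * (lam * ψ z) : ℝ) : ℂ) * Complex.I) := by
  rw [osc]
  congr 1
  push_cast
  ring

theorem norm_osc (lam : ℝ) (ψ : Space d × Freq d → ℝ) (z : Space d × Freq d) :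
    ‖osc lam ψ z‖ = 1 := by
  rw [osc_eq, Complex.norm_exp_ofReal_mul_I]

/-- The phase, with its linear part at `z₀` removed. -/
def centredPhase (lam : ℝ) (ψ : Space d × Freq d → ℝ) (z₀ z : Space d × Freq d) : ℝ :=
  (2 * Real.pi * lam) • (ψ z - fderiv ℝ ψ z₀ z)

theorem contDiff_centredPhase (lam : ℝ) {ψ : Space d × Freq d → ℝ} {P : ℕ} (hψ : ContDiff ℝ P ψ)
    (z₀ : Space d × Freq d) : ContDiff ℝ P (centredPhase lam ψ z₀) :=
  (hψ.sub (fderiv ℝ ψ z₀).contDiff).const_smul _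

theorem norm_iteratedFDeriv_centredPhase {lam : ℝ} (hlam : 0 ≤ lam) {ψ : Space d × Freq d → ℝ}
    {j : ℕ} (hψ : ContDiff ℝ (j + 1 : ℕ) ψ) (z₀ z : Space d × Freq d) :
    ‖iteratedFDeriv ℝ (j + 1) (centredPhase lam ψ z₀) z‖ =
      2 * Real.pi * lam * ‖iteratedFDeriv ℝ j (fun z => fderiv ℝ ψ z - fderiv ℝ ψ z₀) z‖ := by
  have h1 : ContDiff ℝ (j + 1 : ℕ) fun z => ψ z - fderiv ℝ ψ z₀ z :=
    hψ.sub (fderiv ℝ ψ z₀).contDiff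
  have hd : Differentiable ℝ ψ := hψ.differentiable (by simp)
  have h2 : (fderiv ℝ fun z => ψ z - fderiv ℝ ψ z₀ z) =
      fun z => fderiv ℝ ψ z - fderiv ℝ ψ z₀ := by
    funext y
    rw [fderiv_fun_sub (hd y) (fderiv ℝ ψ z₀).differentiableAt, ContinuousLinearMap.fderiv]
  have h3 : centredPhase lam ψ z₀ =
      fun z => (2 * Real.pi * lam) • (fun z => ψ z - fderiv ℝ ψ z₀ z) z := rfl
  have hpi := Real.pi_pos
  rw [h3, iteratedFDeriv_const_smul_apply' h1.contDiffAt, norm_smul,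
    Real.norm_of_nonneg (by positivity), ← norm_iteratedFDeriv_fderiv, h2]

theorem norm_iteratedFDeriv_centredPhase_le {lam : ℝ} (hlam : 0 ≤ lam) {ψ : Space d × Freq d → ℝ}
    {j : ℕ} (hψ : ContDiff ℝ (j + 2 : ℕ) ψ) {B : ℝ} (z₀ z : Space d × Freq d)
    (hB : ‖iteratedFDeriv ℝ (j + 2) ψ z‖ ≤ B) :
    ‖iteratedFDeriv ℝ (j + 2) (centredPhase lam ψ z₀) z‖ ≤ 2 * Real.pi * lam * B := by
  rw [norm_iteratedFDeriv_centredPhase hlam hψ]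
  have hpi := Real.pi_pos
  refine mul_le_mul_of_nonneg_left ?_ (by positivity)
  have h1 : ContDiff ℝ (j + 1 : ℕ) (fderiv ℝ ψ) := hψ.fderiv_right (by norm_cast)
  have h2 : (fun z => fderiv ℝ ψ z - fderiv ℝ ψ z₀) =
      fderiv ℝ ψ - fun _ => fderiv ℝ ψ z₀ := rfl
  rw [h2, iteratedFDeriv_sub_apply h1.contDiffAt contDiff_const.contDiffAt,
    iteratedFDeriv_const_of_ne (Nat.succ_ne_zero j)]
  simp only [Pi.zero_apply, sub_zero]
  rwa [norm_iteratedFDeriv_fderiv]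

theorem norm_iteratedFDeriv_one_centredPhase_le {lam : ℝ} (hlam : 0 ≤ lam)
    {ψ : Space d × Freq d → ℝ} (hψ : ContDiff ℝ (2 : ℕ) ψ) {B : ℝ}
    (hB : ∀ z, ‖iteratedFDeriv ℝ 2 ψ z‖ ≤ B) (z₀ z : Space d × Freq d) :
    ‖iteratedFDeriv ℝ 1 (centredPhase lam ψ z₀) z‖ ≤ 2 * Real.pi * lam * (B * ‖z - z₀‖) := by
  rw [norm_iteratedFDeriv_centredPhase (j := 0) hlam (hψ.of_le (by norm_num))]
  have hpi := Real.pi_pos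
  refine mul_le_mul_of_nonneg_left ?_ (by positivity)
  rw [norm_iteratedFDeriv_zero]
  have h1 : ContDiff ℝ (1 : ℕ) (fderiv ℝ ψ) := hψ.fderiv_right (by norm_num)
  refine Convex.norm_image_sub_le_of_norm_fderiv_le (𝕜 := ℝ) (s := univ)
    (fun y _ => (h1.differentiable (by simp)) y) (fun y _ => ?_) convex_univ (mem_univ _)
    (mem_univ _)
  rw [← norm_iteratedFDeriv_zero (𝕜 := ℝ) (f := fderiv ℝ (fderiv ℝ ψ)), norm_iteratedFDeriv_fderiv,
    norm_iteratedFDeriv_fderiv]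
  exact hB y

/-- The phase itself changes by as much as `λ|v|`, too much for a Taylor expansion of the
exponential. Its linear part at `z₀` accounts for this and yields a unimodular factor independent of
`z`; only the centred remainder has to be expanded. -/
theorem osc_add (lam : ℝ) (ψ : Space d × Freq d → ℝ) (z₀ z v : Space d × Freq d) :
    osc lam ψ (z + v) = osc lam ψ z * osc lam (fderiv ℝ ψ z₀) v *
      Complex.exp (Complex.I *
        ((centredPhase lam ψ z₀ (z + v) - centredPhase lam ψ z₀ z : ℝ) : ℂ)) := by
  simp only [osc, ← Complex.exp_add, centredPhase, map_add, smul_eq_mul]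
  congr 1
  push_cast
  ring

/-- Each coefficient carries at least one power of `t`, which is paired with the `λ` of the phase. A
further factor of size `ρ` or `t` always appears: from the centring when only one derivative of the
phase is involved, and from the weights of the jet or of the Taylor monomial when there are more. -/
theorem jet_taylorCoeff_centredPhase_le {Q N : ℕ} {lam t ρ B : ℝ} (hlam : 0 ≤ lam) (ht : 0 < t)
    (ht1 : t ≤ 1) (hρ : 0 < ρ) (hρ1 : ρ ≤ 1) (hB0 : 0 ≤ B) {ψ : Space d × Freq d → ℝ}
    (hψ : ContDiff ℝ (Q + N + 1 : ℕ) ψ)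
    (hB : ∀ m ≤ Q + N + 1, ∀ z, ‖iteratedFDeriv ℝ m ψ z‖ ≤ B) (z₀ : Space d × Freq d)
    {z : Space d × Freq d} (hz : ‖z - z₀‖ ≤ 3 * ρ) (γ : PosTaylorIndex d N) :
    jet Q ρ (taylorCoeff t (centredPhase lam ψ z₀) γ.2) z ≤
      (Q + 1) * (2 * Real.pi * (t * lam) * B * (3 * ρ + t)) := by
  have hpi := Real.pi_pos
  refine jet_le hρ.le fun m hm => ?_
  obtain ⟨i, α⟩ := γ
  have hi := i.2
  have hm1 : ContDiff ℝ (m + ((i : ℕ) + 1) : ℕ) (centredPhase lam ψ z₀) :=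
    contDiff_centredPhase lam (hψ.of_le (by norm_cast; omega)) z₀
  have h1 := norm_iteratedFDeriv_taylorCoeff_le ht.le α hm1 z
  have hlB : 0 ≤ 2 * Real.pi * lam * B := by positivity
  suffices h : ρ ^ m * (t ^ ((i : ℕ) + 1) *
      ‖iteratedFDeriv ℝ (m + ((i : ℕ) + 1)) (centredPhase lam ψ z₀) z‖) ≤
      t * (3 * ρ + t) * (2 * Real.pi * lam * B) by
    refine (mul_le_mul_of_nonneg_left h1 (by positivity)).trans (h.trans (le_of_eq ?_))
    ring
  -- A first derivative in total is the only case which uses the closeness of `z` to `z₀`.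
  rcases Nat.eq_zero_or_pos (m + (i : ℕ)) with h0 | h0
  · obtain ⟨rfl, hi0⟩ : m = 0 ∧ (i : ℕ) = 0 := by omega
    rw [hi0]
    have h2 := norm_iteratedFDeriv_one_centredPhase_le hlam
      (hψ.of_le (by norm_cast; omega)) (hB 2 (by omega)) z₀ z
    simp only [pow_zero, zero_add, pow_one, one_mul]
    have h3 : 2 * Real.pi * lam * (B * ‖z - z₀‖) ≤ (3 * ρ + t) * (2 * Real.pi * lam * B) := by
      nlinarith
    rw [mul_assoc]
    exact mul_le_mul_of_nonneg_left (h2.trans h3) ht.le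
  · obtain ⟨j, hj⟩ := Nat.exists_eq_add_of_le h0
    have hj' : m + ((i : ℕ) + 1) = j + 2 := by omega
    have h2 : ‖iteratedFDeriv ℝ (m + ((i : ℕ) + 1)) (centredPhase lam ψ z₀) z‖ ≤
        2 * Real.pi * lam * B := by
      rw [hj']
      exact norm_iteratedFDeriv_centredPhase_le hlam (hψ.of_le (by norm_cast; omega)) z₀ z
        (hB _ (by omega) z)
    have h3 : ρ ^ m * t ^ ((i : ℕ) + 1) ≤ t * (3 * ρ + t) := by
      rcases Nat.eq_zero_or_pos m with hm0 | hm0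
      · have h4 : t ^ ((i : ℕ) + 1) ≤ t ^ 2 := pow_le_pow_of_le_one ht.le ht1 (by omega)
        rw [hm0, pow_zero, one_mul]
        nlinarith [mul_pos ht hρ]
      · have h4 : ρ ^ m ≤ ρ ^ 1 := pow_le_pow_of_le_one hρ.le hρ1 hm0
        have h5 : t ^ ((i : ℕ) + 1) ≤ t ^ 1 := pow_le_pow_of_le_one ht.le ht1 (by omega)
        calc _ ≤ ρ ^ 1 * t ^ 1 := mul_le_mul h4 h5 (by positivity) (by positivity)
          _ ≤ _ := by nlinarith [mul_pos ht hρ, mul_pos ht ht]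
    rw [← mul_assoc]
    exact mul_le_mul h3 h2 (norm_nonneg _) (by positivity)

theorem contDiff_expansionTerm {Q N m : ℕ} (t : ℝ) {Φ a : Space d × Freq d → ℝ}
    (hΦ : ContDiff ℝ (Q + N : ℕ) Φ) (ha : ContDiff ℝ (Q + N : ℕ) a) (ι : ExpansionIndex d N m) :
    ContDiff ℝ Q (expansionTerm t Φ a ι) := by
  refine contDiff_const.mul ((contDiff_prod fun j _ => contDiff_taylorCoeff t _
    (hΦ.of_le ?_)).mul (contDiff_taylorCoeff t _ (ha.of_le ?_)))
  · have := (ι.1.2 j).1.2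
    norm_cast
    omega
  · have := ι.2.1.2
    norm_cast
    omega

theorem jet_expansionTerm_le {Q N m : ℕ} {t θ : ℝ} (ht : 0 ≤ t) (ht1 : t ≤ 1) (hθ : 0 ≤ θ)
    (hθ1 : θ ≤ 1)
    {Φ a : Space d × Freq d → ℝ} (hΦ : ContDiff ℝ (Q + N : ℕ) Φ) (ha : ContDiff ℝ (Q + N : ℕ) a)
    {A δ : ℝ} (hA : ∀ m ≤ Q + N, ∀ z, ‖iteratedFDeriv ℝ m a z‖ ≤ A) {z : Space d × Freq d}
    (hδ : ∀ γ : PosTaylorIndex d N, jet Q θ (taylorCoeff t Φ γ.2) z ≤ δ)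
    (hδ0 : 0 ≤ δ) (ι : ExpansionIndex d N m) :
    jet Q θ (expansionTerm t Φ a ι) z ≤ δ ^ (ι.1.1 : ℕ) * ((Q + 1) * A) := by
  have h1 : ∀ j, ContDiff ℝ Q (taylorCoeff t Φ (ι.1.2 j).2) := fun j =>
    contDiff_taylorCoeff t _ (hΦ.of_le (by have := (ι.1.2 j).1.2; norm_cast; omega))
  have h2 : ContDiff ℝ Q (taylorCoeff t a ι.2.2) :=
    contDiff_taylorCoeff t _ (ha.of_le (by have := ι.2.1.2; norm_cast; omega))
  have h3 : ContDiff ℝ Q fun z => ∏ j, taylorCoeff t Φ (ι.1.2 j).2 z :=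
    contDiff_prod fun j _ => h1 j
  have h4 : jet Q θ (taylorCoeff t a ι.2.2) z ≤ (Q + 1) * A := by
    refine jet_le hθ fun m hm => ?_
    have h5 := norm_iteratedFDeriv_taylorCoeff_le (m := m) ht ι.2.2
      (ha.of_le (by have := ι.2.1.2; norm_cast; omega)) z
    have h6 : t ^ (ι.2.1 : ℕ) ≤ 1 := pow_le_one₀ ht ht1
    have h7 : θ ^ m ≤ 1 := pow_le_one₀ hθ hθ1
    refine (mul_le_of_le_one_left (norm_nonneg _) h7).trans (h5.trans ?_)
    refine (mul_le_of_le_one_left (norm_nonneg _) h6).trans (hA _ ?_ z)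
    have := ι.2.1.2
    omega
  have h5 : jet Q θ (fun z => ∏ j, taylorCoeff t Φ (ι.1.2 j).2 z) z ≤ δ ^ (ι.1.1 : ℕ) := by
    have := jet_prod_le hθ Finset.univ h1 z fun j => hδ (ι.1.2 j)
    simpa using this
  have h6 : |(((ι.1.1 : ℕ).factorial : ℝ))⁻¹| ≤ 1 := by
    rw [abs_of_nonneg (by positivity)]
    exact inv_le_one_of_one_le₀ (by exact_mod_cast Nat.one_le_iff_ne_zero.2 (Nat.factorial_ne_zero _))
  calc _ ≤ jet Q θ (fun _ => (((ι.1.1 : ℕ).factorial : ℝ))⁻¹) z * jet Q θ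
        (fun z => (∏ j, taylorCoeff t Φ (ι.1.2 j).2 z) * taylorCoeff t a ι.2.2 z) z :=
        jet_mul_le hθ contDiff_const (h3.mul h2) z
    _ ≤ 1 * (δ ^ (ι.1.1 : ℕ) * ((Q + 1) * A)) := by
        refine mul_le_mul ((jet_const_le _ z).trans h6) ?_ (jet_nonneg hθ _ _) zero_le_one
        exact (jet_mul_le hθ h3 h2 z).trans
          (mul_le_mul h5 h4 (jet_nonneg hθ _ _) (by positivity))
    _ = _ := one_mul _

theorem tsupport_expansionTerm_subset {N m : ℕ} (t : ℝ) (Φ a : Space d × Freq d → ℝ)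
    (ι : ExpansionIndex d N m) : tsupport (expansionTerm t Φ a ι) ⊆ tsupport a := by
  refine closure_minimal (fun z hz => ?_) (isClosed_tsupport a)
  refine tsupport_taylorCoeff_subset t a ι.2.2 (subset_tsupport _ fun h => hz ?_)
  rw [expansionTerm, h]
  simp

/-- The extended phase has only finite regularity globally, but each term carries a derivative of
`a` and vanishes off its support; on the support the phase is smooth. -/
theorem contDiff_top_expansionTerm {N m : ℕ} (t : ℝ) {Φ a : Space d × Freq d → ℝ}
    (ha : ContDiff ℝ (⊤ : ℕ∞) a) (hΦ : ∀ z ∈ tsupport a, ContDiffAt ℝ (⊤ : ℕ∞) Φ z)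
    (ι : ExpansionIndex d N m) : ContDiff ℝ (⊤ : ℕ∞) (expansionTerm t Φ a ι) := by
  rw [contDiff_iff_contDiffAt]
  intro z
  by_cases hz : z ∈ tsupport a
  · exact contDiffAt_const.mul ((contDiffAt_prod fun j _ =>
      contDiffAt_taylorCoeff_top t _ (hΦ z hz)).mul (contDiffAt_taylorCoeff_top t _ ha.contDiffAt))
  · refine contDiffAt_const (c := (0 : ℝ)) |>.congr_of_eventuallyEq ?_
    filter_upwards [(isClosed_tsupport a).isOpen_compl.mem_nhds hz] with y hy
    exact image_eq_zero_of_notMem_tsupport fun h => hy (tsupport_expansionTerm_subset t Φ a ι h)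

end HormanderOp

/-! ### Separation of variables -/

namespace HormanderOp

variable {d : ℕ}

/-- There are `I ^ l` ways to choose `l` phase coefficients out of `I`. The base is a `k`-th power,
so after taking `k`-th roots each choice contributes `(2 (I + 1))^{-l}`, and the sum over `l` is
geometric. The bound is therefore independent of the order of truncation `m`. -/
theorem sum_expansionIndex_rpow_le {N m k : ℕ} (hk : k ≠ 0) {D : ℝ} (hD : 0 ≤ D) :
    ∑ ι : ExpansionIndex d N m,
      (D * ((1 / (2 * (Fintype.card (PosTaylorIndex d N) + 1 : ℝ))) ^ k) ^ (ι.1.1 : ℕ)) ^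
        (1 / (k : ℝ)) ≤ 2 * Fintype.card (TaylorIndex d N) * D ^ (1 / (k : ℝ)) := by
  set I : ℝ := (Fintype.card (PosTaylorIndex d N) : ℝ) with hI
  have hI0 : 0 ≤ I := Nat.cast_nonneg _
  set s : ℝ := 1 / (2 * (I + 1)) with hs
  have hs0 : 0 ≤ s := by positivity
  have h1 : ∀ l : ℕ, (D * (s ^ k) ^ l) ^ (1 / (k : ℝ)) = D ^ (1 / (k : ℝ)) * s ^ l := by
    intro l
    rw [Real.mul_rpow hD (by positivity), ← pow_mul, mul_comm k l, pow_mul, one_div,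
      Real.pow_rpow_inv_natCast (by positivity) hk]
  simp only [h1]
  rw [Fintype.sum_prod_type, Fintype.sum_sigma]
  have h2 : ∀ l : Fin m, ∑ _g : Fin (l : ℕ) → PosTaylorIndex d N, ∑ _β : TaylorIndex d N,
      D ^ (1 / (k : ℝ)) * s ^ (l : ℕ) ≤
        Fintype.card (TaylorIndex d N) * D ^ (1 / (k : ℝ)) * (1 / 2) ^ (l : ℕ) := by
    intro l
    rw [Finset.sum_const, Finset.sum_const, Finset.card_univ, Finset.card_univ, Fintype.card_fun,
      Fintype.card_fin, nsmul_eq_mul, nsmul_eq_mul, Nat.cast_pow, ← hI]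
    have h3 : I ^ (l : ℕ) * s ^ (l : ℕ) ≤ (1 / 2) ^ (l : ℕ) := by
      rw [← mul_pow]
      refine pow_le_pow_left₀ (by positivity) ?_ _
      rw [hs, mul_one_div, div_le_div_iff₀ (by positivity) (by norm_num)]
      linarith
    calc _ = Fintype.card (TaylorIndex d N) * D ^ (1 / (k : ℝ)) * (I ^ (l : ℕ) * s ^ (l : ℕ)) := by
          ring
      _ ≤ _ := mul_le_mul_of_nonneg_left h3 (by positivity)
  refine (Finset.sum_le_sum fun l _ => h2 l).trans ?_
  rw [← Finset.mul_sum, ← Finset.sum_range fun l => ((1 : ℝ) / 2) ^ l]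
  have h4 := sum_geometric_two_le m
  calc _ ≤ Fintype.card (TaylorIndex d N) * D ^ (1 / (k : ℝ)) * 2 :=
        mul_le_mul_of_nonneg_left h4 (by positivity)
    _ = _ := by ring

/-- Separation of variables: a translate of an oscillating amplitude is, in a small cell and up to
a negligible error, a combination of non-negative amplitudes with the same phase, whose coefficients
depend only on the translation. -/
theorem exists_separation (d k N₀ : ℕ) (hk : k ≠ 0) (B : ℝ) (hB1 : 1 ≤ B) :
    ∃ C : ℝ, 1 ≤ C ∧ ∀ (φ ψ : Space d × Freq d → ℝ),
      (∀ z ∈ unitBalls d, ContDiffAt ℝ (⊤ : ℕ∞) φ z) →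
      (∀ z ∈ unitBalls d, ψ =ᶠ[nhds z] φ) →
      ContDiff ℝ (N₀ + 1 + (d + 1) + 1 : ℕ) ψ →
      (∀ m ≤ N₀ + 1 + (d + 1) + 1, ∀ z, ‖iteratedFDeriv ℝ m ψ z‖ ≤ B) →
      ∀ (K lam ρ : ℝ), 1 ≤ K → 1 ≤ lam → 0 < ρ → ρ ≤ 1 → C * (K ^ 2 * ρ) ≤ 1 → C * K ^ 4 ≤ lam →
      ∀ (z₀ : Space d × Freq d) (a : Space d × Freq d → ℝ) (A : ℝ), ContDiff ℝ (⊤ : ℕ∞) a →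
      tsupport a ⊆ unitBalls d →
      (∀ m ≤ N₀ + 1 + (d + 1), ∀ z, ‖iteratedFDeriv ℝ m a z‖ ≤ A) →
      ∃ (ι : Type) (_ : Fintype ι) (b : ι → Space d × Freq d → ℝ) (β : ι → ℝ),
        (∀ i, ContDiff ℝ (⊤ : ℕ∞) (b i)) ∧ (∀ i z, 0 ≤ b i z) ∧
        (∀ i, tsupport (b i) ⊆ tsupport a ∩ Metric.closedBall z₀ (3 * ρ)) ∧ (∀ i, 0 ≤ β i) ∧
        (∀ i, ∀ m ≤ N₀, ∀ z, ‖iteratedFDeriv ℝ m (b i) z‖ ≤ β i) ∧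
        ∑ i, β i ^ (1 / (k : ℝ)) ≤ C * (ρ⁻¹ ^ (N₀ + 1) * A) ^ (1 / (k : ℝ)) ∧
        ∀ u : Space d, ‖u‖ ≤ 2 * K ^ 2 / lam → ∃ κ : ι → ℂ, (∀ i, ‖κ i‖ ≤ 1) ∧
          ∀ z ∈ Metric.closedBall z₀ ρ,
            ‖osc lam ψ (z + (u, 0)) * (a (z + (u, 0)) : ℂ) -
              ∑ i, κ i * (osc lam ψ z * (b i z : ℂ))‖ ≤
              C * A * (K ^ 2) ^ (d + 2) * lam⁻¹ ^ (d + 1) := by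
  obtain ⟨Cχ, hCχ0, hCχ⟩ := exists_cutoff (Space d × Freq d)
  obtain ⟨Cm, hCm0, hCm⟩ := exists_nonneg_majorant (Space d × Freq d) N₀
  set Q : ℕ := N₀ + 1 with hQ
  set N : ℕ := d + 1 with hN
  set I : ℝ := (Fintype.card (PosTaylorIndex d N) : ℝ) with hI
  have hI0 : 0 ≤ I := Nat.cast_nonneg _
  set s : ℝ := 1 / (2 * (I + 1)) with hs
  have hs0 : 0 < s := by positivity
  have hs1 : s ≤ 1 := by
    rw [hs, div_le_one (by positivity)]
    linarith
  -- The smallness required of the phase coefficients; the power `k` anticipates the `k`-th roots in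
  -- the sum of the `β i`.
  set δ : ℝ := s ^ k with hδ
  have hδ0 : 0 < δ := by positivity
  have hδs : δ ≤ s := by
    calc δ ≤ s ^ 1 := pow_le_pow_of_le_one hs0.le hs1 (Nat.one_le_iff_ne_zero.2 hk)
      _ = s := pow_one s
  have hIδ : I * δ ≤ 1 / 2 := by
    refine (mul_le_mul_of_nonneg_left hδs hI0).trans ?_
    rw [hs, mul_one_div, div_le_div_iff₀ (by positivity) (by norm_num)]
    linarith
  set S : ℝ := ∑ i ∈ Finset.range (Q + 1), Cχ i with hS
  have hS0 : 0 ≤ S := Finset.sum_nonneg fun i _ => hCχ0 i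
  have hpi := Real.pi_pos
  have hB0 : 0 ≤ B := by linarith
  set D₀ : ℝ := (1 + Cm) * (Q.factorial * ((Q + 1) * ((Q + 1) * S))) with hD₀
  have hD₀0 : 0 ≤ D₀ := by positivity
  -- With `t * lam = 2 K²` the jet bound for the phase coefficients equals `(δ / 5) (3 C₁ K² ρ + C₁
  -- K² t)`. The two hypotheses on `ρ` and `λ` bound the bracket by `3 + 2`.
  set C₁ : ℝ := 20 * Real.pi * B * (Q + 1) / δ with hC₁
  have hC₁0 : 0 ≤ C₁ := by positivity
  set C₂ : ℝ := 2 * (2 * Fintype.card (TaylorIndex d N) * D₀ ^ (1 / (k : ℝ))) with hC₂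
  have hC₂0 : 0 ≤ C₂ := by positivity
  set C₃ : ℝ := 2 * Real.pi * B * 2 ^ (N + 1) + 2 + 2 * 2 ^ N with hC₃
  have hC₃0 : 0 ≤ C₃ := by positivity
  refine ⟨2 + C₁ + C₂ + C₃, by linarith, ?_⟩
  intro φ ψ hφ hψφ hψ hψB K lam ρ hK hlam hρ hρ1 hKρ hKlam z₀ a A ha has hA
  have hA0 : 0 ≤ A := (norm_nonneg _).trans (hA 0 (by omega) 0)
  have hK0 : 0 < K := by linarith
  have hlam0 : 0 < lam := by linarith
  set t : ℝ := 2 * K ^ 2 / lam with ht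
  have ht0 : 0 < t := by positivity
  have hK24 : K ^ 2 ≤ K ^ 4 := pow_le_pow_right₀ hK (by norm_num)
  have htlam : t * lam = 2 * K ^ 2 := by
    rw [ht]
    field_simp
  have ht1 : t ≤ 1 := by
    rw [ht, div_le_one hlam0]
    have : 2 * K ^ 4 ≤ (2 + C₁ + C₂ + C₃) * K ^ 4 :=
      mul_le_mul_of_nonneg_right (by linarith) (by positivity)
    linarith
  have hjetδ : (Q + 1) * (2 * Real.pi * (t * lam) * B * (3 * ρ + t)) ≤ δ := by
    have h1 : C₁ * (K ^ 2 * ρ) ≤ 1 :=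
      (mul_le_mul_of_nonneg_right (by linarith) (by positivity)).trans hKρ
    have h2 : C₁ * K ^ 4 ≤ lam :=
      (mul_le_mul_of_nonneg_right (by linarith) (by positivity)).trans hKlam
    have h3 : C₁ * (K ^ 2 * t) ≤ 2 := by
      have : C₁ * (K ^ 2 * t) = 2 * (C₁ * K ^ 4) / lam := by
        rw [ht]
        ring
      rw [this, div_le_iff₀ hlam0]
      linarith
    have h4 : (Q + 1) * (2 * Real.pi * (t * lam) * B * (3 * ρ + t)) =
        δ / 5 * (3 * (C₁ * (K ^ 2 * ρ)) + C₁ * (K ^ 2 * t)) := by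
      rw [htlam, hC₁]
      field_simp
      ring
    rw [h4]
    nlinarith
  set Φ := centredPhase lam ψ z₀ with hΦ
  have hΦs : ContDiff ℝ (Q + N + 1 : ℕ) Φ := contDiff_centredPhase lam hψ z₀
  have hΦs' : ContDiff ℝ (Q + N : ℕ) Φ := hΦs.of_le (by norm_cast; omega)
  have hΦtop : ∀ z ∈ tsupport a, ContDiffAt ℝ (⊤ : ℕ∞) Φ z := by
    intro z hz
    have h1 : ContDiffAt ℝ (⊤ : ℕ∞) ψ z :=
      (hφ z (has hz)).congr_of_eventuallyEq (hψφ z (has hz))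
    exact (h1.sub (fderiv ℝ ψ z₀).contDiff.contDiffAt).const_smul _
  have haQ : ContDiff ℝ (Q + N : ℕ) a := ha.of_le (WithTop.coe_le_coe.2 le_top)
  -- The exponential series is truncated where its tail drops below `λ^{-N}`. Thus the number of
  -- terms depends on `λ`, but the sum of the `β i ^ (1 / k)` does not.
  obtain ⟨m, hm⟩ := exists_pow_lt_of_lt_one (show 0 < lam⁻¹ ^ N by positivity)
    (show (1 / 2 : ℝ) < 1 by norm_num)
  obtain ⟨χ, hχs, -, hχ1, hχsupp, hχd⟩ := hCχ (Metric.closedBall z₀ ρ) ρ hρ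
  have hχt : tsupport χ ⊆ Metric.closedBall z₀ (3 * ρ) := by
    refine closure_minimal (fun z hz => ?_) Metric.isClosed_closedBall
    obtain ⟨y, hy, hzy⟩ := Metric.mem_thickening_iff.1 (hχsupp hz)
    rw [Metric.mem_closedBall] at hy ⊢
    linarith [dist_triangle z y z₀]
  have hjχ : ∀ z, jet Q ρ χ z ≤ (Q + 1) * S := by
    intro z
    refine jet_le hρ.le fun i hi => ?_
    calc ρ ^ i * ‖iteratedFDeriv ℝ i χ z‖ ≤ ρ ^ i * (Cχ i * ρ⁻¹ ^ i) :=
          mul_le_mul_of_nonneg_left (hχd i z) (by positivity)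
      _ = Cχ i := by
          rw [inv_pow]
          field_simp
      _ ≤ S := Finset.single_le_sum (f := Cχ) (fun i _ => hCχ0 i) (Finset.mem_range_succ_iff.2 hi)
  have hjΦ : ∀ z ∈ Metric.closedBall z₀ (3 * ρ), ∀ γ : PosTaylorIndex d N,
      jet Q ρ (taylorCoeff t Φ γ.2) z ≤ δ := fun z hz γ =>
    (jet_taylorCoeff_centredPhase_le hlam0.le ht0 ht1 hρ hρ1 hB0 hψ hψB z₀
      (by rwa [← dist_eq_norm]) γ).trans hjetδ
  -- The cutoff to the cell is needed because the phase coefficients are small only near `z₀`; it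
  -- equals `1` on the ball where the expansion is used.
  set g : ExpansionIndex d N m → Space d × Freq d → ℝ :=
    fun ι z => expansionTerm t Φ a ι z * χ z with hg
  have hgs : ∀ ι, ContDiff ℝ (⊤ : ℕ∞) (g ι) := fun ι =>
    (contDiff_top_expansionTerm t ha hΦtop ι).mul hχs
  have hgt : ∀ ι, tsupport (g ι) ⊆ tsupport a ∩ Metric.closedBall z₀ (3 * ρ) := fun ι =>
    subset_inter ((tsupport_mul_subset_left).trans (tsupport_expansionTerm_subset t Φ a ι))
      ((tsupport_mul_subset_right).trans hχt)
  set η : ExpansionIndex d N m → ℝ := fun ι =>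
    Q.factorial * ρ⁻¹ ^ Q * (δ ^ (ι.1.1 : ℕ) * ((Q + 1) * A) * ((Q + 1) * S)) with hη
  have hη0 : ∀ ι, 0 ≤ η ι := fun ι => by positivity
  have hgη : ∀ ι, ∀ j ≤ Q, ∀ z, ‖iteratedFDeriv ℝ j (g ι) z‖ ≤ η ι := by
    intro ι j hj z
    by_cases hz : z ∈ Metric.closedBall z₀ (3 * ρ)
    · refine (norm_iteratedFDeriv_le_jet hρ hρ1 hj (g ι) z).trans
        (mul_le_mul_of_nonneg_left ?_ (by positivity))
      refine (jet_mul_le hρ.le (contDiff_expansionTerm t hΦs' haQ ι)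
        (hχs.of_le (WithTop.coe_le_coe.2 le_top)) z).trans ?_
      exact mul_le_mul (jet_expansionTerm_le ht0.le ht1 hρ.le hρ1 hΦs' haQ hA (hjΦ z hz) hδ0.le ι)
        (hjχ z) (jet_nonneg hρ.le _ _) (by positivity)
    · have h1 : iteratedFDeriv ℝ j (g ι) z = 0 := image_eq_zero_of_notMem_tsupport fun h =>
        hz ((hgt ι) (tsupport_iteratedFDeriv_subset j h)).2
      rw [h1, norm_zero]
      exact hη0 ι
  choose h hhs hgh hht hhd using fun ι => hCm (g ι) (η ι) (hgs ι)
    (((hgt ι).trans inter_subset_left).trans (by rwa [← unitBalls_eq_closedBall])) (hgη ι)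
  -- Each signed amplitude is written as `g = (g + h) - h` with both parts non-negative. The Boolean
  -- tells the two parts apart, and the sign goes into the coefficient `κ`.
  refine ⟨ExpansionIndex d N m × Bool, inferInstance,
    fun i => if i.2 then (fun z => g i.1 z + h i.1 z) else h i.1, fun i => (1 + Cm) * η i.1,
    ?_, ?_, ?_, ?_, ?_, ?_, ?_⟩
  · rintro ⟨ι, b⟩
    cases b
    · simpa using hhs ι
    · simpa using (hgs ι).add (hhs ι)
  · rintro ⟨ι, b⟩ z
    have h1 := abs_le.1 (hgh ι z)
    have h2 := (abs_nonneg _).trans (hgh ι z)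
    cases b
    · simpa using h2
    · simp only [if_true]
      linarith
  · rintro ⟨ι, b⟩
    cases b
    · simpa using (hht ι).trans (hgt ι)
    · simp only [if_true]
      refine (tsupport_add (g ι) (h ι)).trans (union_subset (hgt ι) ?_)
      exact (hht ι).trans (hgt ι)
  · exact fun i => mul_nonneg (by linarith) (hη0 _)
  · rintro ⟨ι, b⟩ j hj z
    have h1 := hhd ι j hj z
    have h2 := hgη ι j (by omega) z
    cases b
    · simp only [Bool.false_eq_true, if_false]
      linarith [hη0 ι]
    · simp only [if_true]
      have h3 : (fun z => g ι z + h ι z) = g ι + h ι := rfl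
      rw [h3, iteratedFDeriv_add_apply ((hgs ι).of_le (WithTop.coe_le_coe.2 le_top)).contDiffAt
        ((hhs ι).of_le (WithTop.coe_le_coe.2 le_top)).contDiffAt]
      refine (norm_add_le _ _).trans ?_
      linarith
  · rw [Fintype.sum_prod_type]
    have h1 : ∀ ι : ExpansionIndex d N m, (1 + Cm) * η ι =
        (D₀ * (ρ⁻¹ ^ Q * A)) * δ ^ (ι.1.1 : ℕ) := fun ι => by
      rw [hη, hD₀]
      ring
    simp only [h1, Finset.sum_const, Finset.card_univ, Fintype.card_bool, nsmul_eq_mul]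
    rw [← Finset.mul_sum]
    have hD : 0 ≤ D₀ * (ρ⁻¹ ^ Q * A) := by positivity
    have h2 := sum_expansionIndex_rpow_le (d := d) (N := N) (m := m) hk hD
    have h3 : 0 ≤ (ρ⁻¹ ^ Q * A) ^ (1 / (k : ℝ)) := by positivity
    calc _ ≤ 2 * (2 * Fintype.card (TaylorIndex d N) *
          (D₀ * (ρ⁻¹ ^ Q * A)) ^ (1 / (k : ℝ))) := by
          push_cast
          exact mul_le_mul_of_nonneg_left h2 (by norm_num)
      _ = C₂ * (ρ⁻¹ ^ Q * A) ^ (1 / (k : ℝ)) := by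
          rw [Real.mul_rpow hD₀0 (by positivity), hC₂]
          ring
      _ ≤ _ := mul_le_mul_of_nonneg_right (by linarith) h3
  · intro u hu
    set w : ℂ := osc lam (fderiv ℝ ψ z₀) (u, 0) with hw
    refine ⟨fun i => (if i.2 then 1 else -1) * (expansionCoeff t u i.1 * w), ?_, ?_⟩
    · rintro ⟨ι, b⟩
      have h1 : ‖expansionCoeff t u ι * w‖ ≤ 1 := by
        rw [norm_mul, hw, norm_osc, mul_one]
        exact norm_expansionCoeff_le ht0 hu ι
      cases b <;> simpa using h1
    intro z hz
    have hz3 : z ∈ Metric.closedBall z₀ (3 * ρ) :=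
      Metric.closedBall_subset_closedBall (by linarith) hz
    have hsum : ∑ i : ExpansionIndex d N m × Bool,
        (if i.2 then 1 else -1) * (expansionCoeff t u i.1 * w) * (osc lam ψ z *
          (((if i.2 then (fun z => g i.1 z + h i.1 z) else h i.1) z : ℝ) : ℂ)) =
        osc lam ψ z * w * ∑ ι : ExpansionIndex d N m,
          expansionCoeff t u ι * (expansionTerm t Φ a ι z : ℂ) := by
      rw [Fintype.sum_prod_type, Finset.mul_sum]
      refine Finset.sum_congr rfl fun ι _ => ?_
      rw [Fintype.sum_bool]
      simp only [if_true, Bool.false_eq_true, if_false, hg, hχ1 z hz, mul_one]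
      push_cast
      ring
    rw [hsum, osc_add lam ψ z₀, ← hw, mul_assoc, ← mul_sub, norm_mul, norm_mul, norm_osc, hw,
      norm_osc, one_mul, one_mul]
    have hδz : ∀ γ : PosTaylorIndex d N, |taylorCoeff t Φ γ.2 z| ≤ δ := fun γ =>
      (abs_le_jet hρ.le _ _).trans (hjΦ z hz3 γ)
    have h1 := norm_sub_expansion_le (N := N) (m := m) (Φ := Φ) (a := a) (A := A)
      (B := 2 * Real.pi * lam * B) (hΦs.of_le (by norm_cast; omega))
      (haQ.of_le (by norm_cast; omega))
      (fun z => norm_iteratedFDeriv_centredPhase_le (j := d) hlam0.le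
        (hψ.of_le (by norm_cast; omega)) z₀ z (hψB _ (by omega) z))
      (hA N (by omega)) (fun z => by simpa using hA 0 (by omega) z) ht0 hu hδz hIδ
    refine h1.trans ?_
    have hKp : (1 : ℝ) ≤ K ^ 2 := one_le_pow₀ hK
    -- The phase carries a factor `λ`. Its Taylor polynomial runs one order further than that of the
    -- amplitude in order to leave the same power `λ^{-N}`.
    have h2 : 2 * Real.pi * lam * B * t ^ (N + 1) =
        2 * Real.pi * B * 2 ^ (N + 1) * ((K ^ 2) ^ (N + 1) * lam⁻¹ ^ N) := by
      rw [ht, div_pow, mul_pow, inv_pow, pow_succ lam]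
      field_simp
    have h3 : t ^ N ≤ 2 ^ N * ((K ^ 2) ^ (N + 1) * lam⁻¹ ^ N) := by
      have : t ^ N = 2 ^ N * ((K ^ 2) ^ N * lam⁻¹ ^ N) := by
        rw [ht, div_pow, mul_pow, inv_pow]
        field_simp
      rw [this]
      refine mul_le_mul_of_nonneg_left (mul_le_mul_of_nonneg_right ?_ (by positivity))
        (by positivity)
      exact pow_le_pow_right₀ hKp (by omega)
    have h4 : (1 / 2 : ℝ) ^ m ≤ (K ^ 2) ^ (N + 1) * lam⁻¹ ^ N :=
      hm.le.trans (le_mul_of_one_le_left (by positivity) (one_le_pow₀ hKp))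
    have h5 : 0 ≤ (K ^ 2) ^ (N + 1) * lam⁻¹ ^ N := by positivity
    calc A * (2 * Real.pi * lam * B * t ^ (N + 1) + 2 * (1 / 2) ^ m + 2 * t ^ N)
        ≤ A * (C₃ * ((K ^ 2) ^ (N + 1) * lam⁻¹ ^ N)) := by
          refine mul_le_mul_of_nonneg_left ?_ hA0
          rw [h2, hC₃]
          linarith
      _ ≤ A * ((2 + C₁ + C₂ + C₃) * ((K ^ 2) ^ (N + 1) * lam⁻¹ ^ N)) :=
          mul_le_mul_of_nonneg_left (mul_le_mul_of_nonneg_right (by linarith) h5) hA0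
      _ = _ := by ring

end HormanderOp

/-! ### Oscillatory integral operators, rounding and bounded overlap -/

namespace HormanderOp

variable {d : ℕ}

/-- The oscillatory integral operator with phase `φ` and amplitude `b`. -/
def oscOp (φ : Space d × Freq d → ℝ) (lam : ℝ) (b : Space d × Freq d → ℝ) (f : Freq d → ℂ)
    (x : Space d) : ℂ :=
  ∫ ω in Metric.closedBall (0 : Freq d) 1,
    osc lam φ (lam⁻¹ • x, ω) * (b (lam⁻¹ • x, ω) : ℂ) * f ω

theorem op_eq_oscOp (T : HormanderOperator d) (f : Freq d → ℂ) :
    T.op f = oscOp T.phase T.scale T.amp f := rfl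

/-- The norm of `L¹(Bⁿ⁻¹)`. -/
def l1Norm (f : Freq d → ℂ) : ℝ := ∫ ω in Metric.closedBall (0 : Freq d) 1, ‖f ω‖

theorem l1Norm_nonneg (f : Freq d → ℂ) : 0 ≤ l1Norm f := integral_nonneg fun _ => norm_nonneg _

theorem l1Norm_mono {f g : Freq d → ℂ}
    (hg : IntegrableOn g (Metric.closedBall (0 : Freq d) 1))
    (h : ∀ ω ∈ Metric.closedBall (0 : Freq d) 1, ‖f ω‖ ≤ ‖g ω‖) : l1Norm f ≤ l1Norm g :=
  integral_mono_of_nonneg (.of_forall fun _ => norm_nonneg _) hg.norm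
    (ae_restrict_of_forall_mem Metric.isClosed_closedBall.measurableSet h)

theorem integrableOn_of_memLp {f : Freq d → ℂ}
    (hf : MemLp f 2 (volume.restrict (Metric.closedBall 0 1))) :
    IntegrableOn f (Metric.closedBall (0 : Freq d) 1) := by
  have : IsFiniteMeasure (volume.restrict (Metric.closedBall (0 : Freq d) 1)) :=
    ⟨by rw [Measure.restrict_apply_univ]; exact measure_closedBall_lt_top⟩
  exact hf.integrable one_le_two

theorem exists_l1Norm_le (d : ℕ) : ∃ C : ℝ, 0 ≤ C ∧ ∀ f : Freq d → ℂ,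
    MemLp f 2 (volume.restrict (Metric.closedBall 0 1)) →
      ENNReal.ofReal (l1Norm f) ≤ ENNReal.ofReal C * HormanderOperator.l2Norm f := by
  set V : ℝ≥0∞ := volume.restrict (Metric.closedBall (0 : Freq d) 1) univ with hV
  have hVt : V ≠ ∞ := by
    rw [hV, Measure.restrict_apply_univ]
    exact measure_closedBall_lt_top.ne
  refine ⟨(V ^ (1 / 2 : ℝ)).toReal, ENNReal.toReal_nonneg, fun f hf => ?_⟩
  have h1 : ENNReal.ofReal (l1Norm f) =
      eLpNorm f 1 (volume.restrict (Metric.closedBall (0 : Freq d) 1)) := by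
    rw [l1Norm, ofReal_integral_norm_eq_lintegral_enorm (integrableOn_of_memLp hf),
      eLpNorm_one_eq_lintegral_enorm]
  have h2 := eLpNorm_le_eLpNorm_mul_rpow_measure_univ (p := 1) (q := 2)
    (by norm_num) hf.aestronglyMeasurable
  rw [h1, ENNReal.ofReal_toReal (ENNReal.rpow_ne_top_of_nonneg (by norm_num) hVt), mul_comm]
  refine h2.trans (le_of_eq ?_)
  rw [HormanderOperator.l2Norm, ← hV]
  norm_num

variable {φ b : Space d × Freq d → ℝ} {lam : ℝ}

theorem continuous_osc_mul (lam : ℝ) (hφ : ∀ z ∈ unitBalls d, ContDiffAt ℝ (⊤ : ℕ∞) φ z)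
    (hb : Continuous b) (hs : tsupport b ⊆ unitBalls d) :
    Continuous fun z => osc lam φ z * (b z : ℂ) := by
  rw [continuous_iff_continuousAt]
  intro z
  by_cases hz : z ∈ tsupport b
  · have h1 : ContinuousAt φ z := (hφ z (hs hz)).continuousAt
    have h2 : ContinuousAt (osc lam φ) z := by
      have h3 : osc lam φ =
          fun z => Complex.exp (2 * Real.pi * Complex.I * ((lam * φ z : ℝ) : ℂ)) := rfl
      rw [h3]
      fun_prop
    exact h2.mul (Complex.continuous_ofReal.comp hb).continuousAt
  · refine (continuousAt_const (y := (0 : ℂ))).congr ?_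
    filter_upwards [(isClosed_tsupport b).isOpen_compl.mem_nhds hz] with y hy
    rw [image_eq_zero_of_notMem_tsupport hy]
    simp

theorem norm_osc_mul (lam : ℝ) (φ b : Space d × Freq d → ℝ) (z : Space d × Freq d) :
    ‖osc lam φ z * (b z : ℂ)‖ = |b z| := by
  rw [norm_mul, norm_osc, one_mul, Complex.norm_real, Real.norm_eq_abs]

theorem integrableOn_osc_mul (hφ : ∀ z ∈ unitBalls d, ContDiffAt ℝ (⊤ : ℕ∞) φ z)
    (hb : Continuous b) (hs : tsupport b ⊆ unitBalls d) {A : ℝ} (hA : ∀ z, |b z| ≤ A)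
    {f : Freq d → ℂ} (hf : IntegrableOn f (Metric.closedBall (0 : Freq d) 1)) (y : Space d) :
    IntegrableOn (fun ω => osc lam φ (y, ω) * (b (y, ω) : ℂ) * f ω)
      (Metric.closedBall (0 : Freq d) 1) := by
  refine Integrable.bdd_mul (c := A) hf ?_ (.of_forall fun ω => ?_)
  · exact ((continuous_osc_mul lam hφ hb hs).comp
      (Continuous.prodMk_right y)).aestronglyMeasurable
  · rw [norm_osc_mul]
    exact hA _

theorem continuous_oscOp (hφ : ∀ z ∈ unitBalls d, ContDiffAt ℝ (⊤ : ℕ∞) φ z)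
    (hb : Continuous b) (hs : tsupport b ⊆ unitBalls d) {A : ℝ} (hA : ∀ z, |b z| ≤ A)
    {f : Freq d → ℂ} (hf : IntegrableOn f (Metric.closedBall (0 : Freq d) 1)) :
    Continuous (oscOp φ lam b f) := by
  refine continuous_of_dominated (bound := fun ω => A * ‖f ω‖) (fun x => ?_) (fun x => ?_)
    (hf.norm.const_mul A) (.of_forall fun ω => ?_)
  · exact (integrableOn_osc_mul hφ hb hs hA hf _).aestronglyMeasurable
  · refine .of_forall fun ω => ?_
    rw [norm_mul, norm_osc_mul]
    exact mul_le_mul_of_nonneg_right (hA _) (norm_nonneg _)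
  · have h1 := continuous_osc_mul lam hφ hb hs
    have h2 : Continuous fun x : Space d => ((lam⁻¹ • x, ω) : Space d × Freq d) := by fun_prop
    exact (h1.comp h2).mul continuous_const

theorem norm_oscOp_le_of_forall {x : Space d} {E : ℝ} {f : Freq d → ℂ}
    (hf : IntegrableOn f (Metric.closedBall (0 : Freq d) 1))
    (hE : ∀ ω, f ω ≠ 0 → |b (lam⁻¹ • x, ω)| ≤ E) :
    ‖oscOp φ lam b f x‖ ≤ E * l1Norm f := by
  rw [l1Norm, ← integral_const_mul]
  refine norm_integral_le_of_norm_le (hf.norm.const_mul E) (.of_forall fun ω => ?_)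
  rw [norm_mul, norm_osc_mul]
  by_cases h : f ω = 0
  · simp [h]
  · exact mul_le_mul_of_nonneg_right (hE ω h) (norm_nonneg _)

theorem norm_oscOp_le {A : ℝ} (hA : ∀ z, |b z| ≤ A) {f : Freq d → ℂ}
    (hf : IntegrableOn f (Metric.closedBall (0 : Freq d) 1)) (x : Space d) :
    ‖oscOp φ lam b f x‖ ≤ A * l1Norm f :=
  norm_oscOp_le_of_forall hf fun _ _ => hA _

theorem oscOp_eq_zero (hs : tsupport b ⊆ unitBalls d) (hlam : 0 < lam) (f : Freq d → ℂ)
    {x : Space d} (hx : lam < ‖x‖) : oscOp φ lam b f x = 0 := by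
  refine integral_eq_zero_of_ae (.of_forall fun ω => ?_)
  have h1 : b (lam⁻¹ • x, ω) = 0 := by
    refine image_eq_zero_of_notMem_tsupport fun h => ?_
    have h2 := (hs h).1
    rw [mem_closedBall_zero_iff, norm_smul, norm_inv, Real.norm_of_nonneg hlam.le,
      inv_mul_le_iff₀ hlam, mul_one] at h2
    exact absurd h2 (not_le.2 hx)
  simp [h1]

theorem oscOp_sum (hφ : ∀ z ∈ unitBalls d, ContDiffAt ℝ (⊤ : ℕ∞) φ z)
    (hb : Continuous b) (hs : tsupport b ⊆ unitBalls d) {A : ℝ} (hA : ∀ z, |b z| ≤ A)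
    {ι : Type*} (s : Finset ι) {f : Freq d → ℂ} {g : ι → Freq d → ℂ}
    (hg : ∀ i ∈ s, IntegrableOn (g i) (Metric.closedBall (0 : Freq d) 1))
    (hfg : ∀ ω ∈ Metric.closedBall (0 : Freq d) 1, f ω = ∑ i ∈ s, g i ω) (x : Space d) :
    oscOp φ lam b f x = ∑ i ∈ s, oscOp φ lam b (g i) x := by
  simp only [oscOp]
  rw [← integral_finsetSum s fun i hi => integrableOn_osc_mul hφ hb hs hA (hg i hi) _]
  refine setIntegral_congr_fun Metric.isClosed_closedBall.measurableSet fun ω hω => ?_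
  rw [hfg ω hω, Finset.mul_sum]

/-- The operator form of the separation of variables. -/
theorem norm_oscOp_add_le {ψ a : Space d × Freq d → ℝ}
    (hφ : ∀ z ∈ unitBalls d, ContDiffAt ℝ (⊤ : ℕ∞) φ z)
    (hψφ : ∀ z ∈ unitBalls d, ψ z = φ z) (ha : Continuous a) (has : tsupport a ⊆ unitBalls d)
    {A : ℝ} (hA : ∀ z, |a z| ≤ A) {ι : Type*} [Fintype ι] {b : ι → Space d × Freq d → ℝ}
    (hb : ∀ i, Continuous (b i)) (hbs : ∀ i, tsupport (b i) ⊆ unitBalls d) {β : ι → ℝ}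
    (hβ : ∀ i z, |b i z| ≤ β i) {κ : ι → ℂ} (hκ : ∀ i, ‖κ i‖ ≤ 1) {x v y : Space d} {ω₀ : Freq d}
    {ρ E : ℝ} (hx : lam⁻¹ • x ∈ Metric.closedBall y ρ)
    (hE : ∀ z ∈ Metric.closedBall (y, ω₀) ρ,
      ‖osc lam ψ (z + (lam⁻¹ • v, 0)) * (a (z + (lam⁻¹ • v, 0)) : ℂ) -
        ∑ i, κ i * (osc lam ψ z * (b i z : ℂ))‖ ≤ E) {f : Freq d → ℂ}
    (hf : IntegrableOn f (Metric.closedBall (0 : Freq d) 1))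
    (hfs : ∀ ω, f ω ≠ 0 → ω ∈ Metric.closedBall ω₀ ρ) :
    ‖oscOp φ lam a f (x + v)‖ ≤ ∑ i, ‖oscOp φ lam (b i) f x‖ + E * l1Norm f := by
  -- The extension `ψ` agrees with `φ` on the unit balls, and multiplication by an amplitude removes
  -- everything else.
  have hcongr : ∀ c : Space d × Freq d → ℝ, tsupport c ⊆ unitBalls d → ∀ z,
      osc lam ψ z * (c z : ℂ) = osc lam φ z * (c z : ℂ) := by
    intro c hc z
    by_cases hz : z ∈ tsupport c
    · rw [osc, osc, hψφ z (hc hz)]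
    · simp [image_eq_zero_of_notMem_tsupport hz]
  have h1 : oscOp φ lam a f (x + v) - ∑ i, κ i * oscOp φ lam (b i) f x =
      ∫ ω in Metric.closedBall (0 : Freq d) 1,
        (osc lam φ (lam⁻¹ • (x + v), ω) * (a (lam⁻¹ • (x + v), ω) : ℂ) -
          ∑ i, κ i * (osc lam φ (lam⁻¹ • x, ω) * (b i (lam⁻¹ • x, ω) : ℂ))) * f ω := by
    have h2 : ∀ i, Integrable (fun ω => κ i *
        (osc lam φ (lam⁻¹ • x, ω) * (b i (lam⁻¹ • x, ω) : ℂ) * f ω))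
          (volume.restrict (Metric.closedBall (0 : Freq d) 1)) := fun i =>
      (integrableOn_osc_mul hφ (hb i) (hbs i) (hβ i) hf _).const_mul _
    simp only [oscOp, ← integral_const_mul]
    rw [← integral_finsetSum _ fun i _ => h2 i,
      ← integral_sub (integrableOn_osc_mul hφ ha has hA hf _)
        (integrable_finsetSum _ fun i _ => h2 i)]
    congr 1
    funext ω
    rw [sub_mul, Finset.sum_mul]
    congr 1
    exact Finset.sum_congr rfl fun i _ => by ring
  have h2 : ‖oscOp φ lam a f (x + v) - ∑ i, κ i * oscOp φ lam (b i) f x‖ ≤ E * l1Norm f := by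
    rw [h1, l1Norm, ← integral_const_mul]
    refine norm_integral_le_of_norm_le (hf.norm.const_mul E) (.of_forall fun ω => ?_)
    rw [norm_mul]
    by_cases h : f ω = 0
    · simp [h]
    refine mul_le_mul_of_nonneg_right ?_ (norm_nonneg _)
    have h3 : ((lam⁻¹ • x, ω) : Space d × Freq d) ∈ Metric.closedBall (y, ω₀) ρ := by
      rw [← closedBall_prod_same]
      exact ⟨hx, hfs ω h⟩
    have h4 := hE _ h3
    have h5 : ((lam⁻¹ • x, ω) : Space d × Freq d) + (lam⁻¹ • v, 0) = (lam⁻¹ • (x + v), ω) := by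
      rw [Prod.mk_add_mk, smul_add, add_zero]
    rw [h5, hcongr a has] at h4
    simp only [hcongr (b _) (hbs _)] at h4
    exact h4
  have h3 : ‖∑ i, κ i * oscOp φ lam (b i) f x‖ ≤ ∑ i, ‖oscOp φ lam (b i) f x‖ := by
    refine (norm_sum_le _ _).trans (Finset.sum_le_sum fun i _ => ?_)
    rw [norm_mul]
    exact mul_le_of_le_one_left (norm_nonneg _) (hκ i)
  calc ‖oscOp φ lam a f (x + v)‖
      = ‖∑ i, κ i * oscOp φ lam (b i) f x +
          (oscOp φ lam a f (x + v) - ∑ i, κ i * oscOp φ lam (b i) f x)‖ := by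
        rw [add_sub_cancel]
    _ ≤ _ := (norm_add_le _ _).trans (add_le_add h3 h2)

/-- Rounding to a lattice of mesh comparable to `ρ`. -/
theorem exists_rounding (n : ℕ) {ρ : ℝ} (hρ : 0 < ρ) (hρ1 : ρ ≤ 1) :
    ∃ (cell : EuclideanSpace ℝ (Fin n) → EuclideanSpace ℝ (Fin n))
      (S : Finset (EuclideanSpace ℝ (Fin n))),
      (∀ s, MeasurableSet {x | cell x = s}) ∧ (∀ x, dist x (cell x) ≤ ρ) ∧
      (∀ x ∈ Metric.closedBall 0 1, cell x ∈ S) ∧ (S.card : ℝ) ≤ (5 * (n + 1) / ρ) ^ n := by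
  classical
  -- The rounding error is bounded by the sum of the `n` coordinate errors; the denominator `n + 1`
  -- also covers dimension `0`.
  set h : ℝ := ρ / (n + 1) with hh
  have hn : (0 : ℝ) < n + 1 := by positivity
  have hh0 : 0 < h := by positivity
  have hh1 : h ≤ 1 := by
    rw [hh, div_le_one hn]
    have : (0 : ℝ) ≤ n := Nat.cast_nonneg n
    linarith
  set pt : (Fin n → ℤ) → EuclideanSpace ℝ (Fin n) := fun m => WithLp.toLp 2 fun i => h * m i
    with hpt
  set idx : EuclideanSpace ℝ (Fin n) → Fin n → ℤ := fun x i => ⌊x i / h⌋ with hidx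
  set m : ℕ := ⌈1 / h⌉₊ with hm
  refine ⟨fun x => pt (idx x), (Fintype.piFinset fun _ : Fin n =>
    Finset.Icc (-(m : ℤ)) m).image pt, fun s => ?_, fun x => ?_, fun x hx => ?_, ?_⟩
  · have h1 : Measurable fun x => pt (idx x) := by
      refine (PiLp.continuous_toLp 2 _).measurable.comp (measurable_pi_lambda _ fun i => ?_)
      have h2 : Measurable fun x : EuclideanSpace ℝ (Fin n) => x i :=
        (EuclideanSpace.proj i : EuclideanSpace ℝ (Fin n) →L[ℝ] ℝ).continuous.measurable
      have h3 : Measurable fun x : EuclideanSpace ℝ (Fin n) => ⌊x i / h⌋ :=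
        Int.measurable_floor.comp (h2.div_const h)
      exact (measurable_from_top.comp h3).const_mul h
    exact h1 (measurableSet_singleton s)
  · have h1 : ∀ i, ‖(x - pt (idx x)) i‖ ≤ h := by
      intro i
      have h2 : (x - pt (idx x)) i = h * Int.fract (x i / h) := by
        have h3 : (pt (idx x)) i = h * (⌊x i / h⌋ : ℝ) := rfl
        rw [PiLp.sub_apply, h3, Int.fract]
        field_simp
      rw [h2, norm_mul, Real.norm_of_nonneg hh0.le, Real.norm_of_nonneg (Int.fract_nonneg _)]
      exact mul_le_of_le_one_right hh0.le (Int.fract_lt_one _).le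
    have h4 : x - pt (idx x) = ∑ i, (x - pt (idx x)) i • EuclideanSpace.single i (1 : ℝ) := by
      have := (EuclideanSpace.basisFun (Fin n) ℝ).sum_repr (x - pt (idx x))
      simpa using this.symm
    rw [dist_eq_norm, h4]
    refine (norm_sum_le _ _).trans ?_
    calc _ ≤ ∑ _i : Fin n, h := Finset.sum_le_sum fun i _ => by
          rw [norm_smul, PiLp.norm_single, norm_one, mul_one]
          exact h1 i
      _ = n * h := by simp
      _ ≤ (n + 1) * h := by nlinarith
      _ = ρ := by rw [hh]; field_simp
  · refine Finset.mem_image_of_mem _ (Fintype.mem_piFinset.2 fun i => ?_)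
    have h1 : |x i| ≤ 1 := (PiLp.norm_apply_le x i).trans (by simpa using hx)
    have h2 : |x i / h| ≤ m := by
      rw [abs_div, abs_of_pos hh0]
      exact (div_le_div_of_nonneg_right h1 hh0.le).trans (Nat.le_ceil _)
    rw [Finset.mem_Icc]
    constructor
    · rw [hidx, Int.le_floor]
      push_cast
      exact (abs_le.1 h2).1
    · have h3 : ((idx x i : ℤ) : ℝ) ≤ (m : ℝ) := (Int.floor_le _).trans (abs_le.1 h2).2
      exact_mod_cast h3
  · have h1 : ((Fintype.piFinset fun _ : Fin n => Finset.Icc (-(m : ℤ)) m).image pt).card ≤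
        (2 * m + 1) ^ n := by
      refine Finset.card_image_le.trans (le_of_eq ?_)
      rw [Fintype.card_piFinset, Finset.prod_const, Finset.card_univ, Fintype.card_fin,
        Int.card_Icc]
      congr 1
      omega
    have h2 : (m : ℝ) ≤ 1 / h + 1 := (Nat.ceil_lt_add_one (by positivity)).le
    have h3 : 1 ≤ 1 / h := by
      rw [le_div_iff₀ hh0]
      linarith
    have h4 : 5 * (n + 1) / ρ = 5 * (1 / h) := by
      rw [hh]
      field_simp
    calc ((((Fintype.piFinset fun _ : Fin n => Finset.Icc (-(m : ℤ)) m).image pt).card : ℕ) : ℝ)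
        ≤ (((2 * m + 1) ^ n : ℕ) : ℝ) := by exact_mod_cast h1
      _ = (2 * (m : ℝ) + 1) ^ n := by push_cast; ring
      _ ≤ _ := by
        rw [h4]
        exact pow_le_pow_left₀ (by positivity) (by linarith) n

/-- Balls with bounded overlap: the sum of the integrals over the balls. -/
theorem sum_lintegral_closedBall_le {n : ℕ} (Z : Finset (EuclideanSpace ℝ (Fin n))) {r : ℝ} {M : ℕ}
    (hM : ∀ x, {c | c ∈ Z ∧ x ∈ Metric.closedBall c r}.ncard ≤ M)
    {W : Set (EuclideanSpace ℝ (Fin n))} (hW : MeasurableSet W)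
    (hZW : ∀ c ∈ Z, Metric.closedBall c r ⊆ W) {g : EuclideanSpace ℝ (Fin n) → ℝ≥0∞}
    (hg : Measurable g) :
    ∑ c ∈ Z, ∫⁻ x in Metric.closedBall c r, g x ≤ M * ∫⁻ x in W, g x := by
  classical
  have h1 : ∀ c, ∫⁻ x in Metric.closedBall c r, g x =
      ∫⁻ x, (Metric.closedBall c r).indicator g x := fun c =>
    (lintegral_indicator Metric.isClosed_closedBall.measurableSet g).symm
  simp only [h1]
  rw [← lintegral_finsetSum _ fun c _ => hg.indicator Metric.isClosed_closedBall.measurableSet,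
    ← lintegral_indicator hW, ← lintegral_const_mul _ (hg.indicator hW)]
  refine lintegral_mono fun x => ?_
  by_cases hx : ∃ c ∈ Z, x ∈ Metric.closedBall c r
  · obtain ⟨c₀, hc₀, hxc₀⟩ := hx
    rw [indicator_of_mem (hZW c₀ hc₀ hxc₀)]
    have h2 : ∑ c ∈ Z, (Metric.closedBall c r).indicator g x =
        (Z.filter fun c => x ∈ Metric.closedBall c r).card * g x := by
      rw [← nsmul_eq_mul, ← Finset.sum_const, Finset.sum_filter]
      rfl
    have h3 : {c | c ∈ Z ∧ x ∈ Metric.closedBall c r} =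
        ((Z.filter fun c => x ∈ Metric.closedBall c r : Finset _) : Set _) := by
      ext c
      simp
    have h4 := hM x
    rw [h3, ncard_coe_finset] at h4
    rw [h2]
    exact mul_le_mul' (Nat.cast_le.2 h4) le_rfl
  · push Not at hx
    rw [Finset.sum_eq_zero fun c hc => indicator_of_notMem (hx c hc) g]
    exact zero_le

/-- A comparison of volumes: the balls meet the unit ball and have radius at most `1`, so they lie
in the ball of radius `3`, which they cover at most `M` times. This makes the number of relevant
caps polynomial in `K`. -/
theorem card_le_of_overlap {n : ℕ} (Z : Finset (EuclideanSpace ℝ (Fin n))) {r : ℝ} (hr : 0 < r)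
    (hr1 : r ≤ 1) {M : ℕ} (hM : ∀ x, {c | c ∈ Z ∧ x ∈ Metric.closedBall c r}.ncard ≤ M)
    (hZ : ∀ c ∈ Z, (Metric.closedBall c r ∩ Metric.closedBall 0 1).Nonempty) :
    (Z.card : ℝ) ≤ M * (3 / r) ^ n := by
  have hZW : ∀ c ∈ Z, Metric.closedBall c r ⊆ Metric.closedBall 0 3 := by
    intro c hc x hx
    obtain ⟨y, hy, hy'⟩ := hZ c hc
    rw [Metric.mem_closedBall] at *
    have h1 := dist_triangle4_right x 0 c y
    have h2 := dist_triangle x c 0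
    have h3 := dist_triangle c y 0
    rw [dist_comm c y] at h3
    linarith
  have h1 := sum_lintegral_closedBall_le Z hM
    (Metric.isClosed_closedBall (x := (0 : EuclideanSpace ℝ (Fin n))) (ε := 3)).measurableSet hZW
    (measurable_const (a := (1 : ℝ≥0∞)))
  simp only [setLIntegral_one] at h1
  have h2 : ∀ (c : EuclideanSpace ℝ (Fin n)) (s : ℝ), 0 < s → volume (Metric.closedBall c s) =
      ENNReal.ofReal (s ^ n) * volume (Metric.ball (0 : EuclideanSpace ℝ (Fin n)) 1) := by
    intro c s hs
    rw [Measure.addHaar_closedBall _ _ hs.le, finrank_euclideanSpace_fin]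
  have hv0 : volume (Metric.ball (0 : EuclideanSpace ℝ (Fin n)) 1) ≠ 0 :=
    (Metric.measure_ball_pos _ _ one_pos).ne'
  have hvt : volume (Metric.ball (0 : EuclideanSpace ℝ (Fin n)) 1) ≠ ∞ := measure_ball_lt_top.ne
  simp only [h2 _ r hr, h2 _ 3 (by norm_num)] at h1
  rw [Finset.sum_const, nsmul_eq_mul, ← mul_assoc, ← mul_assoc,
    ENNReal.mul_le_mul_iff_left hv0 hvt] at h1
  have h3 : ENNReal.ofReal ((Z.card : ℝ) * r ^ n) ≤ ENNReal.ofReal (M * 3 ^ n) := by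
    rw [ENNReal.ofReal_mul (Nat.cast_nonneg _), ENNReal.ofReal_mul (Nat.cast_nonneg _),
      ENNReal.ofReal_natCast, ENNReal.ofReal_natCast]
    exact h1
  have h4 := (ENNReal.ofReal_le_ofReal_iff (by positivity)).1 h3
  rw [div_pow, ← mul_div_assoc, le_div_iff₀ (by positivity)]
  exact h4

end HormanderOp

/-! ### Selection of transverse caps and cells -/

namespace HormanderOp

variable {d : ℕ}

section Pieces

variable {K : ℝ} {M : ℕ} (P : CapDecomposition d K M)

theorem CapDecomposition.weight_le_one {c : Freq d} (hc : c ∈ P.centres) {ω : Freq d}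
    (hω : ω ∈ Metric.closedBall (0 : Freq d) 1) : P.weight c ω ≤ 1 :=
  (Finset.single_le_sum (f := fun c => P.weight c ω) (fun c _ => P.weight_nonneg c ω) hc).trans
    (P.sum_weight ω hω).le

/-- The part of the piece `f_τ` in the cell `{ω | cell ω = s}`. -/
def cellPiece (cell : Freq d → Freq d) (c s : Freq d) (f : Freq d → ℂ) : Freq d → ℂ :=
  {ω | cell ω = s}.indicator (P.piece c f)

variable {P}

theorem norm_piece_le {c : Freq d} (hc : c ∈ P.centres) (f : Freq d → ℂ) {ω : Freq d}
    (hω : ω ∈ Metric.closedBall (0 : Freq d) 1) : ‖P.piece c f ω‖ ≤ ‖f ω‖ := by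
  rw [CapDecomposition.piece, norm_mul, Complex.norm_real,
    Real.norm_of_nonneg (P.weight_nonneg c ω)]
  exact mul_le_of_le_one_left (norm_nonneg _) (CapDecomposition.weight_le_one P hc hω)

theorem norm_cellPiece_le {cell : Freq d → Freq d} {c s : Freq d} (hc : c ∈ P.centres)
    (f : Freq d → ℂ) {ω : Freq d} (hω : ω ∈ Metric.closedBall (0 : Freq d) 1) :
    ‖cellPiece P cell c s f ω‖ ≤ ‖f ω‖ :=
  (norm_indicator_le_norm_self _ _).trans (norm_piece_le hc f hω)

theorem memLp_piece {c : Freq d} (hc : c ∈ P.centres) {f : Freq d → ℂ}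
    (hf : MemLp f 2 (volume.restrict (Metric.closedBall 0 1))) :
    MemLp (P.piece c f) 2 (volume.restrict (Metric.closedBall 0 1)) := by
  refine hf.mono ?_ (ae_restrict_of_forall_mem Metric.isClosed_closedBall.measurableSet
    fun ω hω => norm_piece_le hc f hω)
  exact (Complex.measurable_ofReal.comp (P.measurable_weight c)).aestronglyMeasurable.mul
    hf.aestronglyMeasurable

theorem memLp_cellPiece {cell : Freq d → Freq d} {c s : Freq d}
    (hcell : MeasurableSet {ω | cell ω = s}) (hc : c ∈ P.centres) {f : Freq d → ℂ}
    (hf : MemLp f 2 (volume.restrict (Metric.closedBall 0 1))) :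
    MemLp (cellPiece P cell c s f) 2 (volume.restrict (Metric.closedBall 0 1)) :=
  (memLp_piece hc hf).indicator hcell

theorem l2Norm_cellPiece_le {cell : Freq d → Freq d} {c s : Freq d} (hc : c ∈ P.centres)
    (f : Freq d → ℂ) :
    HormanderOperator.l2Norm (cellPiece P cell c s f) ≤ HormanderOperator.l2Norm f :=
  eLpNorm_mono_ae (ae_restrict_of_forall_mem Metric.isClosed_closedBall.measurableSet
    fun _ hω => norm_cellPiece_le hc f hω)

theorem piece_eq_sum_cellPiece {cell : Freq d → Freq d} {S : Finset (Freq d)}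
    (hS : ∀ ω ∈ Metric.closedBall (0 : Freq d) 1, cell ω ∈ S) (c : Freq d) (f : Freq d → ℂ)
    {ω : Freq d} (hω : ω ∈ Metric.closedBall (0 : Freq d) 1) :
    P.piece c f ω = ∑ s ∈ S, cellPiece P cell c s f ω := by
  rw [Finset.sum_eq_single (cell ω)]
  · exact (indicator_of_mem (s := {ω' | cell ω' = cell ω}) rfl _).symm
  · intro s _ hs
    exact indicator_of_notMem (s := {ω' | cell ω' = s}) (fun h : cell ω = s => hs h.symm) _
  · exact fun h => absurd (hS ω hω) h

theorem of_cellPiece_ne_zero {cell : Freq d → Freq d} {c s : Freq d} (hc : c ∈ P.centres)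
    {f : Freq d → ℂ} {ω : Freq d} (h : cellPiece P cell c s f ω ≠ 0) :
    cell ω = s ∧ ω ∈ Metric.closedBall c K⁻¹ := by
  have h1 : ω ∈ {ω | cell ω = s} := by
    by_contra h1
    exact h (indicator_of_notMem h1 _)
  refine ⟨h1, P.support_weight c hc fun h2 => h ?_⟩
  rw [cellPiece, indicator_of_mem h1, CapDecomposition.piece, h2]
  simp

end Pieces

section Broad

variable {T : HormanderOperator d} {K : ℝ} {M : ℕ} {P : CapDecomposition d K M}

theorem continuous_amp (T : HormanderOperator d) : Continuous T.amp := T.amp_smooth.continuous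

theorem continuous_op {A : ℝ} (hA : ∀ z, |T.amp z| ≤ A) {f : Freq d → ℂ}
    (hf : IntegrableOn f (Metric.closedBall (0 : Freq d) 1)) : Continuous (T.op f) :=
  continuous_oscOp T.phase_smooth (continuous_amp T) T.amp_support hA hf

theorem eLpNorm_rpow_le {p : ℝ} (hp : 0 < p) {F : Space d → ℂ} {s : Set (Space d)}
    (hs : MeasurableSet s) {B : ℝ≥0∞} (hB : ∀ x ∈ s, ‖F x‖ₑ ^ p ≤ B) :
    eLpNorm F (ENNReal.ofReal p) (volume.restrict s) ^ p ≤ B * volume s := by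
  rw [eLpNorm_eq_lintegral_rpow_enorm_toReal (by simpa using hp) ENNReal.ofReal_ne_top,
    ENNReal.toReal_ofReal hp.le, ← ENNReal.rpow_mul, one_div_mul_cancel hp.ne', ENNReal.rpow_one]
  refine (setLIntegral_mono' hs hB).trans (le_of_eq ?_)
  rw [setLIntegral_const]

theorem exists_submodule_of_finrank {k : ℕ} (hkd : k ≤ d + 1) :
    Nonempty {V : Submodule ℝ (Space d) // Module.finrank ℝ V = k - 1} := by
  obtain ⟨V, -, hV⟩ := exists_submodule_finrank_eq (E := Space d) (m := k - 1)
    (by rw [finrank_euclideanSpace_fin]; omega) ⊥ (by simp)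
  exact ⟨⟨V, hV⟩⟩

/-- The trivial bound. -/
theorem broadMu_le {p : ℝ} (hp : 0 < p) {k : ℕ} (hkd : k ≤ d + 1) {A : ℝ}
    (hA : ∀ z, |T.amp z| ≤ A) {f : Freq d → ℂ}
    (hf : MemLp f 2 (volume.restrict (Metric.closedBall 0 1))) (xbar : Space d) :
    T.broadMu P p k 1 f xbar ≤
      ENNReal.ofReal (A * l1Norm f) ^ p * volume (Metric.closedBall xbar (K ^ 2)) := by
  obtain ⟨V⟩ := exists_submodule_of_finrank hkd
  refine (iInf_le _ fun _ => V).trans (iSup_le fun c => iSup_le fun hc => iSup_le fun _ => ?_)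
  refine eLpNorm_rpow_le hp Metric.isClosed_closedBall.measurableSet fun x _ => ?_
  refine ENNReal.rpow_le_rpow ?_ hp.le
  rw [← ofReal_norm]
  refine ENNReal.ofReal_le_ofReal ?_
  have hA0 : 0 ≤ A := (abs_nonneg _).trans (hA 0)
  refine (norm_oscOp_le hA (integrableOn_of_memLp (memLp_piece hc hf)) x).trans ?_
  exact mul_le_mul_of_nonneg_left (l1Norm_mono (integrableOn_of_memLp hf)
    fun ω hω => norm_piece_le hc f hω) hA0

theorem volume_closedBall_ne (x : Space d) {r : ℝ} (hr : 0 < r) :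
    volume (Metric.closedBall x r) ≠ 0 ∧ volume (Metric.closedBall x r) ≠ ∞ :=
  ⟨(Metric.measure_closedBall_pos _ _ hr).ne', measure_closedBall_lt_top.ne⟩

/-- For each subspace, the broad quantity is dominated by a value of one of the pieces which make a
large angle with the subspace. -/
theorem exists_cap_of_broadMu_ne_zero (hK : 1 ≤ K) {p : ℝ} (hp : 0 < p) {k : ℕ} (hkd : k ≤ d + 1)
    {A : ℝ} (hA : ∀ z, |T.amp z| ≤ A) {f : Freq d → ℂ}
    (hf : MemLp f 2 (volume.restrict (Metric.closedBall 0 1))) {xbar : Space d}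
    (hμ : T.broadMu P p k 1 f xbar ≠ 0) {V : Submodule ℝ (Space d)}
    (hV : Module.finrank ℝ V = k - 1) :
    ∃ c ∈ P.centres, ENNReal.ofReal K⁻¹ < T.capAngle xbar (Metric.closedBall c K⁻¹) V ∧
      ∃ x ∈ Metric.closedBall xbar (K ^ 2), T.broadMu P p k 1 f xbar ≤
        2 * volume (Metric.closedBall xbar (K ^ 2)) * ‖T.op (P.piece c f) x‖ₑ ^ p := by
  set μ := T.broadMu P p k 1 f xbar with hμdef
  set v := volume (Metric.closedBall xbar (K ^ 2)) with hv
  obtain ⟨hv0, hvt⟩ := volume_closedBall_ne xbar (show 0 < K ^ 2 by positivity)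
  rw [← hv] at hv0 hvt
  have hμt : μ ≠ ∞ := by
    refine ne_top_of_le_ne_top ?_ (broadMu_le hp hkd hA hf xbar)
    exact ENNReal.mul_ne_top (ENNReal.rpow_ne_top_of_nonneg hp.le ENNReal.ofReal_ne_top) hvt
  -- The factor `2` in the claim leaves room for a crude argument: if the claim failed at every
  -- point of every admissible cap, integration would give `μ ≤ μ / 2`, although `0 < μ < ∞`.
  by_contra! h
  have h1 : μ ≤ μ / 2 := by
    refine (iInf_le _ fun _ => ⟨V, hV⟩).trans (iSup_le fun c => iSup_le fun hc =>
      iSup_le fun hang => ?_)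
    refine (eLpNorm_rpow_le hp Metric.isClosed_closedBall.measurableSet
      (B := μ / 2 / v) fun x hx => ?_).trans (le_of_eq ?_)
    · have h2 := (h c hc (hang 0) x hx).le
      rw [ENNReal.le_div_iff_mul_le (.inl hv0) (.inl hvt),
        ENNReal.le_div_iff_mul_le (.inl two_ne_zero) (.inl ENNReal.ofNat_ne_top)]
      refine le_trans (le_of_eq ?_) h2
      ring
    · exact ENNReal.div_mul_cancel hv0 hvt
  exact absurd h1 (not_le.2 (ENNReal.half_lt_self hμ hμt))

/-- Selection of transverse caps, unless the broad quantity is negligible. -/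
theorem exists_transverse_caps (hK : 1 ≤ K) {p : ℝ} (hp : 0 < p) {k : ℕ} (hkd : k ≤ d + 1)
    {A : ℝ} (hA : ∀ z, |T.amp z| ≤ A) {N : ℕ} (hAN : ∀ z, ‖iteratedFDeriv ℝ N T.amp z‖ ≤ A)
    {f : Freq d → ℂ} (hf : MemLp f 2 (volume.restrict (Metric.closedBall 0 1)))
    {cell : Freq d → Freq d} {S : Finset (Freq d)}
    (hcell : ∀ s, MeasurableSet {ω | cell ω = s})
    (hS : ∀ ω ∈ Metric.closedBall (0 : Freq d) 1, cell ω ∈ S) {xbar : Space d} {q : ℝ}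
    (hq : 2 * volume (Metric.closedBall xbar (K ^ 2)) * ENNReal.ofReal q ^ p =
      T.broadMu P p k 1 f xbar)
    (hqE : S.card * (A * (K ^ 2 / T.scale) ^ N * l1Norm f) < q) :
    ∃ c s ω : Fin k → Freq d, (∀ j, c j ∈ P.centres ∧ ω j ∈ Metric.closedBall (c j) K⁻¹ ∧
      cell (ω j) = s j ∧ (T.scale⁻¹ • xbar, ω j) ∈ tsupport T.amp ∧
      ∃ x ∈ Metric.closedBall xbar (K ^ 2),
        q ≤ S.card * ‖T.op (cellPiece P cell (c j) (s j) f) x‖) ∧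
      ((K⁻¹ / 2) ^ 2) ^ k ≤
        (Matrix.gram ℝ fun j => gauss T.phase (T.scale⁻¹ • xbar) (ω j)).det := by
  have hA0 : 0 ≤ A := (abs_nonneg _).trans (hA 0)
  have hK0 : 0 < K := by linarith
  have hlam : 0 < T.scale := by linarith [T.one_le_scale]
  have hq0 : 0 < q := lt_of_le_of_lt (mul_nonneg (Nat.cast_nonneg _) (mul_nonneg
    (by positivity) (l1Norm_nonneg f))) hqE
  obtain ⟨hv0, hvt⟩ := volume_closedBall_ne xbar (show 0 < K ^ 2 by positivity)
  have hμ : T.broadMu P p k 1 f xbar ≠ 0 := by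
    rw [← hq]
    refine mul_ne_zero (mul_ne_zero two_ne_zero hv0) ?_
    exact (ENNReal.rpow_pos (ENNReal.ofReal_pos.2 hq0) ENNReal.ofReal_ne_top).ne'
  have hsel : ∀ V : Submodule ℝ (Space d), Module.finrank ℝ V = k - 1 →
      ∃ a : Freq d × Freq d × Freq d, (a.1 ∈ P.centres ∧ a.2.2 ∈ Metric.closedBall a.1 K⁻¹ ∧
        cell a.2.2 = a.2.1 ∧ (T.scale⁻¹ • xbar, a.2.2) ∈ tsupport T.amp ∧
        ∃ x ∈ Metric.closedBall xbar (K ^ 2),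
          q ≤ S.card * ‖T.op (cellPiece P cell a.1 a.2.1 f) x‖) ∧
        ∀ w ∈ V, K⁻¹ / 2 ≤ ‖gauss T.phase (T.scale⁻¹ • xbar) a.2.2 - w‖ := by
    intro V hV
    obtain ⟨c, hc, hang, x, hx, hμx⟩ := exists_cap_of_broadMu_ne_zero hK hp hkd hA hf hμ hV
    have h1 : q ≤ ‖T.op (P.piece c f) x‖ := by
      rw [← hq] at hμx
      have h2 := (ENNReal.mul_le_mul_iff_right (mul_ne_zero two_ne_zero hv0)
        (ENNReal.mul_ne_top ENNReal.ofNat_ne_top hvt)).1 hμx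
      have h3 := (ENNReal.rpow_le_rpow_iff hp).1 h2
      rw [← ofReal_norm] at h3
      exact (ENNReal.ofReal_le_ofReal_iff (norm_nonneg _)).1 h3
    have h2 : T.op (P.piece c f) x = ∑ s ∈ S, T.op (cellPiece P cell c s f) x :=
      oscOp_sum T.phase_smooth (continuous_amp T) T.amp_support hA S
        (fun s _ => integrableOn_of_memLp (memLp_cellPiece (hcell s) hc hf))
        (fun ω hω => piece_eq_sum_cellPiece hS c f hω) x
    -- Pigeonhole over the cells. They are much finer than the caps, which are too large for the
    -- Gauss map to be nearly constant on the scale of the transversality.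
    obtain ⟨s, hs, hqs⟩ : ∃ s ∈ S, q ≤ S.card * ‖T.op (cellPiece P cell c s f) x‖ := by
      by_contra! h
      rw [h2] at h1
      have h3 := h1.trans (norm_sum_le _ _)
      rcases S.eq_empty_or_nonempty with rfl | hne
      · simp only [Finset.sum_empty] at h3
        linarith
      have hcard : (0 : ℝ) < S.card := by exact_mod_cast hne.card_pos
      have h4 : ∑ s ∈ S, ‖T.op (cellPiece P cell c s f) x‖ < ∑ _s ∈ S, q / S.card :=
        Finset.sum_lt_sum_of_nonempty hne fun s hs => by
          rw [lt_div_iff₀ hcard, mul_comm]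
          exact h s hs
      rw [Finset.sum_const, nsmul_eq_mul, mul_div_cancel₀ _ hcard.ne'] at h4
      linarith
    -- If the cell piece met no frequency of the support over the centre `xbar`, the amplitude would
    -- vanish to all orders at these frequencies, and at `x`, which is `K² / λ` away after
    -- rescaling, it would be at most `A (K² / λ) ^ N`. This contradicts `hqE`.
    obtain ⟨ω, hωc, hωs, hωa⟩ : ∃ ω ∈ Metric.closedBall c K⁻¹, cell ω = s ∧
        (T.scale⁻¹ • xbar, ω) ∈ tsupport T.amp := by
      by_contra! h
      have hint := integrableOn_of_memLp (memLp_cellPiece (hcell s) hc hf)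
      have h3 : ‖T.op (cellPiece P cell c s f) x‖ ≤
          A * (K ^ 2 / T.scale) ^ N * l1Norm (cellPiece P cell c s f) := by
        refine norm_oscOp_le_of_forall hint fun ω hω => ?_
        obtain ⟨hω1, hω2⟩ := of_cellPiece_ne_zero hc hω
        have h4 := norm_le_of_notMem_tsupport (N := N)
          (T.amp_smooth.of_le (WithTop.coe_le_coe.2 le_top)) hAN (h ω hω2 hω1)
          (T.scale⁻¹ • x, ω)
        rw [Real.norm_eq_abs] at h4
        refine h4.trans (mul_le_mul_of_nonneg_left (pow_le_pow_left₀ (norm_nonneg _) ?_ N) hA0)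
        rw [Prod.mk_sub_mk, sub_self, ← smul_sub, Prod.norm_def, norm_zero,
          max_eq_left (norm_nonneg _), norm_smul, norm_inv, Real.norm_of_nonneg hlam.le,
          inv_mul_eq_div]
        rw [Metric.mem_closedBall, dist_eq_norm] at hx
        exact div_le_div_of_nonneg_right hx hlam.le
      have h4 : l1Norm (cellPiece P cell c s f) ≤ l1Norm f :=
        l1Norm_mono (integrableOn_of_memLp hf) fun ω hω => norm_cellPiece_le hc f hω
      have h5 : ‖T.op (cellPiece P cell c s f) x‖ ≤ A * (K ^ 2 / T.scale) ^ N * l1Norm f :=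
        h3.trans (mul_le_mul_of_nonneg_left h4 (by positivity))
      have h6 := mul_le_mul_of_nonneg_left h5 (Nat.cast_nonneg (α := ℝ) S.card)
      linarith
    refine ⟨(c, s, ω), ⟨hc, hωc, hωs, hωa, x, hx, hqs⟩, fun w hw => ?_⟩
    have hg : gauss₀ T.phase (T.scale⁻¹ • xbar) ω ≠ 0 :=
      gauss₀_ne_zero (T.rank_mixedHessian _ _ (T.amp_support hωa))
    refine sin_le_norm_sub_of_lt_angle (norm_gauss hg) (by positivity) (inv_le_one_of_one_le₀ hK)
      (fun v hv hv0 => ?_) hw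
    -- The angle of the cap is an infimum over all its frequencies in the support, so it also bounds
    -- the angle at the `ω` just found.
    have h3 : T.capAngle xbar (Metric.closedBall c K⁻¹) V ≤ ENNReal.ofReal
        (InnerProductGeometry.angle v (gauss T.phase (T.scale⁻¹ • xbar) ω)) :=
      (iInf₂_le ω ⟨hωc, hωa⟩).trans (iInf₂_le v ⟨hv, hv0⟩)
    exact (ENNReal.ofReal_lt_ofReal_iff_of_nonneg (by positivity)).1 (hang.trans_le h3)
  obtain ⟨a, haP, ha⟩ := exists_tuple_le_det_gram (E := Space d)
    (by rw [finrank_euclideanSpace_fin]; omega) (show 0 ≤ K⁻¹ / 2 by positivity) hsel k le_rfl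
  exact ⟨fun j => (a j).1, fun j => (a j).2.1, fun j => (a j).2.2, haP, ha⟩

end Broad

/-- Transversality of the `3ρ`-cells around the points `(y, s j)`. -/
def CellsTransverse (φ : Space d × Freq d → ℝ) (D : Set (Space d × Freq d)) (ρ ν : ℝ) {k : ℕ}
    (y : Space d) (s : Fin k → Freq d) : Prop :=
  ∀ (x : Space d) (ω : Fin k → Freq d),
    (∀ j, (x, ω j) ∈ D ∧ (x, ω j) ∈ Metric.closedBall (y, s j) (3 * ρ)) →
      ν ≤ HormanderOperator.wedgeNorm fun j => gauss φ x (ω j)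

/-- The points of the `3ρ`-cells are within `4ρ` of the reference points, so the Gauss vectors move
by at most `4Lρ` and the Gram determinant by at most `2ν²`. Starting from `4ν²`, it stays above
`ν²`. -/
theorem cellsTransverse_of_le_det_gram {φ : Space d × Freq d → ℝ} {D : Set (Space d × Freq d)}
    (hD : D ⊆ unitBalls d)
    (hr : ∀ x ω, (x, ω) ∈ unitBalls d →
      Module.finrank ℝ (LinearMap.range (mixedHessian φ x ω).toLinearMap) = d)
    {L : ℝ} (hL0 : 0 < L) (hL : ∀ z ∈ unitBalls d, ∀ z' ∈ unitBalls d,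
      ‖gauss φ z.1 z.2 - gauss φ z'.1 z'.2‖ ≤ L * ‖z - z'‖) {k : ℕ} {L' : ℝ}
    (hL' : ∀ (u v : Fin k → Space d) (r : ℝ), 0 ≤ r →
      (∀ i, ‖u i‖ ≤ 1) → (∀ i, ‖v i‖ ≤ 1) → (∀ i, ‖u i - v i‖ ≤ r) →
      |(Matrix.gram ℝ u).det - (Matrix.gram ℝ v).det| ≤ L' * r)
    {ρ ν : ℝ} (hρ : 0 ≤ ρ)
    (hLρ : L' * (L * (4 * ρ)) ≤ 2 * ν ^ 2) {x y : Space d} {ω s : Fin k → Freq d}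
    (hx : dist x y ≤ ρ) (hωs : ∀ j, dist (ω j) (s j) ≤ ρ) (hωD : ∀ j, (x, ω j) ∈ D)
    (hdet : 4 * ν ^ 2 ≤ (Matrix.gram ℝ fun j => gauss φ x (ω j)).det) :
    CellsTransverse φ D ρ ν y s := by
  intro x' ω' h'
  have hn : ∀ x ω, (x, ω) ∈ unitBalls d → ‖gauss φ x ω‖ ≤ 1 := fun x ω hz =>
    (norm_gauss (gauss₀_ne_zero (hr x ω hz))).le
  have h1 := hL' (fun j => gauss φ x' (ω' j)) (fun j => gauss φ x (ω j)) (L * (4 * ρ))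
    (by positivity) (fun j => hn _ _ (hD (h' j).1)) (fun j => hn _ _ (hD (hωD j))) fun j => by
      refine (hL (x', ω' j) (hD (h' j).1) (x, ω j) (hD (hωD j))).trans
        (mul_le_mul_of_nonneg_left ?_ hL0.le)
      have h2 := (h' j).2
      rw [Metric.mem_closedBall] at h2
      have h3 : dist ((x, ω j) : Space d × Freq d) (y, s j) ≤ ρ := by
        rw [Prod.dist_eq]
        exact max_le hx (hωs j)
      rw [← dist_eq_norm]
      linarith [dist_triangle_right ((x', ω' j) : Space d × Freq d) (x, ω j) (y, s j)]
  refine Real.le_sqrt_of_sq_le ?_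
  have h2 := (abs_le.1 h1).1
  set a := (Matrix.gram ℝ fun j => gauss φ x (ω j)).det
  set b := (Matrix.gram ℝ fun j => gauss φ x' (ω' j)).det
  have h3 : 0 ≤ ν ^ 2 := sq_nonneg ν
  clear_value a b
  change ν ^ 2 ≤ b
  linarith

end HormanderOp

/-! ### Norms of amplitudes and localised operators -/

namespace HormanderOp

variable {d : ℕ}

section Elementary

theorem ennreal_sum_rpow_le {ι : Type*} (s : Finset ι) (f : ι → ℝ≥0∞) {t : ℝ} (ht : 0 < t)
    (ht1 : t ≤ 1) : (∑ i ∈ s, f i) ^ t ≤ ∑ i ∈ s, f i ^ t :=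
  Finset.le_sum_of_subadditive (fun x : ℝ≥0∞ => x ^ t) (ENNReal.zero_rpow_of_pos ht).le
    (fun a b => ENNReal.rpow_add_le_add_rpow a b ht.le ht1) s f

theorem real_sum_rpow_le {ι : Type*} (s : Finset ι) {f : ι → ℝ} (hf : ∀ i, 0 ≤ f i) {t : ℝ}
    (ht : 0 < t) (ht1 : t ≤ 1) : (∑ i ∈ s, f i) ^ t ≤ ∑ i ∈ s, f i ^ t := by
  lift f to ι → NNReal using hf
  have h := Finset.le_sum_of_subadditive (fun x : NNReal => x ^ t) (NNReal.zero_rpow ht.ne').le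
    (fun a b => NNReal.rpow_add_le_add_rpow a b ht.le ht1) s f
  beta_reduce
  exact_mod_cast h

theorem exists_volume_closedBall_le (d : ℕ) : ∃ C : ℝ, 1 ≤ C ∧ ∀ (y : Space d) (r : ℝ), 0 ≤ r →
    volume (Metric.closedBall y r) ≤ ENNReal.ofReal (C * r ^ (d + 1)) := by
  set v : ℝ≥0∞ := volume (Metric.closedBall (0 : Space d) 1) with hv
  have hvt : v ≠ ∞ := measure_closedBall_lt_top.ne
  refine ⟨1 + v.toReal, by linarith [ENNReal.toReal_nonneg (a := v)], fun y r hr => ?_⟩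
  rw [Measure.addHaar_closedBall' _ _ hr, ← hv, finrank_euclideanSpace_fin,
    ← ENNReal.ofReal_toReal hvt, ← ENNReal.ofReal_mul (by positivity)]
  refine ENNReal.ofReal_le_ofReal ?_
  rw [ENNReal.toReal_ofReal ENNReal.toReal_nonneg]
  nlinarith [ENNReal.toReal_nonneg (a := v), pow_nonneg hr (d + 1)]

theorem ampNorm_le_ofReal {N : ℕ} {a : Space d × Freq d → ℝ} {β : ℝ}
    (h : ∀ m ≤ N, ∀ z, ‖iteratedFDeriv ℝ m a z‖ ≤ β) : ampNorm N a ≤ ENNReal.ofReal β := by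
  refine iSup₂_le fun m hm => iSup_le fun z => ?_
  rw [← ofReal_norm]
  exact ENNReal.ofReal_le_ofReal (h m (Nat.lt_succ_iff.1 (Finset.mem_range.1 hm)) z)

theorem exists_ampNorm_eq {a : Space d × Freq d → ℝ} (ha : ContDiff ℝ (⊤ : ℕ∞) a)
    (hs : tsupport a ⊆ unitBalls d) (N : ℕ) :
    ∃ A : ℝ, 0 ≤ A ∧ ampNorm N a = ENNReal.ofReal A ∧
      ∀ m ≤ N, ∀ z, ‖iteratedFDeriv ℝ m a z‖ ≤ A := by
  have hcs : HasCompactSupport a := by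
    refine IsCompact.of_isClosed_subset ?_ (isClosed_tsupport a) hs
    rw [unitBalls_eq_closedBall]
    exact isCompact_closedBall _ _
  have h1 : ∀ m, ∃ B : ℝ, ∀ z, ‖iteratedFDeriv ℝ m a z‖ ≤ B := fun m =>
    (hcs.iteratedFDeriv m).exists_bound_of_continuous
      (ha.continuous_iteratedFDeriv (by exact_mod_cast le_top))
  choose B hB using h1
  have ht : ampNorm N a ≠ ∞ := by
    refine ne_top_of_le_ne_top ENNReal.ofReal_ne_top
      (ampNorm_le_ofReal (β := ∑ m ∈ Finset.range (N + 1), B m) fun m hm z => (hB m z).trans ?_)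
    exact Finset.single_le_sum (f := B) (fun m _ => (norm_nonneg _).trans (hB m 0))
      (Finset.mem_range.2 (Nat.lt_succ_of_le hm))
  refine ⟨(ampNorm N a).toReal, ENNReal.toReal_nonneg, (ENNReal.ofReal_toReal ht).symm,
    fun m hm z => ?_⟩
  rw [← ENNReal.ofReal_le_ofReal_iff ENNReal.toReal_nonneg, ENNReal.ofReal_toReal ht, ofReal_norm]
  exact le_iSup₂_of_le m (Finset.mem_range.2 (Nat.lt_succ_of_le hm))
    (le_iSup (fun z => ‖iteratedFDeriv ℝ m a z‖ₑ) z)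

end Elementary

/-- The operator with the phase and scale of `T`, and the amplitude `b`. -/
def localise (T : HormanderOperator d) (b : Space d × Freq d → ℝ) (hb : ContDiff ℝ (⊤ : ℕ∞) b)
    (hb0 : ∀ z, 0 ≤ b z) (hs : tsupport b ⊆ tsupport T.amp) : HormanderOperator d where
  phase := T.phase
  amp := b
  scale := T.scale
  one_le_scale := T.one_le_scale
  amp_smooth := hb
  amp_nonneg := hb0
  amp_support := hs.trans T.amp_support
  phase_smooth := T.phase_smooth
  rank_mixedHessian := T.rank_mixedHessian
  det_curvature_ne_zero := fun x ω h => T.det_curvature_ne_zero x ω (hs h)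

/-- The values of `T f` at nearby points are dominated by the values of finitely many localised
operators at a single point, if `f` is supported in a small ball. -/
theorem exists_separating_localisations (d k N₀ : ℕ) (hk : k ≠ 0) {φ : Space d × Freq d → ℝ}
    (hφ : ∀ z ∈ unitBalls d, ContDiffAt ℝ (⊤ : ℕ∞) φ z) :
    ∃ C : ℝ, 1 ≤ C ∧ ∀ T : HormanderOperator d, T.phase = φ → ∀ (K ρ A : ℝ), 1 ≤ K → 0 < ρ →
      ρ ≤ 1 → C * (K ^ 2 * ρ) ≤ 1 → C * K ^ 4 ≤ T.scale →
      (∀ m ≤ N₀ + 1 + (d + 1), ∀ z, ‖iteratedFDeriv ℝ m T.amp z‖ ≤ A) →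
      ∀ (y : Space d) (s : Freq d),
      ∃ (ι : Type) (_ : Fintype ι) (S : ι → HormanderOperator d) (β : ι → ℝ),
        (∀ i, (S i).IsLocalisation T) ∧
        (∀ i, tsupport (S i).amp ⊆ Metric.closedBall (y, s) (3 * ρ)) ∧ (∀ i, 0 ≤ β i) ∧
        (∀ i, ampNorm N₀ (S i).amp ≤ ENNReal.ofReal (β i)) ∧
        ∑ i, β i ^ (1 / (k : ℝ)) ≤ C * (ρ⁻¹ ^ (N₀ + 1) * A) ^ (1 / (k : ℝ)) ∧
        ∀ (x v : Space d) (g : Freq d → ℂ), T.scale⁻¹ • x ∈ Metric.closedBall y ρ →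
          ‖v‖ ≤ 2 * K ^ 2 → IntegrableOn g (Metric.closedBall (0 : Freq d) 1) →
          (∀ ω, g ω ≠ 0 → ω ∈ Metric.closedBall s ρ) →
          ‖T.op g (x + v)‖ ≤ ∑ i, ‖(S i).op g x‖ +
            C * A * (K ^ 2) ^ (d + 2) * T.scale⁻¹ ^ (d + 1) * l1Norm g := by
  obtain ⟨ψ, B, hB1, hψ, hψφ, hψB⟩ := exists_global_extension hφ (N₀ + 1 + (d + 1) + 1)
  obtain ⟨C, hC1, hC⟩ := exists_separation d k N₀ hk B hB1
  refine ⟨C, hC1, ?_⟩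
  rintro T rfl K ρ A hK hρ hρ1 hKρ hKlam hA y s
  have hlam : 0 < T.scale := by linarith [T.one_le_scale]
  obtain ⟨ι, hι, b, β, hb, hb0, hbs, hβ0, hβ, hβsum, hsep⟩ := hC T.phase ψ hφ hψφ hψ hψB K T.scale
    ρ hK T.one_le_scale hρ hρ1 hKρ hKlam (y, s) T.amp A T.amp_smooth T.amp_support hA
  have h0 : ∀ {b : Space d × Freq d → ℝ} {β : ℝ} {N : ℕ},
      (∀ m ≤ N, ∀ z, ‖iteratedFDeriv ℝ m b z‖ ≤ β) → ∀ z, |b z| ≤ β := fun {b β N} h z => by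
    rw [← Real.norm_eq_abs, ← norm_iteratedFDeriv_zero (𝕜 := ℝ)]
    exact h 0 (Nat.zero_le _) z
  refine ⟨ι, hι, fun i => localise T (b i) (hb i) (hb0 i) ((hbs i).trans inter_subset_left), β,
    fun i => ⟨rfl, rfl, (hbs i).trans inter_subset_left⟩, fun i => (hbs i).trans inter_subset_right,
    hβ0, fun i => ampNorm_le_ofReal (hβ i), hβsum, fun x v g hx hv hg hgs => ?_⟩
  have hu : ‖T.scale⁻¹ • v‖ ≤ 2 * K ^ 2 / T.scale := by
    rw [norm_smul, norm_inv, Real.norm_of_nonneg hlam.le, inv_mul_eq_div]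
    exact div_le_div_of_nonneg_right hv hlam.le
  obtain ⟨κ, hκ, hκE⟩ := hsep _ hu
  exact norm_oscOp_add_le hφ (fun z hz => (hψφ z hz).eq_of_nhds) T.amp_smooth.continuous
    T.amp_support (h0 hA) (fun i => (hb i).continuous)
    (fun i => ((hbs i).trans inter_subset_left).trans T.amp_support) (fun i => h0 (hβ i)) hκ hx
    hκE hg hgs

/-! ### Consequences of the multilinear inequality -/

section Multilinear

variable {k : ℕ}

theorem continuous_op_of_memLp (T : HormanderOperator d) {f : Freq d → ℂ}
    (hf : MemLp f 2 (volume.restrict (Metric.closedBall 0 1))) : Continuous (T.op f) := by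
  obtain ⟨A, -, -, hA⟩ := exists_ampNorm_eq T.amp_smooth T.amp_support 0
  refine continuous_op (A := A) (fun z => ?_) (integrableOn_of_memLp hf)
  rw [← Real.norm_eq_abs, ← norm_iteratedFDeriv_zero (𝕜 := ℝ)]
  exact hA 0 le_rfl z

/-- The multilinear estimate with the implied constant `C` for the phases `φ`. -/
def MultilinearBound (𝒯 : Set (HormanderOperator d)) (p ε C₀ R₀ : ℝ) (N₀ : ℕ)
    (φ : Fin k → Space d × Freq d → ℝ) (C : ℝ) : Prop :=
  ∀ (T : Fin k → HormanderOperator d) (lam ν R : ℝ) (y : Space d) (f : Fin k → Freq d → ℂ),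
    (∀ j, T j ∈ 𝒯 ∧ (T j).phase = φ j ∧ (T j).scale = lam) →
    0 < ν → ν ≤ 1 → HormanderOperator.Transverse T ν → 1 ≤ R → R₀ ≤ R → R ≤ lam →
    (∀ j, MemLp (f j) 2 (volume.restrict (Metric.closedBall 0 1))) →
    eLpNorm (fun x => ∏ j, ‖(T j).op (f j) x‖ ^ (1 / (k : ℝ))) (ENNReal.ofReal p)
        (volume.restrict (Metric.closedBall y R)) ≤
      ENNReal.ofReal (C * ν ^ (-C₀) * R ^ ε) *
        ∏ j, (ampNorm N₀ (T j).amp * HormanderOperator.l2Norm (f j)) ^ (1 / (k : ℝ))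

/-- The multilinear estimate on a neighbourhood of a ball. -/
theorem eLpNorm_prod_op_le_of_multilinear {𝒯 : Set (HormanderOperator d)} {p ε C₀ R₀ C : ℝ}
    {N₀ : ℕ} {φ : Fin k → Space d × Freq d → ℝ} (hk : k ≠ 0) (hε : 0 < ε)
    (hML : MultilinearBound 𝒯 p ε C₀ R₀ N₀ φ C)
    {T : Fin k → HormanderOperator d} {lam ν R K : ℝ} (y : Space d) {f : Fin k → Freq d → ℂ}
    (hT : ∀ j, T j ∈ 𝒯 ∧ (T j).phase = φ j ∧ (T j).scale = lam) (hν0 : 0 < ν) (hν1 : ν ≤ 1)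
    (hν : HormanderOperator.Transverse T ν) (hR : 1 ≤ R) (hRlam : R ≤ lam) (hK : 1 ≤ K)
    (hR₀ : R₀ ≤ lam)
    (hf : ∀ j, MemLp (f j) 2 (volume.restrict (Metric.closedBall 0 1))) :
    eLpNorm (fun x => ∏ j, ‖(T j).op (f j) x‖ ^ (1 / (k : ℝ))) (ENNReal.ofReal p)
        (volume.restrict (Metric.closedBall y (R + 2 * K ^ 2))) ≤
      ENNReal.ofReal (max C 0 * ν ^ (-C₀) * ((3 + |R₀|) * K ^ 2 * R) ^ ε) *
        ∏ j, (ampNorm N₀ (T j).amp * HormanderOperator.l2Norm (f j)) ^ (1 / (k : ℝ)) := by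
  have hK2 : 1 ≤ K ^ 2 := one_le_pow₀ hK
  have hR₀' := le_abs_self R₀
  have hR₀0 := abs_nonneg R₀
  have hlarge : R + 2 * K ^ 2 + |R₀| ≤ (3 + |R₀|) * K ^ 2 * R := by
    have h1 : 1 ≤ K ^ 2 * R := one_le_mul_of_one_le_of_one_le hK2 hR
    have h2 : R ≤ K ^ 2 * R := le_mul_of_one_le_left (by linarith) hK2
    have h3 : K ^ 2 ≤ K ^ 2 * R := le_mul_of_one_le_right (by linarith) hR
    have h4 : |R₀| ≤ |R₀| * (K ^ 2 * R) := le_mul_of_one_le_right hR₀0 h1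
    linarith
  have hconst : ∀ R', 1 ≤ R' → R' ≤ (3 + |R₀|) * K ^ 2 * R →
      ENNReal.ofReal (C * ν ^ (-C₀) * R' ^ ε) ≤
        ENNReal.ofReal (max C 0 * ν ^ (-C₀) * ((3 + |R₀|) * K ^ 2 * R) ^ ε) := by
    intro R' h1 h2
    refine ENNReal.ofReal_le_ofReal ?_
    have h3 : 0 ≤ ν ^ (-C₀) := Real.rpow_nonneg hν0.le _
    have h4 : R' ^ ε ≤ ((3 + |R₀|) * K ^ 2 * R) ^ ε :=
      Real.rpow_le_rpow (by linarith) h2 hε.le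
    have h5 : 0 ≤ R' ^ ε := Real.rpow_nonneg (by linarith) _
    calc C * ν ^ (-C₀) * R' ^ ε ≤ max C 0 * ν ^ (-C₀) * R' ^ ε := by
          gcongr
          exact le_max_left _ _
      _ ≤ _ := by gcongr
  -- Adding `|R₀|` makes the radius admissible from below. If it is then too large, the ball of
  -- radius `λ` about the origin serves instead, because the operators vanish outside it. In both
  -- cases the radius used is at most `(3 + |R₀|) K² R`.
  by_cases hcase : R + 2 * K ^ 2 + |R₀| ≤ lam
  · have h1 : 1 ≤ R + 2 * K ^ 2 + |R₀| := by linarith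
    refine (eLpNorm_mono_measure _ (Measure.restrict_mono (Metric.closedBall_subset_closedBall
      (by linarith : R + 2 * K ^ 2 ≤ R + 2 * K ^ 2 + |R₀|)) le_rfl)).trans ?_
    refine (hML T lam ν _ y f hT hν0 hν1 hν h1 (by linarith) hcase hf).trans ?_
    exact mul_le_mul_left (hconst _ h1 hlarge) _
  · have h1 : 1 ≤ lam := hR.trans hRlam
    set F : Space d → ℝ := fun x => ∏ j, ‖(T j).op (f j) x‖ ^ (1 / (k : ℝ)) with hF
    have hF0 : (Metric.closedBall (0 : Space d) lam).indicator F = F := by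
      refine indicator_eq_self.2 fun x hx => ?_
      by_contra h
      rw [mem_closedBall_zero_iff, not_le] at h
      refine hx (Finset.prod_eq_zero (Finset.mem_univ (⟨0, Nat.pos_of_ne_zero hk⟩ : Fin k)) ?_)
      rw [op_eq_oscOp, oscOp_eq_zero (T _).amp_support (by rw [(hT _).2.2]; linarith) _
        (by rw [(hT _).2.2]; exact h), norm_zero, Real.zero_rpow]
      exact one_div_ne_zero (Nat.cast_ne_zero.2 hk)
    refine le_trans ?_ ((hML T lam ν lam 0 f hT hν0 hν1 hν h1 hR₀ le_rfl hf).trans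
      (mul_le_mul_left (hconst lam h1 ((not_le.1 hcase).le.trans hlarge)) _))
    change eLpNorm F _ _ ≤ eLpNorm F _ _
    conv_lhs => rw [← hF0]
    rw [eLpNorm_indicator_eq_eLpNorm_restrict Metric.isClosed_closedBall.measurableSet,
      Measure.restrict_restrict Metric.isClosed_closedBall.measurableSet]
    exact eLpNorm_mono_measure _ (Measure.restrict_mono inter_subset_left le_rfl)

/-- Expansion of a product of roots of sums in an `Lᵖ` norm. -/
theorem eLpNorm_prod_sum_rpow_le {α : Type*} [MeasurableSpace α] {μ : Measure α} (hk : k ≠ 0)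
    {p : ℝ≥0∞} (hp : 1 ≤ p) {ι : Fin k → Type} [∀ j, Fintype (ι j)] {F : ∀ j, ι j → α → ℝ}
    (hF0 : ∀ j i x, 0 ≤ F j i x) (hF : ∀ j i, AEStronglyMeasurable (F j i) μ) {c : ℝ≥0∞}
    {b : ∀ j, ι j → ℝ≥0∞}
    (h : ∀ i : ∀ j, ι j, eLpNorm (fun x => ∏ j, F j (i j) x ^ (1 / (k : ℝ))) p μ ≤
      c * ∏ j, b j (i j)) :
    eLpNorm (fun x => ∏ j, (∑ i, F j i x) ^ (1 / (k : ℝ))) p μ ≤ c * ∏ j, ∑ i, b j i := by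
  classical
  have hk0 : (0 : ℝ) < 1 / (k : ℝ) := one_div_pos.2 (Nat.cast_pos.2 (Nat.pos_of_ne_zero hk))
  have hk1 : 1 / (k : ℝ) ≤ 1 :=
    div_le_one_of_le₀ (by exact_mod_cast Nat.one_le_iff_ne_zero.2 hk) (Nat.cast_nonneg _)
  -- The root `t ↦ t ^ (1 / k)` is subadditive, and the product of the resulting sums expands over
  -- all choices of one index per factor.
  have h1 : ∀ x, ‖∏ j, (∑ i, F j i x) ^ (1 / (k : ℝ))‖ ≤
      (∑ i : ∀ j, ι j, fun x => ∏ j, F j (i j) x ^ (1 / (k : ℝ))) x := by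
    intro x
    have h2 : ∀ j, 0 ≤ (∑ i, F j i x) ^ (1 / (k : ℝ)) := fun j =>
      Real.rpow_nonneg (Finset.sum_nonneg fun i _ => hF0 j i x) _
    rw [Real.norm_of_nonneg (Finset.prod_nonneg fun j _ => h2 j), Finset.sum_apply]
    refine (Finset.prod_le_prod (fun j _ => h2 j) fun j _ =>
      real_sum_rpow_le Finset.univ (fun i => hF0 j i x) hk0 hk1).trans (le_of_eq ?_)
    rw [Finset.prod_univ_sum, Fintype.piFinset_univ]
  refine (eLpNorm_mono_real h1).trans ((eLpNorm_sum_le (fun i _ => ?_) hp).trans ?_)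
  · exact Finset.aestronglyMeasurable_fun_prod _ fun j _ =>
      (Real.continuous_rpow_const hk0.le).comp_aestronglyMeasurable (hF j (i j))
  · refine (Finset.sum_le_sum fun i _ => h i).trans (le_of_eq ?_)
    rw [← Finset.mul_sum, Finset.prod_univ_sum, Fintype.piFinset_univ]

end Multilinear

end HormanderOp

namespace HormanderOp

variable {d : ℕ}

/-! ### The estimate on a single ball -/

section PerBall

variable {T : HormanderOperator d} {K : ℝ} {M : ℕ} {P : CapDecomposition d K M}

/-- The geometric mean of the sums `∑ᵢ |Sᵢ g_j|`. -/
def meanOp {k : ℕ} {ι : Fin k → Type} [∀ j, Fintype (ι j)]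
    (S : ∀ j, ι j → HormanderOperator d) (g : Fin k → Freq d → ℂ) (x : Space d) : ℝ :=
  ∏ j, (∑ i, ‖(S j i).op (g j) x‖) ^ (1 / (k : ℝ))

theorem le_mul_prod_rpow {k : ℕ} (hk : k ≠ 0) {q D : ℝ} (hq : 0 ≤ q) (hD : 0 ≤ D)
    {G : Fin k → ℝ} (hG : ∀ j, 0 ≤ G j) (h : ∀ j, q ≤ D * G j) :
    q ≤ D * ∏ j, G j ^ (1 / (k : ℝ)) := by
  have hroot : ∀ x : ℝ, 0 ≤ x → ∏ _j : Fin k, x ^ (1 / (k : ℝ)) = x := fun x hx => by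
    rw [Finset.prod_const, Finset.card_univ, Fintype.card_fin, one_div,
      Real.rpow_inv_natCast_pow hx hk]
  calc q = ∏ _j : Fin k, q ^ (1 / (k : ℝ)) := (hroot q hq).symm
    _ ≤ ∏ j, (D * G j) ^ (1 / (k : ℝ)) := Finset.prod_le_prod
        (fun j _ => Real.rpow_nonneg hq _) fun j _ =>
          Real.rpow_le_rpow hq (h j) (one_div_nonneg.2 (Nat.cast_nonneg _))
    _ = D * ∏ j, G j ^ (1 / (k : ℝ)) := by
        simp_rw [fun j => Real.mul_rpow (z := 1 / (k : ℝ)) hD (hG j)]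
        rw [Finset.prod_mul_distrib, hroot D hD]

/-- The broad quantity of a ball is either negligible or dominated by a multilinear average. -/
theorem broadMu_le_lintegral (hK : 1 ≤ K) {p : ℝ} (hp : 0 < p) {k : ℕ} (hk : k ≠ 0)
    (hkd : k ≤ d + 1) {A : ℝ} (hA : ∀ z, |T.amp z| ≤ A) {N : ℕ}
    (hAN : ∀ z, ‖iteratedFDeriv ℝ N T.amp z‖ ≤ A) {f : Freq d → ℂ}
    (hf : MemLp f 2 (volume.restrict (Metric.closedBall 0 1))) {ρ ν E : ℝ}
    {cell : Freq d → Freq d} {Ω : Finset (Freq d)} (hcell : ∀ s, MeasurableSet {ω | cell ω = s})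
    (hΩ : ∀ ω ∈ Metric.closedBall (0 : Freq d) 1, cell ω ∈ Ω)
    (hcellρ : ∀ ω, dist ω (cell ω) ≤ ρ) (hKρ : K ^ 2 / T.scale ≤ ρ / 2)
    (hE : A * (K ^ 2 / T.scale) ^ N ≤ E) {ι : Space d → Freq d → Type} [∀ y s, Fintype (ι y s)]
    {S : ∀ y s, ι y s → HormanderOperator d}
    (hS : ∀ (y : Space d) (s : Freq d) (x v : Space d) (g : Freq d → ℂ),
      T.scale⁻¹ • x ∈ Metric.closedBall y ρ → ‖v‖ ≤ 2 * K ^ 2 →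
      IntegrableOn g (Metric.closedBall (0 : Freq d) 1) →
      (∀ ω, g ω ≠ 0 → ω ∈ Metric.closedBall s ρ) →
      ‖T.op g (x + v)‖ ≤ ∑ i, ‖(S y s i).op g x‖ + E * l1Norm g) {xbar y : Space d}
    (hy : dist (T.scale⁻¹ • xbar) y ≤ ρ / 2)
    (htr : ∀ ω s : Fin k → Freq d, (∀ j, dist (ω j) (s j) ≤ ρ) →
      (∀ j, (T.scale⁻¹ • xbar, ω j) ∈ tsupport T.amp) → ((K⁻¹ / 2) ^ 2) ^ k ≤
        (Matrix.gram ℝ fun j => gauss T.phase (T.scale⁻¹ • xbar) (ω j)).det →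
      CellsTransverse T.phase (tsupport T.amp) ρ ν y s) :
    T.broadMu P p k 1 f xbar ≤ ∫⁻ _ in Metric.closedBall xbar (K ^ 2),
        2 * ENNReal.ofReal (2 * Ω.card * (E * l1Norm f)) ^ p ∨
      ∃ c s : Fin k → Freq d, (∀ j, c j ∈ P.centres ∧
        (Metric.closedBall (c j) K⁻¹ ∩ Metric.closedBall 0 1).Nonempty ∧ s j ∈ Ω) ∧
        CellsTransverse T.phase (tsupport T.amp) ρ ν y s ∧
        T.broadMu P p k 1 f xbar ≤ ∫⁻ x in Metric.closedBall xbar (K ^ 2),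
          2 * (ENNReal.ofReal (2 * Ω.card) *
            ‖meanOp (fun j => S y (s j)) (fun j => cellPiece P cell (c j) (s j) f) x‖ₑ) ^ p := by
  have hK0 : 0 < K := by linarith
  have hlam : 0 < T.scale := by linarith [T.one_le_scale]
  have hA0 : 0 ≤ A := (abs_nonneg _).trans (hA 0)
  have hE0 : 0 ≤ E := le_trans (by positivity) hE
  obtain ⟨hv0, hvt⟩ := volume_closedBall_ne xbar (show 0 < K ^ 2 by positivity)
  have h2v0 := mul_ne_zero two_ne_zero hv0
  have h2vt : 2 * volume (Metric.closedBall xbar (K ^ 2)) ≠ ∞ :=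
    ENNReal.mul_ne_top ENNReal.ofNat_ne_top hvt
  have hμt : T.broadMu P p k 1 f xbar ≠ ∞ := by
    refine ne_top_of_le_ne_top ?_ (broadMu_le hp hkd hA hf xbar)
    exact ENNReal.mul_ne_top (ENNReal.rpow_ne_top_of_nonneg hp.le ENNReal.ofReal_ne_top) hvt
  -- The height `q` of the broad quantity; the factor `2` is the one lost in passing from an
  -- integral to a value at a point.
  obtain ⟨q, hq0, hq⟩ : ∃ q : ℝ, 0 ≤ q ∧
      2 * volume (Metric.closedBall xbar (K ^ 2)) * ENNReal.ofReal q ^ p =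
        T.broadMu P p k 1 f xbar := by
    refine ⟨((T.broadMu P p k 1 f xbar /
      (2 * volume (Metric.closedBall xbar (K ^ 2)))) ^ p⁻¹).toReal, ENNReal.toReal_nonneg, ?_⟩
    rw [ENNReal.ofReal_toReal (ENNReal.rpow_ne_top_of_nonneg (inv_nonneg.2 hp.le)
      (ENNReal.div_lt_top hμt h2v0).ne), ENNReal.rpow_inv_rpow hp.ne',
      ENNReal.mul_div_cancel h2v0 h2vt]
  have hint : ∀ B : ℝ≥0∞, ∫⁻ _ in Metric.closedBall xbar (K ^ 2), 2 * B ^ p =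
      2 * volume (Metric.closedBall xbar (K ^ 2)) * B ^ p := fun B => by
    rw [setLIntegral_const]
    ring
  have hl1 := l1Norm_nonneg f
  -- The threshold is twice the total error over the cells, so that above it the error of the
  -- separation of variables can be absorbed into `q`.
  by_cases hqE : q ≤ 2 * Ω.card * (E * l1Norm f)
  · left
    rw [hint, ← hq]
    gcongr
  right
  rw [not_le] at hqE
  have hqE' : Ω.card * (A * (K ^ 2 / T.scale) ^ N * l1Norm f) < q := by
    have h1 : Ω.card * (A * (K ^ 2 / T.scale) ^ N * l1Norm f) ≤ Ω.card * (E * l1Norm f) := by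
      gcongr
    have h2 : 0 ≤ Ω.card * (E * l1Norm f) := by positivity
    linarith
  obtain ⟨c, s, ω, hsel, hdet⟩ := exists_transverse_caps hK hp hkd hA hAN hf hcell hΩ hq hqE'
  have hω1 : ∀ j, ω j ∈ Metric.closedBall (0 : Freq d) 1 := fun j =>
    (T.amp_support (hsel j).2.2.2.1).2
  refine ⟨c, s, fun j => ⟨(hsel j).1, ⟨ω j, (hsel j).2.1, hω1 j⟩, ?_⟩,
    htr ω s (fun j => ?_) (fun j => (hsel j).2.2.2.1) hdet, ?_⟩
  · rw [← (hsel j).2.2.1]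
    exact hΩ _ (hω1 j)
  · rw [← (hsel j).2.2.1]
    exact hcellρ _
  rw [← hq, ← hint]
  refine setLIntegral_mono' Metric.isClosed_closedBall.measurableSet fun x hx => ?_
  have hx' : T.scale⁻¹ • x ∈ Metric.closedBall y ρ := by
    rw [Metric.mem_closedBall, dist_eq_norm] at hx
    have h1 : dist (T.scale⁻¹ • x) (T.scale⁻¹ • xbar) ≤ ρ / 2 := by
      rw [dist_eq_norm, ← smul_sub, norm_smul, norm_inv, Real.norm_of_nonneg hlam.le,
        inv_mul_eq_div]
      exact (div_le_div_of_nonneg_right hx hlam.le).trans hKρ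
    rw [Metric.mem_closedBall]
    linarith [dist_triangle (T.scale⁻¹ • x) (T.scale⁻¹ • xbar) y]
  have hG0 : ∀ j, 0 ≤ ∑ i, ‖(S y (s j) i).op (cellPiece P cell (c j) (s j) f) x‖ := fun j =>
    Finset.sum_nonneg fun i _ => norm_nonneg _
  -- The `j`-th piece is large at a point `x'` which depends on `j`. Separation of variables with `v
  -- = x' - x` transfers this to the arbitrary common point `x` of the ball.
  have hqG : ∀ j, q ≤ 2 * Ω.card *
      ∑ i, ‖(S y (s j) i).op (cellPiece P cell (c j) (s j) f) x‖ := by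
    intro j
    obtain ⟨hcj, -, hsj, -, x', hx'B, hqx'⟩ := hsel j
    have hv : ‖x' - x‖ ≤ 2 * K ^ 2 := by
      rw [Metric.mem_closedBall] at hx hx'B
      rw [← dist_eq_norm]
      linarith [dist_triangle_right x' x xbar]
    have h1 := hS y (s j) x (x' - x) (cellPiece P cell (c j) (s j) f) hx' hv
      (integrableOn_of_memLp (memLp_cellPiece (hcell _) hcj hf)) fun w hw => by
        rw [Metric.mem_closedBall, ← (of_cellPiece_ne_zero hcj hw).1]
        exact hcellρ w
    rw [add_sub_cancel] at h1
    have h2 : l1Norm (cellPiece P cell (c j) (s j) f) ≤ l1Norm f :=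
      l1Norm_mono (integrableOn_of_memLp hf) fun w hw => norm_cellPiece_le hcj f hw
    have h3 := mul_le_mul_of_nonneg_left h2 hE0
    have h4 := mul_le_mul_of_nonneg_left (h1.trans (add_le_add_right h3 _))
      (Nat.cast_nonneg (α := ℝ) Ω.card)
    linarith
  have h5 := le_mul_prod_rpow hk hq0 (by positivity) hG0 hqG
  gcongr
  rw [← ofReal_norm (meanOp _ _ x), ← ENNReal.ofReal_mul (by positivity), meanOp,
    Real.norm_of_nonneg (Finset.prod_nonneg fun j _ => Real.rpow_nonneg (hG0 j) _)]
  exact ENNReal.ofReal_le_ofReal h5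

theorem continuous_meanOp {k : ℕ} {ι : Fin k → Type} [∀ j, Fintype (ι j)]
    (S : ∀ j, ι j → HormanderOperator d) {g : Fin k → Freq d → ℂ}
    (hg : ∀ j, MemLp (g j) 2 (volume.restrict (Metric.closedBall 0 1))) :
    Continuous (meanOp S g) :=
  continuous_finsetProd _ fun j _ => (continuous_finsetSum _ fun i _ =>
    (continuous_op_of_memLp (S j i) (hg j)).norm).rpow_const fun _ =>
      .inr (one_div_nonneg.2 (Nat.cast_nonneg _))

end PerBall

/-! ### Summation over the balls -/

section Summation

/-- For `p ≥ 1` the `p`-th root is subadditive and does not increase a number `≥ 1`. All constants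
are therefore free of `p`; this is why `v ≥ 1` is asked for and why `M + 1` replaces `M`, which may
be `0`. -/
theorem rpow_lintegral_add_sum_le {α τ : Type*} [MeasurableSpace α] {μ : Measure α} {p : ℝ}
    (hp : 1 ≤ p) {M : ℕ} {v : ℝ≥0∞} (hv1 : 1 ≤ v) (hv : μ univ ≤ v) (e a : ℝ≥0∞) (U : Finset τ)
    {g : τ → α → ℝ} (hg : ∀ t ∈ U, Measurable (g t)) :
    (M * ∫⁻ x, (2 * e ^ p + ∑ t ∈ U, 2 * (a * ‖g t x‖ₑ) ^ p) ∂μ) ^ (1 / p) ≤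
      2 * (M + 1) * (e * v + ∑ t ∈ U, a * eLpNorm (g t) (ENNReal.ofReal p) μ) := by
  have hp0 : 0 < p := by linarith
  have hp1 : 1 / p ≤ 1 := by
    rw [div_le_one hp0]
    exact hp
  have hp1' : 0 < 1 / p := by positivity
  have hroot : ∀ x : ℝ≥0∞, 1 ≤ x → x ^ (1 / p) ≤ x := fun x hx => by
    simpa using ENNReal.rpow_le_rpow_of_exponent_le hx hp1
  have hpow : ∀ x : ℝ≥0∞, (x ^ p) ^ (1 / p) = x := fun x => by
    rw [one_div, ENNReal.rpow_rpow_inv hp0.ne']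
  have hM : (M : ℝ≥0∞) ^ (1 / p) ≤ M + 1 :=
    (ENNReal.rpow_le_rpow le_self_add hp1'.le).trans (hroot _ le_add_self)
  have h2 : (2 : ℝ≥0∞) ^ (1 / p) ≤ 2 := hroot _ one_le_two
  have hterm : ∀ t ∈ U, ∫⁻ x, 2 * (a * ‖g t x‖ₑ) ^ p ∂μ =
      2 * (a * eLpNorm (g t) (ENNReal.ofReal p) μ) ^ p := by
    intro t ht
    have h3 := hg t ht
    simp only [ENNReal.mul_rpow_of_nonneg _ _ hp0.le]
    rw [lintegral_const_mul _ (by fun_prop), lintegral_const_mul _ (by fun_prop),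
      eLpNorm_eq_lintegral_rpow_enorm_toReal (by simpa using hp0) ENNReal.ofReal_ne_top,
      ENNReal.toReal_ofReal hp0.le, one_div, ENNReal.rpow_inv_rpow hp0.ne']
  rw [ENNReal.mul_rpow_of_nonneg _ _ hp1'.le, lintegral_add_left measurable_const,
    lintegral_finsetSum _ (by fun_prop (disch := assumption)), lintegral_const]
  rw [Finset.sum_congr rfl hterm]
  calc _ ≤ (M + 1) * ((2 * e ^ p * v) ^ (1 / p) +
        ∑ t ∈ U, (2 * (a * eLpNorm (g t) (ENNReal.ofReal p) μ) ^ p) ^ (1 / p)) := by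
        refine mul_le_mul' hM ((ENNReal.rpow_add_le_add_rpow _ _ hp1'.le hp1).trans
          (add_le_add ?_ (ennreal_sum_rpow_le _ _ hp1' hp1)))
        gcongr
    _ ≤ (M + 1) * (2 * e * v + ∑ t ∈ U, 2 * (a * eLpNorm (g t) (ENNReal.ofReal p) μ)) := by
        gcongr with t ht
        · rw [ENNReal.mul_rpow_of_nonneg _ _ hp1'.le, ENNReal.mul_rpow_of_nonneg _ _ hp1'.le, hpow]
          gcongr
          exact hroot v hv1
        · rw [ENNReal.mul_rpow_of_nonneg _ _ hp1'.le, hpow]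
          gcongr
    _ = _ := by
        rw [← Finset.mul_sum]
        ring

theorem ncard_filter_le {α : Type*} (Z : Finset α) (q r : α → Prop) [DecidablePred q] :
    {c | c ∈ Z.filter q ∧ r c}.ncard ≤ {c | c ∈ Z ∧ r c}.ncard :=
  Set.ncard_le_ncard (t := {c | c ∈ Z ∧ r c}) (fun _ hc => ⟨(Finset.mem_filter.1 hc.1).1, hc.2⟩)
    (Z.finite_toSet.subset fun _ hc => hc.1)

open Classical in
/-- The broad norm is dominated by multilinear averages over the transverse tuples of cells, up to
a negligible term. -/
theorem exists_broadNorm_le {T : HormanderOperator d} {K : ℝ} {M : ℕ}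
    {P : CapDecomposition d K M} (Q : SpatialCover d T.scale K M) (hK : 1 ≤ K) {p : ℝ} (hp : 1 ≤ p)
    {k : ℕ} (hk : k ≠ 0) (hkd : k ≤ d + 1) {A : ℝ} (hA : ∀ z, |T.amp z| ≤ A) {N : ℕ}
    (hAN : ∀ z, ‖iteratedFDeriv ℝ N T.amp z‖ ≤ A) {f : Freq d → ℂ}
    (hf : MemLp f 2 (volume.restrict (Metric.closedBall 0 1))) {ρ ν E : ℝ}
    {cell : Freq d → Freq d} {Ω : Finset (Freq d)} (hcell : ∀ s, MeasurableSet {ω | cell ω = s})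
    (hΩ : ∀ ω ∈ Metric.closedBall (0 : Freq d) 1, cell ω ∈ Ω)
    (hcellρ : ∀ ω, dist ω (cell ω) ≤ ρ) (hKρ : K ^ 2 / T.scale ≤ ρ / 2)
    (hE : A * (K ^ 2 / T.scale) ^ N ≤ E) {ι : Space d → Freq d → Type} [∀ y s, Fintype (ι y s)]
    {S : ∀ y s, ι y s → HormanderOperator d}
    (hS : ∀ (y : Space d) (s : Freq d) (x v : Space d) (g : Freq d → ℂ),
      T.scale⁻¹ • x ∈ Metric.closedBall y ρ → ‖v‖ ≤ 2 * K ^ 2 →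
      IntegrableOn g (Metric.closedBall (0 : Freq d) 1) →
      (∀ ω, g ω ≠ 0 → ω ∈ Metric.closedBall s ρ) →
      ‖T.op g (x + v)‖ ≤ ∑ i, ‖(S y s i).op g x‖ + E * l1Norm g)
    {xcell : Space d → Space d} {Ξ : Finset (Space d)}
    (hΞ : ∀ x ∈ Metric.closedBall (0 : Space d) 1, xcell x ∈ Ξ)
    (hxcell : ∀ x, dist x (xcell x) ≤ ρ / 2)
    (htr : ∀ (x y : Space d) (ω s : Fin k → Freq d), dist x y ≤ ρ / 2 →
      (∀ j, dist (ω j) (s j) ≤ ρ) → (∀ j, (x, ω j) ∈ tsupport T.amp) → ((K⁻¹ / 2) ^ 2) ^ k ≤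
        (Matrix.gram ℝ fun j => gauss T.phase x (ω j)).det →
      CellsTransverse T.phase (tsupport T.amp) ρ ν y s)
    {v : ℝ≥0∞} (hv1 : 1 ≤ v) {y₀ : Space d} {R : ℝ}
    (hv : volume (Metric.closedBall y₀ (R + 2 * K ^ 2)) ≤ v) :
    ∃ U : Finset (Space d × (Fin k → Freq d) × (Fin k → Freq d)),
      (U.card : ℝ) ≤ Ξ.card * ((M * (3 * K) ^ d) ^ k * Ω.card ^ k) ∧
      (∀ t ∈ U, (∀ j, t.2.1 j ∈ P.centres) ∧
        CellsTransverse T.phase (tsupport T.amp) ρ ν t.1 t.2.2) ∧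
      T.broadNorm P Q p k 1 f (Metric.closedBall y₀ R) ≤
        2 * (M + 1) * (ENNReal.ofReal (2 * Ω.card * (E * l1Norm f)) * v +
          ∑ t ∈ U, ENNReal.ofReal (2 * Ω.card) * eLpNorm (meanOp (fun j => S t.1 (t.2.2 j))
            (fun j => cellPiece P cell (t.2.1 j) (t.2.2 j) f)) (ENNReal.ofReal p)
            (volume.restrict (Metric.closedBall y₀ (R + 2 * K ^ 2)))) := by
  have hp0 : 0 < p := by linarith
  have hK0 : 0 < K := by linarith
  have hlam : 0 < T.scale := by linarith [T.one_le_scale]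
  set Γ := P.centres.filter fun c =>
    (Metric.closedBall c K⁻¹ ∩ Metric.closedBall 0 1).Nonempty with hΓ
  have hΓcard : (Γ.card : ℝ) ≤ M * (3 * K) ^ d := by
    have h1 := card_le_of_overlap Γ (inv_pos.2 hK0) (inv_le_one_of_one_le₀ hK) (M := M)
      (fun ω => (ncard_filter_le _ _ _).trans (P.overlap ω))
      fun c hc => (Finset.mem_filter.1 hc).2
    rwa [div_inv_eq_mul] at h1
  set U : Finset (Space d × (Fin k → Freq d) × (Fin k → Freq d)) :=
    (Ξ ×ˢ (Fintype.piFinset fun _ => Γ) ×ˢ (Fintype.piFinset fun _ => Ω)).filter fun t =>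
      CellsTransverse T.phase (tsupport T.amp) ρ ν t.1 t.2.2 with hU
  have hmem : ∀ t ∈ U, (∀ j, t.2.1 j ∈ P.centres) ∧
      CellsTransverse T.phase (tsupport T.amp) ρ ν t.1 t.2.2 := by
    intro t ht
    rw [hU, Finset.mem_filter, Finset.mem_product, Finset.mem_product, Fintype.mem_piFinset] at ht
    exact ⟨fun j => (Finset.mem_filter.1 (ht.1.2.1 j)).1, ht.2⟩
  refine ⟨U, ?_, hmem, ?_⟩
  · have h1 : U.card ≤ Ξ.card * (Γ.card ^ k * Ω.card ^ k) := by
      refine (Finset.card_filter_le _ _).trans (le_of_eq ?_)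
      simp [Finset.card_product, Fintype.card_piFinset]
    calc (U.card : ℝ) ≤ Ξ.card * (Γ.card ^ k * Ω.card ^ k) := by exact_mod_cast h1
      _ ≤ _ := by gcongr
  set g : Space d × (Fin k → Freq d) × (Fin k → Freq d) → Space d → ℝ := fun t =>
    meanOp (fun j => S t.1 (t.2.2 j)) fun j => cellPiece P cell (t.2.1 j) (t.2.2 j) f with hg
  have hgm : ∀ t ∈ U, Measurable (g t) := fun t ht => (continuous_meanOp _ fun j =>
    memLp_cellPiece (hcell _) ((hmem t ht).1 j) hf).measurable
  -- One integrand that dominates on every ball, whichever alternative and whichever tuple occurs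
  -- there. Only then can the sum over the balls be replaced by a single integral using their finite
  -- overlap.
  set h : Space d → ℝ≥0∞ := fun x => 2 * ENNReal.ofReal (2 * Ω.card * (E * l1Norm f)) ^ p +
    ∑ t ∈ U, 2 * (ENNReal.ofReal (2 * Ω.card) * ‖g t x‖ₑ) ^ p with hh
  have hhm : Measurable h := by
    refine measurable_const.add (Finset.measurable_fun_sum _ fun t ht => ?_)
    have := hgm t ht
    fun_prop
  have hball : ∀ xbar ∈ Q.centres, T.broadMu P p k 1 f xbar ≤
      ∫⁻ x in Metric.closedBall xbar (K ^ 2), h x := by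
    intro xbar hx
    have hx1 : T.scale⁻¹ • xbar ∈ Metric.closedBall (0 : Space d) 1 := by
      have h1 := mem_closedBall_zero_iff.1 (Q.centred xbar hx)
      rw [mem_closedBall_zero_iff, norm_smul, norm_inv, Real.norm_of_nonneg hlam.le,
        inv_mul_le_one₀ hlam]
      exact h1
    rcases broadMu_le_lintegral hK hp0 hk hkd hA hAN hf hcell hΩ hcellρ hKρ hE hS (hxcell _)
      (htr _ _ · · (hxcell _)) with h1 | ⟨c, s, hcs, hν, h1⟩
    · exact h1.trans (lintegral_mono fun x => le_self_add)
    · refine h1.trans (lintegral_mono fun x => le_add_of_nonneg_of_le zero_le ?_)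
      refine Finset.single_le_sum (f := fun t =>
        2 * (ENNReal.ofReal (2 * Ω.card) * ‖g t x‖ₑ) ^ p) (fun _ _ => zero_le)
        (a := (xcell (T.scale⁻¹ • xbar), c, s)) ?_
      rw [hU, Finset.mem_filter, Finset.mem_product, Finset.mem_product, Fintype.mem_piFinset,
        Fintype.mem_piFinset]
      exact ⟨⟨hΞ _ hx1, fun j => Finset.mem_filter.2 ⟨(hcs j).1, (hcs j).2.1⟩,
        fun j => (hcs j).2.2⟩, hν⟩
  refine le_trans ?_ (rpow_lintegral_add_sum_le (μ := volume.restrict _) hp hv1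
    (by rwa [Measure.restrict_apply_univ]) _ _ U hgm)
  refine ENNReal.rpow_le_rpow ?_ (by positivity)
  refine (Finset.sum_le_sum fun c hc => hball c (Finset.mem_filter.1 hc).1).trans ?_
  refine sum_lintegral_closedBall_le _ (fun x => ?_) Metric.isClosed_closedBall.measurableSet
    (fun c hc => ?_) hhm
  · exact (ncard_filter_le _ _ _).trans (Q.overlap x)
  · obtain ⟨w, hw, hw'⟩ := (Finset.mem_filter.1 hc).2
    intro x hx
    rw [Metric.mem_closedBall] at *
    linarith [dist_triangle4_right x y₀ c w, dist_triangle4 x c w y₀, dist_comm c w]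

end Summation

end HormanderOp

/-! ### Collecting the powers of `K` -/

namespace HormanderOp

variable {d : ℕ}

/-- The multilinear average over a transverse tuple of cells. -/
theorem eLpNorm_meanOp_le {k : ℕ} (hk : k ≠ 0) {𝒯 : Set (HormanderOperator d)}
    {p ε C₀ R₀ C : ℝ} (hp : 1 ≤ p) (hε : 0 < ε) {N₀ : ℕ} {φ : Space d × Freq d → ℝ}
    (hML : MultilinearBound 𝒯 p ε C₀ R₀ N₀ (fun _ : Fin k => φ) C) {ι : Fin k → Type}
    [∀ j, Fintype (ι j)] {S : ∀ j, ι j → HormanderOperator d} {β : ∀ j, ι j → ℝ} {lam : ℝ}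
    (hS : ∀ j i, S j i ∈ 𝒯 ∧ (S j i).phase = φ ∧ (S j i).scale = lam) (hβ0 : ∀ j i, 0 ≤ β j i)
    (hβ : ∀ j i, ampNorm N₀ (S j i).amp ≤ ENNReal.ofReal (β j i)) {c Λ : ℝ} (hc : 0 ≤ c)
    (hΛ : 0 ≤ Λ) (hsum : ∀ j, ∑ i, β j i ^ (1 / (k : ℝ)) ≤ c * Λ ^ (1 / (k : ℝ)))
    {g : Fin k → Freq d → ℂ}
    (hg : ∀ j, MemLp (g j) 2 (volume.restrict (Metric.closedBall 0 1))) {L : ℝ≥0∞}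
    (hgL : ∀ j, HormanderOperator.l2Norm (g j) ≤ L) {ν R K : ℝ} (y : Space d) (hν0 : 0 < ν)
    (hν1 : ν ≤ 1)
    (hν : ∀ i : ∀ j, ι j, HormanderOperator.Transverse (fun j => S j (i j)) ν)
    (hR : 1 ≤ R) (hRlam : R ≤ lam) (hK : 1 ≤ K) (hR₀ : R₀ ≤ lam) :
    eLpNorm (meanOp S g) (ENNReal.ofReal p)
        (volume.restrict (Metric.closedBall y (R + 2 * K ^ 2))) ≤
      ENNReal.ofReal (max C 0 * ν ^ (-C₀) * ((3 + |R₀|) * K ^ 2 * R) ^ ε * (c ^ k * Λ)) * L := by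
  have hk0 : 0 ≤ 1 / (k : ℝ) := one_div_nonneg.2 (Nat.cast_nonneg _)
  have hR0 : 0 ≤ (3 + |R₀|) * K ^ 2 * R := by positivity
  refine (eLpNorm_prod_sum_rpow_le hk (ENNReal.one_le_ofReal.2 hp)
    (fun j i x => norm_nonneg ((S j i).op (g j) x))
    (fun j i => (continuous_op_of_memLp (S j i) (hg j)).norm.aestronglyMeasurable)
    (c := ENNReal.ofReal (max C 0 * ν ^ (-C₀) * ((3 + |R₀|) * K ^ 2 * R) ^ ε))
    (b := fun j i => (ENNReal.ofReal (β j i) * L) ^ (1 / (k : ℝ))) fun i => ?_).trans ?_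
  · refine (eLpNorm_prod_op_le_of_multilinear hk hε hML y (fun j => hS j (i j)) hν0 hν1 (hν i) hR
      hRlam hK hR₀ hg).trans ?_
    gcongr with j _
    · exact hβ j (i j)
    · exact hgL j
  -- The sum has the form of a `k`-th root, so the product over the `k` factors restores one full
  -- power of `Λ` and of `L`.
  have hj : ∀ j, ∑ i, (ENNReal.ofReal (β j i) * L) ^ (1 / (k : ℝ)) ≤
      (ENNReal.ofReal (c ^ k * Λ) * L) ^ (1 / (k : ℝ)) := by
    intro j
    simp_rw [ENNReal.mul_rpow_of_nonneg _ _ hk0, ← Finset.sum_mul,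
      fun i => ENNReal.ofReal_rpow_of_nonneg (hβ0 j i) hk0]
    rw [ENNReal.ofReal_rpow_of_nonneg (by positivity) hk0,
      ← ENNReal.ofReal_sum_of_nonneg fun i _ => Real.rpow_nonneg (hβ0 j i) _,
      Real.mul_rpow (by positivity) hΛ, one_div, Real.pow_rpow_inv_natCast hc hk, ← one_div]
    gcongr
    exact hsum j
  rw [ENNReal.ofReal_mul (mul_nonneg (mul_nonneg (le_max_right _ _) (Real.rpow_nonneg hν0.le _))
    (Real.rpow_nonneg hR0 _)), mul_assoc (ENNReal.ofReal _)]
  refine mul_le_mul_right ?_ _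
  refine (Finset.prod_le_prod' fun j _ => hj j).trans (le_of_eq ?_)
  rw [Finset.prod_const, Finset.card_univ, Fintype.card_fin, ← ENNReal.rpow_natCast,
    ← ENNReal.rpow_mul, one_div_mul_cancel (Nat.cast_ne_zero.2 hk), ENNReal.rpow_one]

/-- The trivial bound for the broad norm. -/
theorem broadNorm_le_trivial {T : HormanderOperator d} {K : ℝ} {M : ℕ}
    {P : CapDecomposition d K M} (Q : SpatialCover d T.scale K M) {p : ℝ} (hp : 1 ≤ p)
    {k : ℕ} (hkd : k ≤ d + 1) {A : ℝ} (hA : ∀ z, |T.amp z| ≤ A) {f : Freq d → ℂ}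
    (hf : MemLp f 2 (volume.restrict (Metric.closedBall 0 1))) {v : ℝ≥0∞} (hv1 : 1 ≤ v)
    {y₀ : Space d} {R : ℝ} (hv : volume (Metric.closedBall y₀ (R + 2 * K ^ 2)) ≤ v) :
    T.broadNorm P Q p k 1 f (Metric.closedBall y₀ R) ≤
      2 * (M + 1) * (ENNReal.ofReal (A * l1Norm f) * v) := by
  classical
  have h1 := rpow_lintegral_add_sum_le (M := M) (τ := Unit) (g := fun _ _ => 0)
    (μ := volume.restrict (Metric.closedBall y₀ (R + 2 * K ^ 2))) hp hv1
    (by rwa [Measure.restrict_apply_univ]) (ENNReal.ofReal (A * l1Norm f)) 0 ∅ (by simp)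
  simp only [Finset.sum_empty, add_zero] at h1
  refine le_trans (ENNReal.rpow_le_rpow ?_ (by positivity)) h1
  refine le_trans (Finset.sum_le_sum fun c _ => ?_)
    (sum_lintegral_closedBall_le (r := K ^ 2) _ (fun x => ?_)
      Metric.isClosed_closedBall.measurableSet (fun c hc => ?_) measurable_const)
  · refine (broadMu_le (by linarith) hkd hA hf c).trans ?_
    rw [setLIntegral_const]
    gcongr
    exact le_mul_of_one_le_left zero_le one_le_two
  · exact (ncard_filter_le _ _ _).trans (Q.overlap x)
  · obtain ⟨w, hw, hw'⟩ := (Finset.mem_filter.1 hc).2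
    intro x hx
    rw [Metric.mem_closedBall] at *
    linarith [dist_triangle4 x c w y₀, dist_comm c w]

theorem rpow_neg_le_pow {K : ℝ} (hK : 1 ≤ K) (k : ℕ) (C₀ : ℝ) :
    ((2 * (2 * K) ^ k)⁻¹ : ℝ) ^ (-C₀) ≤
      (2 * 2 ^ k) ^ ⌈|C₀|⌉₊ * K ^ (k * ⌈|C₀|⌉₊) := by
  have h1 : (1 : ℝ) ≤ 2 * (2 * K) ^ k := by
    have := one_le_pow₀ (n := k) (show (1 : ℝ) ≤ 2 * K by linarith)
    linarith
  rw [Real.inv_rpow (by linarith), ← Real.rpow_neg (by linarith), neg_neg]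
  calc (2 * (2 * K) ^ k) ^ C₀ ≤ (2 * (2 * K) ^ k) ^ (⌈|C₀|⌉₊ : ℝ) :=
        Real.rpow_le_rpow_of_exponent_le h1 ((le_abs_self _).trans (Nat.le_ceil _))
    _ = _ := by
        rw [Real.rpow_natCast]
        ring

theorem mul_rpow_le_pow {K R c ε : ℝ} (hK : 1 ≤ K) (hR : 1 ≤ R) (hc : 0 ≤ c) :
    (c * K ^ 2 * R) ^ ε ≤ c ^ ε * K ^ (2 * ⌈ε⌉₊) * R ^ ε := by
  have h1 : (1 : ℝ) ≤ K ^ 2 := one_le_pow₀ hK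
  rw [Real.mul_rpow (by positivity) (by positivity), Real.mul_rpow hc (by positivity)]
  have h2 : (K ^ 2) ^ ε ≤ K ^ (2 * ⌈ε⌉₊) := by
    rw [pow_mul, ← Real.rpow_natCast (K ^ 2)]
    exact Real.rpow_le_rpow_of_exponent_le h1 (Nat.le_ceil _)
  have h3 : 0 ≤ c ^ ε := Real.rpow_nonneg hc _
  have h4 : 0 ≤ R ^ ε := Real.rpow_nonneg (by linarith) _
  gcongr

/-- In the application, `D` is the number of frequency cells, `EV` the error of the expansion times
the volume, `U` the number of tuples, `Y` the multilinear bound for one tuple and `r` is `R ^ ε`.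
Each is polynomial in `K`, and the exponents are simply added. -/
theorem combine_polynomial_bounds {K r A D EV U Y m l cD cE cU cY : ℝ} {a b c e : ℕ} (hK : 1 ≤ K)
    (hr : 1 ≤ r) (hA : 0 ≤ A) (hm : 0 ≤ m) (hl : 0 ≤ l) (hD0 : 0 ≤ D) (hU0 : 0 ≤ U) (hEV0 : 0 ≤ EV) (hY0 : 0 ≤ Y)
    (hcE : 0 ≤ cE) (hcY : 0 ≤ cY) (hD : D ≤ cD * K ^ a)
    (hEV : EV ≤ cE * K ^ b * A) (hU : U ≤ cU * K ^ c) (hY : Y ≤ cY * K ^ e * r * A) :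
    m * (2 * D * EV * l + U * (2 * D) * Y) ≤
      m * (2 * cD * cE * l + 2 * cU * cD * cY) * K ^ (a + b + c + e) * r * A := by
  have hK0 : 0 ≤ K := by linarith
  have hcD : 0 ≤ cD * K ^ a := hD0.trans hD
  have hcU : 0 ≤ cU * K ^ c := hU0.trans hU
  have hcD0 : 0 ≤ cD := nonneg_of_mul_nonneg_left hcD (by positivity)
  have hcU0 : 0 ≤ cU := nonneg_of_mul_nonneg_left hcU (by positivity)
  have h1 : 2 * D * EV * l ≤ 2 * (cD * K ^ a) * (cE * K ^ b * A) * l := by gcongr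
  have h2 : U * (2 * D) * Y ≤ (cU * K ^ c) * (2 * (cD * K ^ a)) * (cY * K ^ e * r * A) := by
    gcongr
  have h3 : 2 * (cD * K ^ a) * (cE * K ^ b * A) * l ≤
      2 * cD * cE * l * (K ^ (a + b + c + e) * r * A) := by
    have h4 : K ^ (a + b) * 1 * A ≤ K ^ (a + b + c + e) * r * A := by
      have h5 : K ^ (a + b) ≤ K ^ (a + b + c + e) := pow_le_pow_right₀ hK (by omega)
      gcongr
    calc _ = 2 * cD * cE * l * (K ^ (a + b) * 1 * A) := by ring
      _ ≤ _ := by gcongr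
  have h4 : (cU * K ^ c) * (2 * (cD * K ^ a)) * (cY * K ^ e * r * A) ≤
      2 * cU * cD * cY * (K ^ (a + b + c + e) * r * A) := by
    have h4 : K ^ (a + c + e) * r * A ≤ K ^ (a + b + c + e) * r * A := by
      have h5 : K ^ (a + c + e) ≤ K ^ (a + b + c + e) := pow_le_pow_right₀ hK (by omega)
      gcongr
    calc _ = 2 * cU * cD * cY * (K ^ (a + c + e) * r * A) := by ring
      _ ≤ _ := by gcongr
  calc _ ≤ m * (2 * cD * cE * l * (K ^ (a + b + c + e) * r * A) +
        2 * cU * cD * cY * (K ^ (a + b + c + e) * r * A)) :=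
        mul_le_mul_of_nonneg_left (by linarith) hm
    _ = _ := by ring

end HormanderOp

/-! ### Large and small scales, and the proposition -/

namespace HormanderOp

variable {d : ℕ}

/-- The power of `K` which is lost in the passage from multilinear to broad estimates. -/
def broadExponent (d k N₀ : ℕ) (C₀ ε : ℝ) : ℕ :=
  2 * k * d + (4 * d + 6) + (2 * k * (d + 1) + (d * k + 2 * k * d * k)) +
    (k * ⌈|C₀|⌉₊ + 2 * ⌈ε⌉₊ + 2 * k * (N₀ + 1))

theorem volume_closedBall_add_le {Cv : ℝ} (hCv1 : 1 ≤ Cv)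
    (hCv : ∀ (y : Space d) (r : ℝ), 0 ≤ r →
      volume (Metric.closedBall y r) ≤ ENNReal.ofReal (Cv * r ^ (d + 1)))
    {K lam R : ℝ} (hK : 1 ≤ K) (hR : 0 ≤ R) (hRlam : R ≤ lam) (hlam : 1 ≤ lam) (y : Space d) :
    1 ≤ ENNReal.ofReal (Cv * (3 * (lam * K ^ 2)) ^ (d + 1)) ∧
      volume (Metric.closedBall y (R + 2 * K ^ 2)) ≤
        ENNReal.ofReal (Cv * (3 * (lam * K ^ 2)) ^ (d + 1)) := by
  have hK2 : 1 ≤ K ^ 2 := one_le_pow₀ hK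
  have h1 : lam ≤ lam * K ^ 2 := le_mul_of_one_le_right (by linarith) hK2
  have h2 : K ^ 2 ≤ lam * K ^ 2 := le_mul_of_one_le_left (by linarith) hlam
  refine ⟨ENNReal.one_le_ofReal.2
    (one_le_mul_of_one_le_of_one_le hCv1 (one_le_pow₀ (by linarith))), ?_⟩
  refine (hCv y _ (by positivity)).trans (ENNReal.ofReal_le_ofReal ?_)
  gcongr
  linarith

theorem card_bound_eq (b c m K : ℝ) (d k : ℕ) :
    (5 * (d + 2) * (2 * (b * K ^ (2 * k)))) ^ (d + 1) *
        ((m * (3 * K) ^ d) ^ k * (c * K ^ (2 * k * d)) ^ k) =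
      (5 * (d + 2) * (2 * b)) ^ (d + 1) * ((m * 3 ^ d) ^ k * c ^ k) *
        K ^ (2 * k * (d + 1) + (d * k + 2 * k * d * k)) := by
  simp only [mul_pow, ← pow_mul]
  ring

theorem mult_bound_eq (m t c b K r s A : ℝ) (k a e N : ℕ) :
    m * (t * K ^ (k * a)) * (r * K ^ (2 * e) * s) * (c ^ k * ((b * K ^ (2 * k)) ^ (N + 1) * A)) =
      m * t * r * (c ^ k * b ^ (N + 1)) * K ^ (k * a + 2 * e + 2 * k * (N + 1)) * s * A := by
  rw [mul_pow, ← pow_mul K, pow_add, pow_add]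
  ring

-- The choice of parameters. For `λ` above a multiple of `K ^ (2 * k + 4)`, a ball of radius `K²`
-- rescales to radius `K² / λ ≤ ρ / 2`, so one spatial cell of size `ρ ~ K^{-2k}` contains it and
-- the whole single-ball argument applies.
set_option maxHeartbeats 1000000 in
theorem exists_broadNorm_le_of_large {k : ℕ} (hk : k ≠ 0) (hkd : k ≤ d + 1)
    {𝒯 : Set (HormanderOperator d)} (h𝒯 : HormanderOperator.ClosedUnderLocalisation 𝒯)
    {p ε C₀ R₀ CM : ℝ} (hp : 1 ≤ p) (hε : 0 < ε) {N₀ : ℕ} {φ : Space d × Freq d → ℝ}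
    (hφ : ∀ z ∈ unitBalls d, ContDiffAt ℝ (⊤ : ℕ∞) φ z)
    (hr : ∀ x ω, (x, ω) ∈ unitBalls d →
      Module.finrank ℝ (LinearMap.range (mixedHessian φ x ω).toLinearMap) = d)
    (hML : MultilinearBound 𝒯 p ε C₀ R₀ N₀ (fun _ : Fin k => φ) CM) (M : ℕ) :
    ∃ Λ C : ℝ, 0 ≤ Λ ∧ 0 ≤ C ∧ ∀ T ∈ 𝒯, T.phase = φ → ∀ (K R : ℝ) (y : Space d)
      (P : CapDecomposition d K M) (Q : SpatialCover d T.scale K M) (f : Freq d → ℂ),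
      1 ≤ K → 1 ≤ R → R ≤ T.scale → MemLp f 2 (volume.restrict (Metric.closedBall 0 1)) →
      Λ * K ^ (2 * k + 4) ≤ T.scale →
      T.broadNorm P Q p k 1 f (Metric.closedBall y R) ≤
        ENNReal.ofReal (C * K ^ broadExponent d k N₀ C₀ ε * R ^ ε) *
          (ampNorm (N₀ + 1 + (d + 1)) T.amp * HormanderOperator.l2Norm f) := by
  obtain ⟨Cs, hCs1, hCs⟩ := exists_separating_localisations d k N₀ hk hφ
  obtain ⟨L, hL0, hL⟩ := exists_gauss_lipschitz hφ hr
  obtain ⟨L', hL'0, hL'⟩ := exists_det_gram_lipschitz (Space d) k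
  obtain ⟨Cv, hCv1, hCv⟩ := exists_volume_closedBall_le d
  obtain ⟨Cl, hCl0, hCl⟩ := exists_l1Norm_le d
  -- The first summand makes `ρ` small enough for the separation of variables; the second makes the
  -- change of the Gram determinant across a cell at most `2ν²`.
  set b : ℝ := Cs + 8 * 4 ^ k * (L' * L) with hb
  have hLL : 0 < 8 * 4 ^ k * (L' * L) := by positivity
  have hb1 : 1 ≤ b := by linarith
  set cD : ℝ := (5 * (d + 1) * b) ^ d with hcD
  set cE : ℝ := Cs * Cv * 3 ^ (d + 1) with hcE
  set cU : ℝ := (5 * (d + 2) * (2 * b)) ^ (d + 1) * ((M * 3 ^ d) ^ k * cD ^ k) with hcU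
  set cY : ℝ := max CM 0 * (2 * 2 ^ k) ^ ⌈|C₀|⌉₊ * (3 + |R₀|) ^ ε * (Cs ^ k * b ^ (N₀ + 1)) with hcY
  have hR₀0 := abs_nonneg R₀
  have hmax : 0 ≤ max CM 0 := le_max_right _ _
  have h3R : 0 ≤ (3 + |R₀|) ^ ε := Real.rpow_nonneg (by positivity) _
  have hcD0 : 0 ≤ cD := by positivity
  have hcE0 : 0 ≤ cE := by positivity
  have hcU0 : 0 ≤ cU := by positivity
  have hcY0 : 0 ≤ cY := by positivity
  refine ⟨2 * b + |R₀|, 2 * (M + 1) * (2 * cD * cE * Cl + 2 * cU * cD * cY), by positivity,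
    by positivity, ?_⟩
  rintro T hT rfl K R y P Q f hK hR hRlam hf hlarge
  have hK0 : 0 < K := by linarith
  have hlam1 := T.one_le_scale
  have hlam0 : 0 < T.scale := by linarith
  obtain ⟨A, hA0, hAeq, hA⟩ := exists_ampNorm_eq T.amp_smooth T.amp_support (N₀ + 1 + (d + 1))
  have hA' : ∀ z, |T.amp z| ≤ A := fun z => by
    rw [← Real.norm_eq_abs, ← norm_iteratedFDeriv_zero (𝕜 := ℝ)]
    exact hA 0 (Nat.zero_le _) z
  set ρ : ℝ := (b * K ^ (2 * k))⁻¹ with hρ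
  have hK2k : 1 ≤ K ^ (2 * k) := one_le_pow₀ hK
  have hbK : 1 ≤ b * K ^ (2 * k) := one_le_mul_of_one_le_of_one_le hb1 hK2k
  have hρ0 : 0 < ρ := inv_pos.2 (by linarith)
  have hρ1 : ρ ≤ 1 := inv_le_one_of_one_le₀ hbK
  -- Half the square root of the Gram determinant bound `(2K)^{-2k}`; the half is given up when
  -- passing from points to cells.
  set ν : ℝ := (2 * (2 * K) ^ k)⁻¹ with hν
  have h2K : (1 : ℝ) ≤ (2 * K) ^ k := one_le_pow₀ (by linarith)
  have hν0 : 0 < ν := inv_pos.2 (by linarith)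
  have hν1 : ν ≤ 1 := inv_le_one_of_one_le₀ (by linarith)
  have hKpow : ∀ m ≤ 2 * k + 4, K ^ m ≤ K ^ (2 * k + 4) := fun m hm => pow_le_pow_right₀ hK hm
  have hKρ : Cs * (K ^ 2 * ρ) ≤ 1 := by
    have h1 : K ^ 2 ≤ K ^ (2 * k) := pow_le_pow_right₀ hK (by omega)
    rw [hρ, ← mul_assoc, ← div_eq_mul_inv, div_le_one (by linarith)]
    exact mul_le_mul (by linarith) h1 (by positivity) (by linarith)
  have hRK : |R₀| ≤ |R₀| * K ^ (2 * k + 4) := le_mul_of_one_le_right hR₀0 (one_le_pow₀ hK)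
  have hbpos : 0 ≤ b * K ^ (2 * k + 4) := by positivity
  have hKlam : Cs * K ^ 4 ≤ T.scale := by
    have h1 : Cs * K ^ 4 ≤ b * K ^ (2 * k + 4) :=
      mul_le_mul (by linarith) (hKpow 4 (by omega)) (by positivity) (by linarith)
    linarith
  have hR₀lam : R₀ ≤ T.scale := by
    have := le_abs_self R₀
    linarith
  have hKρ2 : K ^ 2 / T.scale ≤ ρ / 2 := by
    rw [hρ, inv_eq_one_div, div_div, div_le_div_iff₀ hlam0 (by positivity)]
    have h1 : K ^ 2 * (b * K ^ (2 * k) * 2) ≤ 2 * b * K ^ (2 * k + 4) := by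
      calc _ = 2 * b * K ^ (2 * k + 2) := by ring
        _ ≤ _ := mul_le_mul_of_nonneg_left (hKpow _ (by omega)) (by linarith)
    linarith
  have hνρ : L' * (L * (4 * ρ)) ≤ 2 * ν ^ 2 := by
    have h1 : 2 * ν ^ 2 = (2 * 4 ^ k * K ^ (2 * k))⁻¹ := by
      rw [hν, mul_pow, inv_pow, mul_pow, mul_pow, ← pow_mul, ← pow_mul, mul_comm k 2, pow_mul 2 2 k]
      field_simp
      norm_num
    rw [h1, hρ, ← mul_assoc, ← mul_assoc, ← div_eq_mul_inv, inv_eq_one_div,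
      div_le_div_iff₀ (by positivity) (by positivity)]
    calc L' * L * 4 * (2 * 4 ^ k * K ^ (2 * k)) = 8 * 4 ^ k * (L' * L) * K ^ (2 * k) := by ring
      _ ≤ 1 * (b * K ^ (2 * k)) := by
        rw [one_mul]
        gcongr
        linarith
  have hν4 : 4 * ν ^ 2 = ((K⁻¹ / 2) ^ 2) ^ k := by
    rw [hν, ← pow_mul, mul_comm 2 k, pow_mul, div_eq_mul_inv, ← mul_inv, mul_comm K 2, mul_inv,
      ← inv_pow]
    ring
  obtain ⟨cell, Ω, hcell, hcellρ, hΩ, hΩcard⟩ := exists_rounding d hρ0 hρ1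
  -- Spatial rounding at `ρ / 2` leaves another `ρ / 2` for the distance from a point of the
  -- rescaled ball to its centre.
  obtain ⟨xcell, Ξ, -, hxcell, hΞ, hΞcard⟩ :=
    exists_rounding (d + 1) (half_pos hρ0) (by linarith : ρ / 2 ≤ 1)
  choose ι hι S β hSloc hSsupp hβ0 hβ hβsum hS using
    hCs T rfl K ρ A hK hρ0 hρ1 hKρ hKlam hA
  set E : ℝ := Cs * A * (K ^ 2) ^ (d + 2) * T.scale⁻¹ ^ (d + 1) with hE
  have hE0 : 0 ≤ E := by positivity
  have hEA : A * (K ^ 2 / T.scale) ^ (d + 1) ≤ E := by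
    have h1 : (K ^ 2) ^ (d + 1) ≤ (K ^ 2) ^ (d + 2) :=
      pow_le_pow_right₀ (one_le_pow₀ hK) (by omega)
    calc A * (K ^ 2 / T.scale) ^ (d + 1)
        = 1 * A * (K ^ 2) ^ (d + 1) * T.scale⁻¹ ^ (d + 1) := by
          rw [div_eq_mul_inv, mul_pow]
          ring
      _ ≤ _ := by
          rw [hE]
          gcongr
  set V : ℝ := Cv * (3 * (T.scale * K ^ 2)) ^ (d + 1) with hV
  have hV0 : 0 ≤ V := by positivity
  obtain ⟨hv1, hv⟩ := volume_closedBall_add_le hCv1 hCv hK (by linarith) hRlam hlam1 y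
  rw [← hV] at hv1 hv
  obtain ⟨U, hUcard, hU, hbroad⟩ := exists_broadNorm_le (P := P) (ν := ν) Q hK hp hk hkd hA'
    (hA (d + 1) (by omega)) hf hcell hΩ hcellρ hKρ2 hEA hS hΞ hxcell
    (fun x y ω s hx hω hωD hdet => cellsTransverse_of_le_det_gram T.amp_support
      T.rank_mixedHessian hL0 hL hL' hρ0.le hνρ (hx.trans (by linarith)) hω hωD (hν4 ▸ hdet))
    hv1 hv
  set Y : ℝ := max CM 0 * ν ^ (-C₀) * ((3 + |R₀|) * K ^ 2 * R) ^ ε *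
    (Cs ^ k * (ρ⁻¹ ^ (N₀ + 1) * A)) with hY
  have hνC : 0 ≤ ν ^ (-C₀) := Real.rpow_nonneg hν0.le _
  have hRε : 0 ≤ ((3 + |R₀|) * K ^ 2 * R) ^ ε := Real.rpow_nonneg (by positivity) _
  have hY0 : 0 ≤ Y := by positivity
  have hterm : ∀ t ∈ U, eLpNorm (meanOp (fun j => S t.1 (t.2.2 j))
      (fun j => cellPiece P cell (t.2.1 j) (t.2.2 j) f)) (ENNReal.ofReal p)
        (volume.restrict (Metric.closedBall y (R + 2 * K ^ 2))) ≤
      ENNReal.ofReal Y * HormanderOperator.l2Norm f := by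
    intro t ht
    obtain ⟨htc, htr⟩ := hU t ht
    refine eLpNorm_meanOp_le hk hp hε hML (β := fun j => β t.1 (t.2.2 j))
      (fun j i => ⟨h𝒯 T hT _ (hSloc _ _ i), (hSloc _ _ i).2.1, (hSloc _ _ i).1⟩)
      (fun j i => hβ0 _ _ i) (fun j i => hβ _ _ i) (by linarith) (by positivity)
      (fun j => hβsum _ _) (fun j => memLp_cellPiece (hcell _) (htc j) hf)
      (fun j => l2Norm_cellPiece_le (htc j) f) y hν0 hν1 (fun i x ω hx => ?_) hR hRlam hK hR₀lam
    have h1 := htr x ω fun j => ⟨(hSloc _ _ (i j)).2.2 (hx j), hSsupp _ _ (i j) (hx j)⟩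
    simpa only [(hSloc _ _ _).2.1] using h1
  have hρinv : ρ⁻¹ = b * K ^ (2 * k) := inv_inv _
  have hD : (Ω.card : ℝ) ≤ cD * K ^ (2 * k * d) := by
    refine hΩcard.trans (le_of_eq ?_)
    rw [div_eq_mul_inv, hρinv, hcD, pow_mul K (2 * k) d, ← mul_pow, mul_assoc _ b]
  -- The power `λ^{-(d+1)}` in the error cancels `λ^{d+1}` in the volume. This fixes the order `d +
  -- 1` of the Taylor expansions, and with it the number of derivatives of the amplitude.
  have hEV : E * V ≤ cE * K ^ (4 * d + 6) * A := by
    have h1 : T.scale⁻¹ ^ (d + 1) * T.scale ^ (d + 1) = 1 := by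
      rw [← mul_pow, inv_mul_cancel₀ hlam0.ne', one_pow]
    calc E * V = Cs * Cv * 3 ^ (d + 1) * ((K ^ 2) ^ (d + 2) * (K ^ 2) ^ (d + 1)) * A *
          (T.scale⁻¹ ^ (d + 1) * T.scale ^ (d + 1)) := by
          rw [hE, hV, mul_pow, mul_pow]
          ring
      _ = cE * K ^ (4 * d + 6) * A := by
          rw [h1, mul_one, hcE, ← pow_add, ← pow_mul]
          ring_nf
      _ ≤ _ := le_rfl
  have hUc : (U.card : ℝ) ≤ cU * K ^ (2 * k * (d + 1) + (d * k + 2 * k * d * k)) := by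
    refine hUcard.trans ?_
    calc (Ξ.card : ℝ) * ((M * (3 * K) ^ d) ^ k * Ω.card ^ k)
        ≤ (5 * ((d + 1 : ℕ) + 1) / (ρ / 2)) ^ (d + 1) *
          ((M * (3 * K) ^ d) ^ k * (cD * K ^ (2 * k * d)) ^ k) := by gcongr
      _ = (5 * (d + 2) * (2 * (b * K ^ (2 * k)))) ^ (d + 1) *
          ((M * (3 * K) ^ d) ^ k * (cD * K ^ (2 * k * d)) ^ k) := by
          rw [← hρinv]
          push_cast
          field_simp
          ring
      _ = _ := card_bound_eq _ _ _ _ d k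
  have hYc : Y ≤ cY * K ^ (k * ⌈|C₀|⌉₊ + 2 * ⌈ε⌉₊ + 2 * k * (N₀ + 1)) * R ^ ε * A := by
    have h1 := rpow_neg_le_pow hK k C₀
    have h2 := mul_rpow_le_pow (ε := ε) hK hR (show 0 ≤ 3 + |R₀| by positivity)
    calc Y ≤ max CM 0 * ((2 * 2 ^ k) ^ ⌈|C₀|⌉₊ * K ^ (k * ⌈|C₀|⌉₊)) *
          ((3 + |R₀|) ^ ε * K ^ (2 * ⌈ε⌉₊) * R ^ ε) *
          (Cs ^ k * ((b * K ^ (2 * k)) ^ (N₀ + 1) * A)) := by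
          rw [hY, hρinv]
          gcongr
      _ = _ := mult_bound_eq _ _ _ _ _ _ _ _ _ _ _ _
  have hreal := combine_polynomial_bounds (m := 2 * (M + 1)) hK (Real.one_le_rpow hR hε.le) hA0
    (by positivity) hCl0 (Nat.cast_nonneg _) (Nat.cast_nonneg _) (by positivity) hY0 hcE0 hcY0
    hD hEV hUc hYc
  refine hbroad.trans ?_
  have hM : (2 * (M + 1) : ℝ≥0∞) = ENNReal.ofReal (2 * (M + 1)) := by
    rw [ENNReal.ofReal_mul zero_le_two, ENNReal.ofReal_add (Nat.cast_nonneg _) zero_le_one]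
    simp
  have herr : ENNReal.ofReal (2 * Ω.card * (E * l1Norm f)) * ENNReal.ofReal V ≤
      ENNReal.ofReal (2 * Ω.card * (E * V) * Cl) * HormanderOperator.l2Norm f := by
    calc _ = ENNReal.ofReal (2 * Ω.card * (E * V)) * ENNReal.ofReal (l1Norm f) := by
          rw [← ENNReal.ofReal_mul (mul_nonneg (by positivity) (mul_nonneg hE0 (l1Norm_nonneg f))),
            ← ENNReal.ofReal_mul (by positivity)]
          congr 1
          ring
      _ ≤ ENNReal.ofReal (2 * Ω.card * (E * V)) *
          (ENNReal.ofReal Cl * HormanderOperator.l2Norm f) := by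
          gcongr
          exact hCl f hf
      _ = _ := by
          rw [← mul_assoc, ← ENNReal.ofReal_mul (by positivity)]
  have hmain : ∑ t ∈ U, ENNReal.ofReal (2 * Ω.card) * eLpNorm (meanOp (fun j => S t.1 (t.2.2 j))
      (fun j => cellPiece P cell (t.2.1 j) (t.2.2 j) f)) (ENNReal.ofReal p)
        (volume.restrict (Metric.closedBall y (R + 2 * K ^ 2))) ≤
      ENNReal.ofReal (U.card * (2 * Ω.card) * Y) * HormanderOperator.l2Norm f := by
    refine (Finset.sum_le_sum fun t ht => mul_le_mul_right (hterm t ht) _).trans (le_of_eq ?_)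
    rw [Finset.sum_const, nsmul_eq_mul, ENNReal.ofReal_mul (p := U.card * (2 * Ω.card))
      (by positivity), ENNReal.ofReal_mul (p := U.card) (by positivity), ENNReal.ofReal_natCast]
    ring
  calc _ ≤ ENNReal.ofReal (2 * (M + 1)) *
        (ENNReal.ofReal (2 * Ω.card * (E * V) * Cl) * HormanderOperator.l2Norm f +
          ENNReal.ofReal (U.card * (2 * Ω.card) * Y) * HormanderOperator.l2Norm f) := by
        rw [hM]
        gcongr
    _ = ENNReal.ofReal (2 * (M + 1) *
          (2 * Ω.card * (E * V) * Cl + U.card * (2 * Ω.card) * Y)) *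
          HormanderOperator.l2Norm f := by
        rw [← add_mul, ← mul_assoc, ← ENNReal.ofReal_add (by positivity) (by positivity),
          ← ENNReal.ofReal_mul (by positivity)]
    _ ≤ _ := by
        rw [hAeq, ← mul_assoc (ENNReal.ofReal (_ * R ^ ε)), ← ENNReal.ofReal_mul (by positivity)]
        exact mul_le_mul_left (ENNReal.ofReal_le_ofReal hreal) _

/-- When `λ` is at most a power of `K`, so is the volume of the region of integration, up to a
constant, and the bound of `T f` by the `L¹` norm suffices. -/
theorem exists_broadNorm_le_of_small {k : ℕ} (hkd : k ≤ d + 1) {p : ℝ} (hp : 1 ≤ p) {Λ : ℝ}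
    (hΛ : 0 ≤ Λ) (e M N : ℕ) :
    ∃ C : ℝ, 0 ≤ C ∧ ∀ (T : HormanderOperator d) (K R : ℝ) (y : Space d)
      (P : CapDecomposition d K M) (Q : SpatialCover d T.scale K M) (f : Freq d → ℂ),
      1 ≤ K → 1 ≤ R → R ≤ T.scale → MemLp f 2 (volume.restrict (Metric.closedBall 0 1)) →
      T.scale ≤ Λ * K ^ e →
      T.broadNorm P Q p k 1 f (Metric.closedBall y R) ≤
        ENNReal.ofReal (C * K ^ ((e + 2) * (d + 1))) *
          (ampNorm N T.amp * HormanderOperator.l2Norm f) := by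
  obtain ⟨Cv, hCv1, hCv⟩ := exists_volume_closedBall_le d
  obtain ⟨Cl, hCl0, hCl⟩ := exists_l1Norm_le d
  refine ⟨2 * (M + 1) * (Cv * (3 * Λ) ^ (d + 1) * Cl), by positivity, ?_⟩
  intro T K R y P Q f hK hR hRlam hf hsmall
  have hlam1 := T.one_le_scale
  have hlam0 : 0 < T.scale := by linarith
  obtain ⟨A, hA0, hAeq, hA⟩ := exists_ampNorm_eq T.amp_smooth T.amp_support N
  have hA' : ∀ z, |T.amp z| ≤ A := fun z => by
    rw [← Real.norm_eq_abs, ← norm_iteratedFDeriv_zero (𝕜 := ℝ)]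
    exact hA 0 (Nat.zero_le _) z
  obtain ⟨hv1, hv⟩ := volume_closedBall_add_le hCv1 hCv hK (by linarith) hRlam hlam1 y
  refine (broadNorm_le_trivial Q hp hkd hA' hf hv1 hv).trans ?_
  have hM : (2 * (M + 1) : ℝ≥0∞) = ENNReal.ofReal (2 * (M + 1)) := by
    rw [ENNReal.ofReal_mul zero_le_two, ENNReal.ofReal_add (Nat.cast_nonneg _) zero_le_one]
    simp
  have hV : Cv * (3 * (T.scale * K ^ 2)) ^ (d + 1) ≤
      Cv * (3 * Λ) ^ (d + 1) * K ^ ((e + 2) * (d + 1)) := by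
    calc Cv * (3 * (T.scale * K ^ 2)) ^ (d + 1)
        ≤ Cv * (3 * (Λ * K ^ e * K ^ 2)) ^ (d + 1) := by gcongr
      _ = _ := by
        rw [pow_mul, mul_assoc Cv, ← mul_pow]
        ring
  rw [hM, hAeq, ENNReal.ofReal_mul hA0]
  calc _ ≤ ENNReal.ofReal (2 * (M + 1)) * (ENNReal.ofReal A *
        (ENNReal.ofReal Cl * HormanderOperator.l2Norm f) *
        ENNReal.ofReal (Cv * (3 * Λ) ^ (d + 1) * K ^ ((e + 2) * (d + 1)))) := by
        gcongr
        exact hCl f hf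
    _ = ENNReal.ofReal (2 * (M + 1)) * ENNReal.ofReal Cl *
        ENNReal.ofReal (Cv * (3 * Λ) ^ (d + 1) * K ^ ((e + 2) * (d + 1))) *
        (ENNReal.ofReal A * HormanderOperator.l2Norm f) := by ring
    _ = _ := by
        rw [← ENNReal.ofReal_mul (by positivity), ← ENNReal.ofReal_mul (by positivity)]
        congr 2
        ring

end HormanderOp

end

/-- If the `k`-linear inequality holds for the transverse `k`-tuples from a class `𝒯` of
Hörmander-type operators which is closed under translation and under localisation of the amplitude,
then the `k`-broad inequality holds for all operators in `𝒯`. Here `n = d + 1`. -/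
theorem proposition6p4 (d k : ℕ) (hk : 2 ≤ k) (hkd : k ≤ d + 1) (ε : ℝ) (hε : 0 < ε)
    (C₀ R₀ : ℝ) (N₀ : ℕ) :
    ∃ (C₁ : ℝ) (N₁ : ℕ), ∀ (p : ℝ), 2 ≤ p → ∀ 𝒯 : Set (HormanderOperator d),
      HormanderOperator.ClosedUnderTranslation 𝒯 →
      HormanderOperator.ClosedUnderLocalisation 𝒯 →
      HormanderOperator.MultilinearEstimate 𝒯 k p ε C₀ R₀ N₀ →
      HormanderOperator.BroadEstimate 𝒯 k p ε C₁ N₁ := by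
  -- The exponent is the sum of those for large and small scales. Among the derivatives of the
  -- amplitude, `1` is lost to the non-negative majorant and `d + 1` are reserved for the Taylor
  -- expansion.
  refine ⟨(HormanderOp.broadExponent d k N₀ C₀ ε + (2 * k + 4 + 2) * (d + 1) : ℕ), N₀ + 1 + (d + 1), ?_⟩
  intro p hp 𝒯 _ h𝒯 hML M φ
  -- Smoothness and H1 for `φ` come from a member of the class with this phase; without such a
  -- member nothing is claimed about `φ`.
  by_cases hex : ∃ T ∈ 𝒯, T.phase = φ
  swap
  · exact ⟨0, fun T hT hφ => absurd ⟨T, hT, hφ⟩ hex⟩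
  obtain ⟨T₀, -, rfl⟩ := hex
  obtain ⟨CM, hCM⟩ := hML fun _ => T₀.phase
  obtain ⟨Λ, C, hΛ, hC, hlarge⟩ := HormanderOp.exists_broadNorm_le_of_large (by omega) hkd h𝒯
    (by linarith : 1 ≤ p) hε T₀.phase_smooth T₀.rank_mixedHessian hCM M
  obtain ⟨C', hC', hsmall⟩ := HormanderOp.exists_broadNorm_le_of_small (d := d) hkd (by linarith : 1 ≤ p) hΛ
    (2 * k + 4) M (N₀ + 1 + (d + 1))
  refine ⟨C + C', fun T hT hφ K R y P Q f hK hR hRlam hf => ?_⟩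
  have hRε : 1 ≤ R ^ ε := Real.one_le_rpow hR hε.le
  rw [Real.rpow_natCast]
  -- In the second case the factor `R ^ ε ≥ 1` is inserted for free.
  rcases le_total (Λ * K ^ (2 * k + 4)) T.scale with h | h
  · refine (hlarge T hT hφ K R y P Q f hK hR hRlam hf h).trans ?_
    gcongr
    · linarith
    · omega
  · refine (hsmall T K R y P Q f hK hR hRlam hf h).trans ?_
    refine mul_le_mul_left (ENNReal.ofReal_le_ofReal ?_) _
    calc C' * K ^ ((2 * k + 4 + 2) * (d + 1)) = C' * K ^ ((2 * k + 4 + 2) * (d + 1)) * 1 :=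
          (mul_one _).symm
      _ ≤ _ := by
          have h1 : K ^ ((2 * k + 4 + 2) * (d + 1)) ≤
              K ^ (HormanderOp.broadExponent d k N₀ C₀ ε + (2 * k + 4 + 2) * (d + 1)) :=
            pow_le_pow_right₀ hK (by omega)
          gcongr
          linarith
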